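/- Let $G$ be a countable discrete group, let $(d_n)_{n\in\mathbb N}$ be positive integers, and let $\sigma_n\colon G\to \mathrm{Sym}(d_n)$ be approximate homomorphisms, i.e. $\lim_{n\to\infty} d_{\mathrm{Hamm}}(\sigma_n(gh),\sigma_n(g)\sigma_n(h))=0$ for all $g,h\in G$, where $d_{\mathrm{Hamm}}(p,q)=\frac1k|\{i: p(i)\neq q(i)\}|$ on $\mathrm{Sym}(k)$. Let $\omega$ be a free ultrafilter on $\mathbb N$ with $\lim_{n\to\omega}d_n=\infty$ (automatic if $d_n\to\infty$). Notation. Let $\mathcal S_\omega=\prod_{n\to\omega}(\mathrm{Sym}(d_n),d_{\mathrm{Hamm}})$ be the group of all sequences of permutations modulo those with $\lim_{n\to\omega}d_{\mathrm{Hamm}}(p_n,1)=0$, and $\sigma_\omega(g)=(\sigma_n(g))_{n\to\omega}\in\mathcal S_\omega$. Let $\mathcal M=\prod_{n\to\omega}(M_{d_n}(\mathbb C),\mathrm{tr})$ be the algebra of operator-norm bounded sequences modulo those with $\lim_{n\to\omega}\|x_n\|_2=0$, with trace $\tau_\omega((x_n)_{n\to\omega})=\lim_{n\to\omega}\mathrm{tr}(x_n)$,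 where $\mathrm{tr}$ is the normalized trace and $\|x\|_2=\mathrm{tr}(x^*x)^{1/2}$. Through diagonal matrices and permutation matrices, $L^\infty(\mathcal L,u_\omega)=\prod_{n\to\omega}(\ell^\infty(d_n),u_{d_n})$ is a $*$-subalgebra of $\mathcal M$ and $\mathcal S_\omega$ is a subgroup of its unitary group. Let $S_n(j)(g)=1$ if $\sigma_n(g)(j)=j$ and $0$ otherwise, and let $\Theta=\mathrm{IRS}(\sigma_\omega)=\lim_{n\to\omega}(S_n)_*u_{d_n}$ be the weak$^*$ limit in $\mathrm{Prob}(\{0,1\}^G)$, where $u_{d_n}$ is the uniform measure on $\{1,\dots,d_n\}$. It is concentrated on the space $\mathrm{Sub}(G)\subseteq\{0,1\}^G$ of subgroups of $G$. Let $$Y=\{(H,x)\in \mathrm{Sub}(G)\times[0,1]^G : x(hg)=x(g)\text{ for all } g\in G,\ h\in H\},\qquad \mu_\Theta=\int_{\mathrm{Sub}(G)}\delta_H\otimes m^{\otimes G/H}\,d\Theta(H),$$ where $m$ is Lebesgue measure on $[0,1]$, $G/H$ is the set of right cosets $Hg$, and $m^{\otimes G/H}$ is viewed as a measure on $[0,1]^G$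 concentrated on the functions that are constant on right $H$-cosets. Let $G$ act on $Y$ by $g\cdot(H,x)=(gHg^{-1},gx)$ with $(gx)(a)=x(g^{-1}a)$ (the $\Theta$-Bernoulli action with base $([0,1],m)$), let $\mathcal R$ be its orbit equivalence relation, and let $[\mathcal R]$ be the full group: measure-preserving Borel automorphisms $\gamma$ of $(Y,\mu_\Theta)$ with $\gamma(y)\in[y]_{\mathcal R}$ for almost every $y$, modulo almost everywhere equality. Theorem. The measure $\mu_\Theta$ is a probability measure, for every $g\in G$ the map $\Xi(g)(y)=gy$ defines an element of $[\mathcal R]$, and there is a sofic approximation $(\rho,\widehat\sigma)$ of $\mathcal R$ with $\widehat\sigma\circ\Xi=\sigma_\omega$. That is, there are a normal $*$-homomorphism $\rho\colon L^\infty(Y,\mu_\Theta)\to L^\infty(\mathcal L,u_\omega)$ and a group homomorphism $\widehat\sigma\colon[\mathcal R]\to\mathcal S_\omega$ such that, for all $f\in L^\infty(Y,\mu_\Theta)$ and $\gamma\in[\mathcal R]$, $$\tau_\omega(\rho(f)\widehat\sigma(\gamma))=\int_{\{y:\gamma(y)=y\}}f\,d\mu_\Theta,\qquad \widehat\sigma(\gamma)\rho(f)\widehat\sigma(\gamma)^{-1}=\rho(f\circ\gamma^{-1}),$$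 and such that $\widehat\sigma(\Xi(g))=\sigma_\omega(g)$ for every $g\in G$. -/

import Mathlib

open MeasureTheory Filter Topology
open scoped ENNReal

noncomputable section

namespace SoficExtension

/-! ### Symmetric groups, approximate homomorphisms and the group ultraproduct -/

/-- The normalized Hamming distance on `Sym(k)`. -/
def hammDist {k : ℕ} (p q : Equiv.Perm (Fin k)) : ℝ :=
  ((Finset.univ.filter fun i => p i ≠ q i).card : ℝ) / k

/-- `σ n : G → Sym(d n)` are approximate (asymptotic) homomorphisms. -/
def IsApproxHom {G : Type*} [Group G] {d : ℕ → ℕ} (σ : ∀ n, G → Equiv.Perm (Fin (d n))) : Prop :=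
  ∀ g h : G, Tendsto (fun n => hammDist (σ n (g * h)) (σ n g * σ n h)) atTop (𝓝 0)

theorem hammDist_nonneg {k : ℕ} (p q : Equiv.Perm (Fin k)) : 0 ≤ hammDist p q := by
  unfold hammDist; positivity

theorem hammDist_mul_one_le {k : ℕ} (p q : Equiv.Perm (Fin k)) :
    hammDist (p * q) 1 ≤ hammDist p 1 + hammDist q 1 := by
  classical
  unfold hammDist
  rw [← add_div]
  apply div_le_div_of_nonneg_right _ (Nat.cast_nonneg k)
  rw [← Nat.cast_add, Nat.cast_le]
  refine (Finset.card_le_card ?_).trans (Finset.card_union_le _ _)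
  intro i hi
  rw [Finset.mem_filter] at hi
  rw [Finset.mem_union, Finset.mem_filter, Finset.mem_filter]
  by_contra hc
  simp only [Finset.mem_univ, true_and, not_or, not_not] at hc
  refine hi.2 ?_
  change p (q i) = i
  have h2 : q i = i := hc.2
  rw [h2]
  exact hc.1

theorem hammDist_inv_one {k : ℕ} (p : Equiv.Perm (Fin k)) :
    hammDist p⁻¹ 1 = hammDist p 1 := by
  unfold hammDist
  congr 2
  refine congrArg Finset.card (Finset.ext fun i => ?_)
  rw [Finset.mem_filter, Finset.mem_filter]
  refine and_congr_right fun _ => not_congr ?_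
  change p⁻¹ i = i ↔ p i = i
  rw [Equiv.Perm.inv_eq_iff_eq, eq_comm]

theorem hammDist_conj_one {k : ℕ} (p q : Equiv.Perm (Fin k)) :
    hammDist (q * p * q⁻¹) 1 = hammDist p 1 := by
  unfold hammDist
  congr 2
  refine Finset.card_bij (fun i _ => q⁻¹ i) ?_ ?_ ?_
  · intro i hi
    rw [Finset.mem_filter] at hi ⊢
    refine ⟨Finset.mem_univ _, fun h => hi.2 ?_⟩
    change q (p (q⁻¹ i)) = i
    have h' : p (q⁻¹ i) = q⁻¹ i := h
    rw [h']
    exact Equiv.apply_symm_apply q i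
  · intro a _ b _ h
    exact q⁻¹.injective h
  · intro b hb
    rw [Finset.mem_filter] at hb
    refine ⟨q b, ?_, by simp⟩
    rw [Finset.mem_filter]
    refine ⟨Finset.mem_univ _, fun h => hb.2 ?_⟩
    have h' : q (p (q⁻¹ (q b))) = q b := h
    rw [show q⁻¹ (q b) = b from Equiv.symm_apply_apply q b] at h'
    exact q.injective h'

/-- Sequences of permutations with `lim_{n → ω} d_Hamm(p n, 1) = 0`. -/
def permNull (ω : Ultrafilter ℕ) (d : ℕ → ℕ) : Subgroup (∀ n, Equiv.Perm (Fin (d n))) where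
  carrier := {p | Tendsto (fun n => hammDist (p n) 1) ω (𝓝 0)}
  mul_mem' {p q} hp hq := by
    have h := Tendsto.add hp hq
    rw [add_zero] at h
    exact squeeze_zero (fun n => hammDist_nonneg _ _) (fun n => hammDist_mul_one_le _ _) h
  one_mem' := by simp [hammDist]
  inv_mem' {p} hp := by
    have h : Tendsto (fun n => hammDist (p n) 1) ω (𝓝 0) := hp
    change Tendsto (fun n => hammDist (p n)⁻¹ 1) ω (𝓝 0)
    simpa only [hammDist_inv_one] using h

instance permNull_normal (ω : Ultrafilter ℕ) (d : ℕ → ℕ) : (permNull ω d).Normal where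
  conj_mem p hp q := by
    have h : Tendsto (fun n => hammDist (p n) 1) ω (𝓝 0) := hp
    change Tendsto (fun n => hammDist (q n * p n * (q n)⁻¹) 1) ω (𝓝 0)
    simpa only [hammDist_conj_one] using h

/-- The group ultraproduct `𝒮_ω = ∏_{n → ω} (Sym(d n), d_Hamm)`. -/
abbrev PermUltra (ω : Ultrafilter ℕ) (d : ℕ → ℕ) : Type :=
  (∀ n, Equiv.Perm (Fin (d n))) ⧸ permNull ω d

/-- The ultraproduct map `σ_ω(g) = (σ n g)_{n → ω}`. -/
def ultraMap {G : Type*} (ω : Ultrafilter ℕ) {d : ℕ → ℕ} (σ : ∀ n, G → Equiv.Perm (Fin (d n)))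
    (g : G) : PermUltra ω d :=
  QuotientGroup.mk (fun n => σ n g)

/-! ### The tracial ultraproduct of matrix algebras -/

/-- The normalized trace on `M_k(ℂ)`. -/
def tr {k : ℕ} (A : Matrix (Fin k) (Fin k) ℂ) : ℂ := (k : ℂ)⁻¹ * A.trace

/-- The `2`-norm `‖A‖₂ = tr(A* A)^{1/2}` on `M_k(ℂ)`. -/
def norm2 {k : ℕ} (A : Matrix (Fin k) (Fin k) ℂ) : ℝ := Real.sqrt (tr (star A * A)).re

theorem norm2_eq_sum {k : ℕ} (A : Matrix (Fin k) (Fin k) ℂ) :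
    norm2 A = Real.sqrt ((k : ℝ)⁻¹ * ∑ j, ∑ i, ‖A i j‖ ^ 2) := by
  unfold norm2 tr
  congr 1
  have h : (star A * A).trace = ((∑ j, ∑ i, ‖A i j‖ ^ 2 : ℝ) : ℂ) := by
    simp only [Matrix.trace, Matrix.diag_apply, Matrix.mul_apply, Matrix.star_apply]
    push_cast
    refine Finset.sum_congr rfl fun j _ => Finset.sum_congr rfl fun i _ => ?_
    rw [RCLike.star_def, RCLike.conj_mul]
    simp
  rw [h, ← Complex.ofReal_natCast, ← Complex.ofReal_inv, ← Complex.ofReal_mul, Complex.ofReal_re]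

theorem norm2_eq_euclidean {k : ℕ} (A : Matrix (Fin k) (Fin k) ℂ) :
    norm2 A = Real.sqrt ((k : ℝ)⁻¹) *
      ‖(WithLp.toLp 2 (fun p : Fin k × Fin k => A p.2 p.1) : EuclideanSpace ℂ (Fin k × Fin k))‖ := by
  rw [norm2_eq_sum, Real.sqrt_mul (by positivity), EuclideanSpace.norm_eq]
  congr 2
  rw [Fintype.sum_prod_type]

theorem norm2_nonneg {k : ℕ} (A : Matrix (Fin k) (Fin k) ℂ) : 0 ≤ norm2 A := Real.sqrt_nonneg _

theorem norm2_zero {k : ℕ} : norm2 (0 : Matrix (Fin k) (Fin k) ℂ) = 0 := by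
  rw [norm2_eq_sum]; simp

theorem norm2_add_le {k : ℕ} (A B : Matrix (Fin k) (Fin k) ℂ) :
    norm2 (A + B) ≤ norm2 A + norm2 B := by
  simp only [norm2_eq_euclidean]
  rw [← mul_add]
  refine mul_le_mul_of_nonneg_left ?_ (Real.sqrt_nonneg _)
  refine le_trans (le_of_eq ?_) (norm_add_le _ _)
  rfl

theorem norm2_star {k : ℕ} (A : Matrix (Fin k) (Fin k) ℂ) : norm2 (star A) = norm2 A := by
  rw [norm2_eq_sum, norm2_eq_sum, Finset.sum_comm]
  simp [Matrix.star_apply]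

section
open scoped Matrix.Norms.L2Operator

/-- The operator norm on `M_k(ℂ)` acting on the Hilbert space `ℂ^k`. -/
def opNorm {k : ℕ} (A : Matrix (Fin k) (Fin k) ℂ) : ℝ := ‖A‖

theorem opNorm_nonneg {k : ℕ} (A : Matrix (Fin k) (Fin k) ℂ) : 0 ≤ opNorm A := norm_nonneg A

theorem opNorm_add_le {k : ℕ} (A B : Matrix (Fin k) (Fin k) ℂ) :
    opNorm (A + B) ≤ opNorm A + opNorm B := norm_add_le A B

theorem opNorm_mul_le {k : ℕ} (A B : Matrix (Fin k) (Fin k) ℂ) :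
    opNorm (A * B) ≤ opNorm A * opNorm B := norm_mul_le A B

theorem opNorm_star {k : ℕ} (A : Matrix (Fin k) (Fin k) ℂ) : opNorm (star A) = opNorm A :=
  Matrix.l2_opNorm_conjTranspose A

theorem opNorm_algebraMap_le {k : ℕ} (r : ℂ) :
    opNorm (algebraMap ℂ (Matrix (Fin k) (Fin k) ℂ) r) ≤ ‖r‖ := by
  unfold opNorm
  rw [Matrix.algebraMap_eq_diagonal, Matrix.l2_opNorm_diagonal]
  exact (pi_norm_le_iff_of_nonneg (norm_nonneg r)).2 fun i => by simp

theorem norm2_mul_le {k : ℕ} (A B : Matrix (Fin k) (Fin k) ℂ) :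
    norm2 (A * B) ≤ opNorm A * norm2 B := by
  have key : ∀ j, ∑ i, ‖(A * B) i j‖ ^ 2 ≤ opNorm A ^ 2 * ∑ i, ‖B i j‖ ^ 2 := by
    intro j
    have h := Matrix.l2_opNorm_mulVec A (WithLp.toLp 2 (fun i => B i j) : EuclideanSpace ℂ (Fin k))
    have h2 := pow_le_pow_left₀ (norm_nonneg _) h 2
    rw [mul_pow, EuclideanSpace.norm_sq_eq, EuclideanSpace.norm_sq_eq] at h2
    exact h2
  rw [norm2_eq_sum, norm2_eq_sum]
  rw [← Real.sqrt_sq (opNorm_nonneg A), ← Real.sqrt_mul (sq_nonneg _)]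
  apply Real.sqrt_le_sqrt
  rw [mul_left_comm]
  refine mul_le_mul_of_nonneg_left ?_ (by positivity)
  rw [Finset.mul_sum]
  exact Finset.sum_le_sum fun j _ => key j

end

theorem norm2_mul_le' {k : ℕ} (A B : Matrix (Fin k) (Fin k) ℂ) :
    norm2 (A * B) ≤ norm2 A * opNorm B := by
  rw [← norm2_star (A * B), star_mul, mul_comm (norm2 A), ← norm2_star A, ← opNorm_star B]
  exact norm2_mul_le _ _

theorem norm_tr_le {k : ℕ} (A : Matrix (Fin k) (Fin k) ℂ) : ‖tr A‖ ≤ norm2 A := by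
  rw [norm2_eq_sum]
  apply Real.le_sqrt_of_sq_le
  unfold tr
  rw [norm_mul, mul_pow, norm_inv, Complex.norm_natCast]
  have h1 : ‖A.trace‖ ^ 2 ≤ k * ∑ j, ‖A j j‖ ^ 2 := by
    have h := pow_le_pow_left₀ (norm_nonneg _) (norm_sum_le Finset.univ fun j => A j j) 2
    refine h.trans ?_
    simpa using sq_sum_le_card_mul_sum_sq (s := Finset.univ) (f := fun j => ‖A j j‖)
  have h2 : ∑ j, ‖A j j‖ ^ 2 ≤ ∑ j, ∑ i, ‖A i j‖ ^ 2 :=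
    Finset.sum_le_sum fun j _ =>
      Finset.single_le_sum (f := fun i => ‖A i j‖ ^ 2) (fun i _ => by positivity)
        (Finset.mem_univ j)
  rcases Nat.eq_zero_or_pos k with rfl | hk
  · simp
  · have hk' : (0 : ℝ) < k := by exact_mod_cast hk
    calc ((k : ℝ)⁻¹) ^ 2 * ‖A.trace‖ ^ 2 ≤ ((k : ℝ)⁻¹) ^ 2 * (k * ∑ j, ‖A j j‖ ^ 2) := by gcongr
      _ = (k : ℝ)⁻¹ * ∑ j, ‖A j j‖ ^ 2 := by field_simp
      _ ≤ _ := by gcongr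

theorem norm2_one_le {k : ℕ} : norm2 (1 : Matrix (Fin k) (Fin k) ℂ) ≤ 1 := by
  unfold norm2 tr
  rw [star_one, one_mul, Matrix.trace_one, Fintype.card_fin]
  rcases Nat.eq_zero_or_pos k with rfl | hk
  · simp
  · rw [inv_mul_cancel₀ (by exact_mod_cast hk.ne')]
    simp

theorem norm_tr_le_opNorm {k : ℕ} (A : Matrix (Fin k) (Fin k) ℂ) : ‖tr A‖ ≤ opNorm A := by
  refine (norm_tr_le A).trans ?_
  have h := norm2_mul_le A 1
  rw [mul_one] at h
  exact h.trans (mul_le_of_le_one_right (opNorm_nonneg A) norm2_one_le)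

/-- Norm-bounded sequences `(x_n)` with `x_n ∈ M_{d n}(ℂ)`. -/
def BddSeq (d : ℕ → ℕ) : StarSubalgebra ℂ (∀ n, Matrix (Fin (d n)) (Fin (d n)) ℂ) where
  carrier := {x | ∃ C : ℝ, ∀ n, opNorm (x n) ≤ C}
  mul_mem' := by
    rintro x y ⟨C, hC⟩ ⟨D, hD⟩
    exact ⟨C * D, fun n => (opNorm_mul_le _ _).trans
      (mul_le_mul (hC n) (hD n) (opNorm_nonneg _) ((opNorm_nonneg _).trans (hC n)))⟩
  add_mem' := by
    rintro x y ⟨C, hC⟩ ⟨D, hD⟩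
    exact ⟨C + D, fun n => (opNorm_add_le _ _).trans (add_le_add (hC n) (hD n))⟩
  algebraMap_mem' r := ⟨‖r‖, fun n => opNorm_algebraMap_le r⟩
  star_mem' := by
    rintro x ⟨C, hC⟩
    exact ⟨C, fun n => (opNorm_star (x n)).le.trans (hC n)⟩

/-- Bounded sequences with `lim_{n → ω} ‖x_n‖₂ = 0`. -/
def nullIdeal (ω : Ultrafilter ℕ) (d : ℕ → ℕ) : Ideal (BddSeq d) where
  carrier := {x | Tendsto (fun n => norm2 (x.1 n)) ω (𝓝 0)}
  add_mem' {x y} hx hy := by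
    have h := Tendsto.add hx hy
    rw [add_zero] at h
    exact squeeze_zero (fun n => norm2_nonneg _) (fun n => norm2_add_le _ _) h
  zero_mem' := by
    change Tendsto _ _ _
    simp [norm2_zero]
  smul_mem' := by
    rintro ⟨c, C, hC⟩ x hx
    have h : Tendsto (fun n => C * norm2 (x.1 n)) ω (𝓝 (C * 0)) := Tendsto.const_mul C hx
    rw [mul_zero] at h
    refine squeeze_zero (fun n => norm2_nonneg _) (fun n => ?_) h
    exact (norm2_mul_le _ _).trans (mul_le_mul_of_nonneg_right (hC n) (norm2_nonneg _))

instance nullIdeal_isTwoSided (ω : Ultrafilter ℕ) (d : ℕ → ℕ) : (nullIdeal ω d).IsTwoSided where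
  mul_mem_of_left := by
    rintro x ⟨c, C, hC⟩ hx
    have h : Tendsto (fun n => norm2 (x.1 n) * C) ω (𝓝 (0 * C)) := Tendsto.mul_const C hx
    rw [zero_mul] at h
    refine squeeze_zero (fun n => norm2_nonneg _) (fun n => ?_) h
    exact (norm2_mul_le' _ _).trans (mul_le_mul_of_nonneg_left (hC n) (norm2_nonneg _))

theorem star_mem_nullIdeal {ω : Ultrafilter ℕ} {d : ℕ → ℕ} {x : BddSeq d}
    (hx : x ∈ nullIdeal ω d) : star x ∈ nullIdeal ω d := by
  have h : Tendsto (fun n => norm2 (x.1 n)) ω (𝓝 0) := hx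
  change Tendsto (fun n => norm2 (star (x.1 n))) ω (𝓝 0)
  simpa only [norm2_star] using h

/-- The tracial ultraproduct `ℳ = ∏_{n → ω} (M_{d n}(ℂ), tr)`. -/
abbrev MatUltra (ω : Ultrafilter ℕ) (d : ℕ → ℕ) : Type := BddSeq d ⧸ nullIdeal ω d

/-- The involution of `ℳ`, `((x_n)_{n → ω})* = (x_n*)_{n → ω}`. -/
instance instStarRingMatUltra (ω : Ultrafilter ℕ) (d : ℕ → ℕ) : StarRing (MatUltra ω d) where
  star := Quotient.map' star (by
    intro a b hab
    rw [Submodule.quotientRel_def] at hab ⊢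
    have h := star_mem_nullIdeal hab
    rwa [star_sub] at h)
  star_involutive := by
    rintro ⟨x⟩
    exact congrArg (Ideal.Quotient.mk (nullIdeal ω d)) (star_star x)
  star_mul := by
    rintro ⟨x⟩ ⟨y⟩
    exact congrArg (Ideal.Quotient.mk (nullIdeal ω d)) (star_mul x y)
  star_add := by
    rintro ⟨x⟩ ⟨y⟩
    exact congrArg (Ideal.Quotient.mk (nullIdeal ω d)) (star_add x y)

instance instStarModuleMatUltra (ω : Ultrafilter ℕ) (d : ℕ → ℕ) : StarModule ℂ (MatUltra ω d) where
  star_smul := by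
    rintro c ⟨x⟩
    exact congrArg (Ideal.Quotient.mk (nullIdeal ω d)) (star_smul c x)

/-- `(x_n)_n ↦ (x_n)_{n → ω}`. -/
def matClass (ω : Ultrafilter ℕ) (d : ℕ → ℕ) : BddSeq d →⋆ₐ[ℂ] MatUltra ω d where
  toAlgHom := Ideal.Quotient.mkₐ ℂ (nullIdeal ω d)
  map_star' _ := rfl

theorem exists_lim_tr (ω : Ultrafilter ℕ) {d : ℕ → ℕ} (x : BddSeq d) :
    ∃ c : ℂ, Tendsto (fun n => tr (x.1 n)) ω (𝓝 c) := by
  obtain ⟨C, hC⟩ := x.2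
  have hcpt := isCompact_closedBall (0 : ℂ) C
  have hmem : ∀ᶠ n in (ω : Filter ℕ), tr (x.1 n) ∈ Metric.closedBall (0 : ℂ) C :=
    Eventually.of_forall fun n => by
      rw [mem_closedBall_zero_iff]
      exact (norm_tr_le_opNorm _).trans (hC n)
  obtain ⟨c, -, hc⟩ := hcpt.ultrafilter_le_nhds (ω.map fun n => tr (x.1 n))
    (le_principal_iff.2 hmem)
  exact ⟨c, hc⟩

/-- `(x_n)_n ↦ lim_{n → ω} tr(x_n)` on bounded sequences. -/
def limTr (ω : Ultrafilter ℕ) (d : ℕ → ℕ) : BddSeq d →ₗ[ℂ] ℂ where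
  toFun x := limUnder (ω : Filter ℕ) fun n => tr (x.1 n)
  map_add' x y := by
    obtain ⟨a, ha⟩ := exists_lim_tr ω x
    obtain ⟨b, hb⟩ := exists_lim_tr ω y
    rw [ha.limUnder_eq, hb.limUnder_eq]
    refine Tendsto.limUnder_eq ((ha.add hb).congr fun n => ?_)
    change _ = tr (x.1 n + y.1 n)
    simp [tr, Matrix.trace_add, mul_add]
  map_smul' c x := by
    obtain ⟨a, ha⟩ := exists_lim_tr ω x
    rw [ha.limUnder_eq]
    refine Tendsto.limUnder_eq ((ha.const_smul c).congr fun n => ?_)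
    change _ = tr (c • x.1 n)
    simp [tr, Matrix.trace_smul, mul_left_comm]

/-- The trace `τ_ω` on `ℳ`, `τ_ω((x_n)_{n → ω}) = lim_{n → ω} tr(x_n)`. -/
def traceUltra (ω : Ultrafilter ℕ) (d : ℕ → ℕ) : MatUltra ω d →ₗ[ℂ] ℂ :=
  ((nullIdeal ω d).restrictScalars ℂ).liftQ (limTr ω d) (by
    intro x hx
    have h : Tendsto (fun n => norm2 (x.1 n)) ω (𝓝 0) := hx
    rw [LinearMap.mem_ker]
    exact Tendsto.limUnder_eq (squeeze_zero_norm (fun n => norm_tr_le _) h))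

/-- Bounded sequences of diagonal matrices. -/
def diagSeq (d : ℕ → ℕ) : StarSubalgebra ℂ (BddSeq d) where
  carrier := {x | ∀ n, (x.1 n).IsDiag}
  mul_mem' := by
    intro x y hx hy n
    change (x.1 n * y.1 n).IsDiag
    rw [← (hx n).diagonal_diag, ← (hy n).diagonal_diag, Matrix.diagonal_mul_diagonal]
    exact Matrix.isDiag_diagonal _
  add_mem' := by
    intro x y hx hy n
    exact (hx n).add (hy n)
  algebraMap_mem' r n := by
    change (algebraMap ℂ (Matrix (Fin (d n)) (Fin (d n)) ℂ) r).IsDiag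
    rw [Matrix.algebraMap_eq_diagonal]
    exact Matrix.isDiag_diagonal _
  star_mem' := by
    intro x hx n
    exact (hx n).conjTranspose

/-- `L^∞(ℒ, u_ω) = ∏_{n → ω} (ℓ^∞(d n), u_{d n})`, as a subalgebra of `ℳ`: functions on
`{1, …, d n}` are identified with diagonal matrices. This identification turns the supremum norm
into the operator norm, and the `L²(u_{d n})`-norm into the `2`-norm. -/
def LoebLInfty (ω : Ultrafilter ℕ) (d : ℕ → ℕ) : StarSubalgebra ℂ (MatUltra ω d) :=
  (diagSeq d).map (matClass ω d)

/-- The permutation matrix of `p`, sending the basis vector `e_j` to `e_{p j}`. -/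
def permMat {k : ℕ} (p : Equiv.Perm (Fin k)) : Matrix (Fin k) (Fin k) ℂ :=
  Matrix.of fun i j => if i = p j then 1 else 0

theorem permMat_one {k : ℕ} : permMat (1 : Equiv.Perm (Fin k)) = 1 := by
  ext i j
  simp only [permMat, Matrix.one_apply, Matrix.of_apply]
  rfl

theorem permMat_mul {k : ℕ} (p q : Equiv.Perm (Fin k)) :
    permMat (p * q) = permMat p * permMat q := by
  ext i j
  simp [permMat, Matrix.mul_apply]
  rfl

theorem star_permMat_mul_self {k : ℕ} (p : Equiv.Perm (Fin k)) :
    star (permMat p) * permMat p = 1 := by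
  ext i j
  simp [permMat, Matrix.mul_apply, Matrix.star_apply, Matrix.one_apply, eq_comm]

section
open scoped Matrix.Norms.L2Operator

theorem opNorm_permMat_le {k : ℕ} (p : Equiv.Perm (Fin k)) : opNorm (permMat p) ≤ 1 := by
  have h : opNorm (permMat p) * opNorm (permMat p) ≤ 1 := by
    unfold opNorm
    rw [← CStarRing.norm_star_mul_self, star_permMat_mul_self]
    simpa [opNorm] using opNorm_algebraMap_le (k := k) 1
  nlinarith [opNorm_nonneg (permMat p)]

end

theorem norm2_permMat_sub_one_le {k : ℕ} (p : Equiv.Perm (Fin k)) :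
    norm2 (permMat p - 1) ≤ Real.sqrt (2 * hammDist p 1) := by
  classical
  rw [norm2_eq_sum]
  apply Real.sqrt_le_sqrt
  unfold hammDist
  have key : ∀ j, ∑ i, ‖(permMat p - 1) i j‖ ^ 2 ≤ if p j ≠ (1 : Equiv.Perm (Fin k)) j then 2 else 0 := by
    intro j
    by_cases h : p j = j
    · rw [if_neg (by simpa using h)]
      refine le_of_eq (Finset.sum_eq_zero fun i _ => ?_)
      simp [permMat, Matrix.one_apply, h]
    · rw [if_pos (by simpa using h)]
      have h1 : ∀ i, ‖(permMat p - 1) i j‖ ^ 2 ≤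
          (if i = p j then (1 : ℝ) else 0) + (if i = j then (1 : ℝ) else 0) := by
        intro i
        by_cases h1 : i = p j
        · subst h1
          simp [permMat, h]
        · by_cases h2 : i = j <;> simp [permMat, h1, h2]
          subst h2
          simp [h1]
      refine (Finset.sum_le_sum fun i _ => h1 i).trans (le_of_eq ?_)
      rw [Finset.sum_add_distrib]
      simp
      norm_num
  have := Finset.sum_le_sum fun j (_ : j ∈ Finset.univ) => key j
  rw [← Finset.sum_filter, Finset.sum_const, nsmul_eq_mul] at this
  calc _ ≤ (k : ℝ)⁻¹ * _ := mul_le_mul_of_nonneg_left this (by positivity)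
    _ = _ := by ring

/-- Sequences of permutations as sequences of permutation matrices. -/
def permSeq (d : ℕ → ℕ) : (∀ n, Equiv.Perm (Fin (d n))) →* BddSeq d where
  toFun p := ⟨fun n => permMat (p n), 1, fun n => opNorm_permMat_le _⟩
  map_one' := Subtype.ext (funext fun _ => permMat_one)
  map_mul' p q := Subtype.ext (funext fun n => permMat_mul (p n) (q n))

/-- The embedding of `𝒮_ω` into the unitary group of `ℳ` through permutation matrices. -/
def permEmb (ω : Ultrafilter ℕ) (d : ℕ → ℕ) : PermUltra ω d →* MatUltra ω d :=
  QuotientGroup.lift (permNull ω d) ((matClass ω d : BddSeq d →* MatUltra ω d).comp (permSeq d)) (by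
    intro p hp
    have h : Tendsto (fun n => hammDist (p n) 1) ω (𝓝 0) := hp
    have h2 : Tendsto (fun n => Real.sqrt (2 * hammDist (p n) 1)) ω (𝓝 0) := by
      have h3 := (Real.continuous_sqrt.tendsto _).comp (h.const_mul 2)
      rw [mul_zero, Real.sqrt_zero] at h3
      exact h3
    rw [MonoidHom.mem_ker]
    have hgoal : permSeq d p - 1 ∈ nullIdeal ω d := ?_
    · exact Ideal.Quotient.eq.2 hgoal
    exact squeeze_zero (fun n => norm2_nonneg _) (fun n => norm2_permMat_sub_one_le (p n)) h2)

/-! ### The invariant random subgroup of a sequence of approximate homomorphisms -/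

/-- `S_σ(j)(g) = 1` if `σ(g)(j) = j`, and `0` otherwise. -/
def stabIndicator {G : Type*} {k : ℕ} (σ : G → Equiv.Perm (Fin k)) (j : Fin k) : G → Bool :=
  fun g => decide (σ g j = j)

/-- The law `(S_σ)_* u_k` on `{0,1}^G`, with `u_k` the uniform measure on `{1, …, k}`. -/
def stabLaw {G : Type*} {k : ℕ} [NeZero k] (σ : G → Equiv.Perm (Fin k)) :
    ProbabilityMeasure (G → Bool) :=
  ⟨(ProbabilityTheory.uniformOn (Set.univ : Set (Fin k))).map (stabIndicator σ), by
    have : IsProbabilityMeasure (ProbabilityTheory.uniformOn (Set.univ : Set (Fin k))) :=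
      ProbabilityTheory.isProbabilityMeasure_uniformOn Set.finite_univ Set.univ_nonempty
    exact Measure.isProbabilityMeasure_map (measurable_of_finite _).aemeasurable⟩

/-- The limit `lim_{n → ω} (S_{σ n})_* u_{d n}`, in the weak* topology of `Prob({0,1}^G)`
(a compact Hausdorff space, so that the limit exists and is unique). -/
def limStabLaw {G : Type*} [Countable G] {d : ℕ → ℕ} [∀ n, NeZero (d n)]
    (σ : ∀ n, G → Equiv.Perm (Fin (d n))) (ω : Ultrafilter ℕ) : ProbabilityMeasure (G → Bool) :=
  (ω.map fun n => stabLaw (σ n)).lim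

theorem tendsto_limStabLaw {G : Type*} [Countable G] {d : ℕ → ℕ} [∀ n, NeZero (d n)]
    (σ : ∀ n, G → Equiv.Perm (Fin (d n))) (ω : Ultrafilter ℕ) :
    Tendsto (fun n => stabLaw (σ n)) ω (𝓝 (limStabLaw σ ω)) :=
  (ω.map fun n => stabLaw (σ n)).le_nhds_lim

/-- A subgroup as a point of `{0,1}^G`. -/
def subgroupIndicator {G : Type*} [Group G] (H : Subgroup G) : G → Bool :=
  fun g => @decide (g ∈ H) (Classical.dec _)

/-- The σ-algebra of `Sub(G) ⊆ {0,1}^G`; for countable `G` this is the Borel σ-algebra of the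
topology induced from `{0,1}^G`. -/
instance instMeasurableSpaceSubgroup {G : Type*} [Group G] : MeasurableSpace (Subgroup G) :=
  MeasurableSpace.comap subgroupIndicator inferInstance

/-- `IRS(σ_ω)`, as a measure on `Sub(G)`. -/
def irs {G : Type*} [Group G] [Countable G] {d : ℕ → ℕ} [∀ n, NeZero (d n)]
    (σ : ∀ n, G → Equiv.Perm (Fin (d n))) (ω : Ultrafilter ℕ) : Measure (Subgroup G) :=
  Measure.comap subgroupIndicator (limStabLaw σ ω : Measure (G → Bool))

/-! ### The `Θ`-Bernoulli action -/

/-- The space `Y` of pairs `(H, x) ∈ Sub(G) × X^G` with `x(h g) = x(g)` for `g ∈ G`, `h ∈ H`. -/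
def BernSpace (G X : Type*) [Group G] : Type _ :=
  {p : Subgroup G × (G → X) // ∀ g : G, ∀ h ∈ p.1, p.2 (h * g) = p.2 g}

instance instMeasurableSpaceBernSpace (G X : Type*) [Group G] [MeasurableSpace X] :
    MeasurableSpace (BernSpace G X) :=
  inferInstanceAs (MeasurableSpace {p : Subgroup G × (G → X) // ∀ g : G, ∀ h ∈ p.1, p.2 (h * g) = p.2 g})

/-- The action `g · (H, x) = (g H g⁻¹, g x)` with `(g x)(a) = x(g⁻¹ a)`. -/
instance instMulActionBernSpace (G X : Type*) [Group G] : MulAction G (BernSpace G X) where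
  smul g p := ⟨(p.1.1.map (MulAut.conj g).toMonoidHom, fun a => p.1.2 (g⁻¹ * a)), by
    rintro a _ ⟨h, hh, rfl⟩
    have := p.2 (g⁻¹ * a) h hh
    simpa [MulAut.conj_apply, mul_assoc] using this⟩
  one_smul p := by
    refine Subtype.ext (Prod.ext ?_ ?_)
    · change p.1.1.map (MulAut.conj (1 : G)).toMonoidHom = p.1.1
      ext x
      simp
    · change (fun a => p.1.2 ((1 : G)⁻¹ * a)) = p.1.2
      simp
  mul_smul g h p := by
    refine Subtype.ext (Prod.ext ?_ ?_)
    · change p.1.1.map (MulAut.conj (g * h)).toMonoidHom =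
        (p.1.1.map (MulAut.conj h).toMonoidHom).map (MulAut.conj g).toMonoidHom
      rw [Subgroup.map_map, map_mul]
      rfl
    · change (fun a => p.1.2 ((g * h)⁻¹ * a)) = fun a => p.1.2 (h⁻¹ * (g⁻¹ * a))
      simp [mul_assoc]

theorem measurable_mem_subgroup {G : Type*} [Group G] (g : G) :
    MeasurableSet {H : Subgroup G | g ∈ H} := by
  have h : Measurable fun H : Subgroup G => subgroupIndicator H g :=
    (measurable_pi_apply g).comp (comap_measurable subgroupIndicator)
  have h2 := h (measurableSet_singleton true)
  convert h2 using 1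
  ext H
  simp [subgroupIndicator]

instance instMeasurableConstSMulBernSpace (G X : Type*) [Group G] [MeasurableSpace X] :
    MeasurableConstSMul G (BernSpace G X) where
  measurable_const_smul g := by
    refine Measurable.subtype_mk (Measurable.prodMk ?_ ?_)
    · refine measurable_comap_iff.2 (measurable_pi_iff.2 fun a => measurable_to_bool ?_)
      have h : MeasurableSet {p : BernSpace G X | g⁻¹ * a * g ∈ p.1.1} :=
        (measurable_fst.comp measurable_subtype_coe) (measurable_mem_subgroup (g⁻¹ * a * g))
      convert h using 1
      ext p
      simp only [Set.mem_preimage, Function.comp_apply, subgroupIndicator, Set.mem_singleton_iff,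
        decide_eq_true_eq, Set.mem_ofPred_eq]
      constructor
      · rintro ⟨h, hh, rfl⟩
        simpa [MulAut.conj_apply, mul_assoc] using hh
      · intro h
        exact ⟨_, h, by simp [MulAut.conj_apply, mul_assoc]⟩
    · exact measurable_pi_iff.2 fun a =>
        (measurable_pi_apply (g⁻¹ * a)).comp (measurable_snd.comp measurable_subtype_coe)

/-- The product measure `ν^{⊗ G/H}` (`G/H` the space of right cosets `Hg`), as a measure on `X^G`
concentrated on the functions that are constant on right `H`-cosets. -/
def cosetMeasure {G X : Type*} [Group G] [MeasurableSpace X] (ν : Measure X) (H : Subgroup G) :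
    Measure (G → X) :=
  (Measure.infinitePi fun _ : Quotient (QuotientGroup.rightRel H) => ν).map
    fun z g => z (Quotient.mk (QuotientGroup.rightRel H) g)

/-- The `Θ`-Bernoulli measure `μ_Θ = ∫ δ_H ⊗ ν^{⊗ G/H} dΘ(H)`, as a measure on the space `Y`. -/
def bernMeasure {G X : Type*} [Group G] [MeasurableSpace X] (ν : Measure X)
    (Θ : Measure (Subgroup G)) : Measure (BernSpace G X) :=
  Measure.comap Subtype.val (Θ.bind fun H => (Measure.dirac H).prod (cosetMeasure ν H))

/-! ### The full group of an equivalence relation -/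

/-- The group of Borel automorphisms of `X`, under composition. -/
instance instGroupMeasurableEquiv {X : Type*} [MeasurableSpace X] : Group (X ≃ᵐ X) where
  mul γ δ := δ.trans γ
  one := MeasurableEquiv.refl X
  inv γ := γ.symm
  mul_assoc _ _ _ := rfl
  one_mul _ := rfl
  mul_one _ := rfl
  inv_mul_cancel γ := MeasurableEquiv.ext (funext fun x => γ.symm_apply_apply x)

/-- Measure-preserving Borel automorphisms `γ` with `γ(x) ∈ [x]_ℛ` for almost every `x`. -/
def fullAut {X : Type*} [MeasurableSpace X] (ν : Measure X) (R : Setoid X) : Subgroup (X ≃ᵐ X) where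
  carrier := {γ | MeasurePreserving γ ν ν ∧ ∀ᵐ x ∂ν, R x (γ x)}
  mul_mem' := by
    rintro γ δ ⟨hγ, hγ'⟩ ⟨hδ, hδ'⟩
    refine ⟨hγ.comp hδ, ?_⟩
    filter_upwards [hδ', hδ.quasiMeasurePreserving.ae hγ'] with x h1 h2
    exact R.trans h1 h2
  one_mem' := ⟨MeasurePreserving.id ν, Eventually.of_forall fun x => R.refl x⟩
  inv_mem' := by
    rintro γ ⟨hγ, hγ'⟩
    have hs : MeasurePreserving γ.symm ν ν := hγ.symm γ
    refine ⟨hs, ?_⟩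
    filter_upwards [hs.quasiMeasurePreserving.ae hγ'] with x hx
    rw [γ.apply_symm_apply] at hx
    exact R.symm hx

/-- Elements of `fullAut ν R` that agree with the identity almost everywhere. -/
def aeTrivial {X : Type*} [MeasurableSpace X] (ν : Measure X) (R : Setoid X) :
    Subgroup (fullAut ν R) where
  carrier := {γ | ∀ᵐ x ∂ν, γ.1 x = x}
  mul_mem' := by
    intro γ δ hγ hδ
    filter_upwards [hδ, δ.2.1.quasiMeasurePreserving.ae hγ] with x h1 h2
    change γ.1 (δ.1 x) = x
    rw [h2, h1]
  one_mem' := by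
    change ∀ᵐ x ∂ν, x = x
    exact Eventually.of_forall fun _ => rfl
  inv_mem' := by
    intro γ hγ
    change ∀ᵐ x ∂ν, γ.1.symm x = x
    have hγ' : ∀ᵐ x ∂ν, γ.1 x = x := hγ
    filter_upwards [hγ'] with x hx
    rw [MeasurableEquiv.symm_apply_eq]
    exact hx.symm

instance aeTrivial_normal {X : Type*} [MeasurableSpace X] (ν : Measure X) (R : Setoid X) :
    (aeTrivial ν R).Normal where
  conj_mem γ hγ δ := by
    have h := (δ⁻¹).2.1.quasiMeasurePreserving.ae hγ
    filter_upwards [h] with x hx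
    change δ.1 (γ.1 (δ.1.symm x)) = x
    have hx' : γ.1 (δ.1.symm x) = δ.1.symm x := hx
    rw [hx', MeasurableEquiv.apply_symm_apply]

/-- The full group `[ℛ]`: measure-preserving automorphisms with `γ(x) ∈ [x]_ℛ` almost everywhere,
modulo almost everywhere equality. (Every bimeasurable bijection between conull sets that moves
almost every point within its `ℛ`-class preserves the measure when `ℛ` does, and agrees almost
everywhere with such an everywhere defined automorphism: restrict it to an invariant conull set
and extend it by the identity.) -/
abbrev FullGroup {X : Type*} [MeasurableSpace X] (ν : Measure X) (R : Setoid X) : Type _ :=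
  fullAut ν R ⧸ aeTrivial ν R

/-! ### Sofic approximations -/

/-- The weak operator topology on `L^∞(X, ν)`, acting on `L²(X, ν)` by multiplication. -/
@[reducible]
def wotLInfty {X : Type*} [MeasurableSpace X] (ν : Measure X) : TopologicalSpace (Lp ℂ ∞ ν) :=
  ⨅ (ξ : Lp ℂ 2 ν) (η : Lp ℂ 2 ν),
    TopologicalSpace.induced (fun f => ∫ x, f x * ξ x * star (η x) ∂ν) inferInstance

/-- Normality of a `*`-homomorphism `ρ : L^∞(X, ν) → L^∞(ℒ, u_ω)`: continuity on the unit ball for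
the weak operator topologies. On the target, these are given by the vector functionals
`a ↦ ⟨a x, y⟩ = τ_ω(y* a x)` of the representation on `L²` of the trace; as `ρ` maps the unit
ball to a norm bounded set, vectors `x, y` in the dense subspace given by `ℳ` suffice. -/
def IsNormalMap {X : Type*} [MeasurableSpace X] {ν : Measure X} {ω : Ultrafilter ℕ} {d : ℕ → ℕ}
    (ρ : Lp ℂ ∞ ν → LoebLInfty ω d) : Prop :=
  ∀ x y : MatUltra ω d,
    @ContinuousOn _ _ (wotLInfty ν) _
      (fun f => traceUltra ω d (star y * (ρ f : MatUltra ω d) * x)) {f | ‖f‖ ≤ 1}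

/-- `(ρ, s)` is a sofic approximation of the equivalence relation `R` on `(X, ν)`. In `map_mul`,
`f • g` is the pointwise product of `f, g ∈ L^∞(X, ν)`. -/
structure IsSoficApproximation {X : Type*} [MeasurableSpace X] (ν : Measure X) (R : Setoid X)
    (ω : Ultrafilter ℕ) (d : ℕ → ℕ) (ρ : Lp ℂ ∞ ν →ₗ[ℂ] LoebLInfty ω d)
    (s : FullGroup ν R →* PermUltra ω d) : Prop where
  map_mul : ∀ f g : Lp ℂ ∞ ν, ρ (f • g : Lp ℂ ∞ ν) = ρ f * ρ g
  map_star : ∀ f : Lp ℂ ∞ ν, ρ (star f) = star (ρ f)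
  normal : IsNormalMap ρ
  trace_eq : ∀ (f : Lp ℂ ∞ ν) (γ : fullAut ν R),
    traceUltra ω d ((ρ f : MatUltra ω d) * permEmb ω d (s (QuotientGroup.mk γ))) =
      ∫ x in {x | γ.1 x = x}, f x ∂ν
  covariant : ∀ (f : Lp ℂ ∞ ν) (γ : fullAut ν R),
    permEmb ω d (s (QuotientGroup.mk γ)) * (ρ f : MatUltra ω d) *
        permEmb ω d (s (QuotientGroup.mk γ))⁻¹ =
      (ρ (Lp.compMeasurePreserving (γ⁻¹).1 (γ⁻¹).2.1 f) : MatUltra ω d)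

end SoficExtension

end

/-!
The theorem holds because the models `σ n : G → Sym(d n)` may be labelled at random so that they see
the whole Bernoulli space, after which every element of `L^∞` and of the full group is transferred to
the models by approximation.

*Labels.* Choose independent uniform labels `c n : Fin (d n) → [0,1]`, and send the point `j` of the
`n`-th model to its stabilizer together with the labels `g ↦ c n (σ n g⁻¹ j)` along its orbit, a
point of the compact space `K = {0,1}^G × [0,1]^G`. Seen through a finite window, the labels at `j`
have the law of labels on the cosets of the stabilizer of `j` (`integral_labelPt_eq`), so the expected
image of the uniform measure converges to the law `cosetLabelLaw`. The window of a point meets those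
of boundedly many others only, and labels in disjoint windows are independent, so the variance is
`O(1 / d n)` (`variance_labelMean_le`), and since `d n → ∞` some fixed labelling distributes the
models along the limit law (`exists_labelling`). As a choice of the least representative of each
coset shows, that law is the image of `μ_Θ` in `K` (`map_bernEmbed`). The limit law is concentrated on subgroups,
because `σ` is asymptotically multiplicative; invariance of `μ_Θ` is inherited from the counting
measures, and as `[0,1]` has no atoms, the stabilizer of almost every point `(H, x)` is `H`
(`ae_smul_eq_iff`). So the labelled models form a model of the action (`isActionModel_labelMap`).

*Functions.* For any such model, a bounded function `f` on `Y` is represented by a bounded sequence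
of functions `a` on the models if the same continuous functions on `K` approximate `f` and `a` in
mean (`Represents`). This relation respects the algebraic operations and the action, every `f` is
represented (`IsModel.exists_represents`), means of `a` converge to the integral of `f`, and `a` is
determined by `f` up to sequences vanishing in the limit. This gives `ρ`. Its matrix coefficients are
bounded in the norm of `L²`, so they are inner products there, which gives normality
(`IsModel.isNormalMap_rho`).

*The full group.* An element `γ` of the full group agrees with group elements on the pieces of a
countable partition. A sequence of permutations represents `γ` if, for every `g`, the set where it
agrees with `σ g` represents the set where `γ` agrees with `g` (`RepresentsPerm`). Gluing the `σ g`
over sets that represent the pieces gives such a sequence (`exists_representsPerm`). By locality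
(`represents_of_cover`), whatever holds on all pieces holds globally: the sequence is unique in the
limit, products represent products, and composition with it represents composition with `γ`. This
gives the homomorphism on the full group, and `σ g` itself represents the action of `g`. The trace
formula is convergence of means, applied to the function `f` cut down to the fixed points of `γ`.
-/
noncomputable section

namespace SoficExtension

set_option linter.unusedSectionVars false

/-! ### Means over the finite models and the filter of almost all points -/

/-- The disjoint union of the finite sets `Fin (d n)`; sequences of functions on these sets are
functions on `Pts d`. -/
abbrev Pts (d : ℕ → ℕ) : Type := Σ n, Fin (d n)

/-- The normalized sum of `a` over the `n`-th fibre of `Pts d`. -/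
def mean {d : ℕ → ℕ} {E : Type*} [AddCommGroup E] [Module ℝ E] (a : Pts d → E) (n : ℕ) : E :=
  (d n : ℝ)⁻¹ • ∑ j : Fin (d n), a ⟨n, j⟩

section Mean
variable {d : ℕ → ℕ} {E : Type*} [NormedAddCommGroup E] [NormedSpace ℝ E]

theorem mean_add (a b : Pts d → E) (n : ℕ) :
    mean (fun x => a x + b x) n = mean a n + mean b n := by
  simp [mean, Finset.sum_add_distrib, smul_add]

theorem mean_sub (a b : Pts d → E) (n : ℕ) :
    mean (fun x => a x - b x) n = mean a n - mean b n := by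
  simp [mean, Finset.sum_sub_distrib, smul_sub]

theorem mean_const_mul (c : ℝ) (a : Pts d → ℝ) (n : ℕ) :
    mean (fun x => c * a x) n = c * mean a n := by
  simp only [mean, ← Finset.mul_sum, smul_eq_mul]; ring

theorem mean_mono {a b : Pts d → ℝ} (h : ∀ x, a x ≤ b x) (n : ℕ) : mean a n ≤ mean b n := by
  unfold mean
  exact smul_le_smul_of_nonneg_left (Finset.sum_le_sum fun j _ => h _) (by positivity)

theorem mean_nonneg {a : Pts d → ℝ} (h : ∀ x, 0 ≤ a x) (n : ℕ) : 0 ≤ mean a n := by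
  unfold mean
  exact smul_nonneg (by positivity) (Finset.sum_nonneg fun j _ => h _)

theorem norm_mean_le (a : Pts d → E) (n : ℕ) : ‖mean a n‖ ≤ mean (fun x => ‖a x‖) n := by
  unfold mean
  rw [norm_smul, Real.norm_of_nonneg (by positivity), smul_eq_mul]
  exact mul_le_mul_of_nonneg_left (norm_sum_le _ _) (by positivity)

theorem mean_const [∀ n, NeZero (d n)] (c : E) (n : ℕ) : mean (fun _ : Pts d => c) n = c := by
  have : (d n : ℝ) ≠ 0 := by exact_mod_cast NeZero.ne (d n)
  simp only [mean, Finset.sum_const, Finset.card_univ, Fintype.card_fin]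
  rw [← Nat.cast_smul_eq_nsmul ℝ, smul_smul, inv_mul_cancel₀ this, one_smul]

theorem mean_sum {ι : Type*} (s : Finset ι) (a : ι → Pts d → E) (n : ℕ) :
    mean (fun x => ∑ i ∈ s, a i x) n = ∑ i ∈ s, mean (a i) n := by
  simp only [mean, ← Finset.smul_sum]
  rw [Finset.sum_comm]

theorem mean_le_of_le [∀ n, NeZero (d n)] {a : Pts d → ℝ} {c : ℝ} (h : ∀ x, a x ≤ c) (n : ℕ) :
    mean a n ≤ c :=
  (mean_mono h n).trans (mean_const c n).le

end Mean

/-- The self-map of `Pts d` given by a sequence of permutations. -/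
def act {d : ℕ → ℕ} (p : ∀ n, Equiv.Perm (Fin (d n))) (x : Pts d) : Pts d := ⟨x.1, p x.1 x.2⟩

section Act
variable {d : ℕ → ℕ} (p q : ∀ n, Equiv.Perm (Fin (d n)))

@[simp] theorem act_mul (x : Pts d) : act (p * q) x = act p (act q x) := rfl

@[simp] theorem act_one (x : Pts d) : act (1 : ∀ n, Equiv.Perm (Fin (d n))) x = x := rfl

@[simp] theorem act_inv_act (x : Pts d) : act p⁻¹ (act p x) = x := by
  rw [← act_mul, inv_mul_cancel, act_one]

@[simp] theorem act_act_inv (x : Pts d) : act p (act p⁻¹ x) = x := by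
  rw [← act_mul, mul_inv_cancel, act_one]

theorem act_injective : Function.Injective (act p) :=
  Function.LeftInverse.injective (act_inv_act p)

theorem act_eq_iff {x y : Pts d} : act p x = y ↔ x = act p⁻¹ y := by
  constructor
  · rintro rfl; simp
  · rintro rfl; simp

theorem act_mk_eq_iff {n : ℕ} {i j : Fin (d n)} :
    act p ⟨n, i⟩ = ⟨n, j⟩ ↔ p n i = j := by
  simp [act]

theorem mean_comp_act {E : Type*} [AddCommGroup E] [Module ℝ E] (a : Pts d → E) (n : ℕ) :
    mean (fun x => a (act p x)) n = mean a n := by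
  unfold mean
  congr 1
  exact Equiv.sum_comp (p n) fun j => a ⟨n, j⟩

end Act

theorem indicator_one_nonneg {α : Type*} (S : Set α) (x : α) :
    0 ≤ S.indicator (1 : α → ℝ) x :=
  Set.indicator_nonneg (fun _ _ => zero_le_one) x

/-- The filter of sets of points whose complement has vanishing density in the limit along `ω`:
the conull sets of the Loeb space. -/
def loebFilter (ω : Ultrafilter ℕ) (d : ℕ → ℕ) : Filter (Pts d) :=
  comk (fun S => Tendsto (mean (S.indicator (1 : Pts d → ℝ))) ω (𝓝 0))
    (by
      have h : mean ((∅ : Set (Pts d)).indicator (1 : Pts d → ℝ)) = fun _ => 0 := by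
        funext n; simp [mean]
      rw [h]; exact tendsto_const_nhds)
    (fun t ht s hs => squeeze_zero (fun n => mean_nonneg (indicator_one_nonneg s) n)
      (fun n => mean_mono (fun x => Set.indicator_le_indicator_of_subset hs
        (fun _ => zero_le_one) x) n) ht)
    (fun s hs t ht => by
      have h := hs.add ht
      rw [add_zero] at h
      refine squeeze_zero (fun n => mean_nonneg (indicator_one_nonneg _) n) (fun n => ?_) h
      rw [← mean_add]
      refine mean_mono (fun x => ?_) n
      by_cases h1 : x ∈ s <;> by_cases h2 : x ∈ t <;> simp [h1, h2])

section LoebFilter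
variable {ω : Ultrafilter ℕ} {d : ℕ → ℕ}

theorem eventually_loeb {P : Pts d → Prop} : (∀ᶠ x in loebFilter ω d, P x) ↔
    Tendsto (mean ({x | ¬ P x}.indicator (1 : Pts d → ℝ))) ω (𝓝 0) := Iff.rfl

theorem mean_tendsto_zero [∀ n, NeZero (d n)] {a : Pts d → ℝ} {M : ℝ} (h0 : ∀ x, 0 ≤ a x)
    (hM : ∀ x, a x ≤ M) (h : ∀ ε > 0, ∀ᶠ x in loebFilter ω d, a x ≤ ε) :
    Tendsto (mean a) ω (𝓝 0) := by
  rw [Metric.tendsto_nhds]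
  intro ε hε
  have h1 := (eventually_loeb.1 (h (ε / 2) (by positivity))).const_mul M
  rw [mul_zero] at h1
  filter_upwards [h1.eventually_lt_const (show 0 < ε / 2 by positivity)] with n hn
  rw [Real.dist_eq, sub_zero, abs_of_nonneg (mean_nonneg h0 n)]
  have : mean a n ≤ mean (fun x => ε / 2 + M * {x | ¬ a x ≤ ε / 2}.indicator 1 x) n := by
    refine mean_mono (fun x => ?_) n
    by_cases hx : a x ≤ ε / 2
    · simp [hx]
    · have h' : x ∈ {x | ¬ a x ≤ ε / 2} := hx
      rw [Set.indicator_of_mem h', Pi.one_apply, mul_one]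
      linarith [hM x]
  rw [mean_add, mean_const, mean_const_mul] at this
  linarith

/-- Markov's inequality. -/
theorem eventually_lt_of_mean_tendsto {a : Pts d → ℝ} (h0 : ∀ x, 0 ≤ a x)
    (h : Tendsto (mean a) ω (𝓝 0)) {ε : ℝ} (hε : 0 < ε) : ∀ᶠ x in loebFilter ω d, a x < ε := by
  rw [eventually_loeb]
  have h1 := h.const_mul ε⁻¹
  rw [mul_zero] at h1
  refine squeeze_zero (fun n => mean_nonneg (indicator_one_nonneg _) n) (fun n => ?_) h1
  rw [← mean_const_mul]
  refine mean_mono (fun x => ?_) n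
  by_cases hx : a x < ε
  · simpa [hx] using mul_nonneg (inv_nonneg.2 hε.le) (h0 x)
  · have h' : x ∈ {x | ¬ a x < ε} := hx
    rw [Set.indicator_of_mem h', Pi.one_apply]
    rw [not_lt] at hx
    calc (1 : ℝ) = ε⁻¹ * ε := (inv_mul_cancel₀ hε.ne').symm
      _ ≤ _ := by gcongr

theorem mean_norm_tendsto_zero_iff [∀ n, NeZero (d n)] {E : Type*} [NormedAddCommGroup E]
    {a : Pts d → E} (hM : ∃ M, ∀ x, ‖a x‖ ≤ M) :
    Tendsto (mean fun x => ‖a x‖) ω (𝓝 0) ↔ Tendsto a (loebFilter ω d) (𝓝 0) := by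
  constructor
  · intro h
    rw [Metric.tendsto_nhds]
    intro ε hε
    simpa using eventually_lt_of_mean_tendsto (fun x => norm_nonneg (a x)) h hε
  · intro h
    obtain ⟨M, hM⟩ := hM
    refine mean_tendsto_zero (fun x => norm_nonneg _) hM fun ε hε => ?_
    filter_upwards [Metric.tendsto_nhds.1 h ε hε] with x hx
    simpa using hx.le

end LoebFilter

theorem hammDist_eq_mean {d : ℕ → ℕ} (p q : ∀ n, Equiv.Perm (Fin (d n))) (n : ℕ) :
    hammDist (p n) (q n) = mean ({x | ¬ act p x = act q x}.indicator (1 : Pts d → ℝ)) n := by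
  classical
  unfold hammDist mean
  rw [smul_eq_mul, div_eq_inv_mul, Finset.card_filter]
  push_cast
  congr 1
  refine Finset.sum_congr rfl fun j _ => ?_
  simp [Set.indicator_apply, act]

theorem tendsto_hammDist_iff {ω : Ultrafilter ℕ} {d : ℕ → ℕ} (p q : ∀ n, Equiv.Perm (Fin (d n))) :
    Tendsto (fun n => hammDist (p n) (q n)) ω (𝓝 0) ↔
      ∀ᶠ x in loebFilter ω d, act p x = act q x := by
  rw [eventually_loeb]
  simp only [hammDist_eq_mean]

theorem mk_eq_mk_iff {ω : Ultrafilter ℕ} {d : ℕ → ℕ} (p q : ∀ n, Equiv.Perm (Fin (d n))) :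
    (QuotientGroup.mk p : PermUltra ω d) = QuotientGroup.mk q ↔
      ∀ᶠ x in loebFilter ω d, act p x = act q x := by
  rw [QuotientGroup.eq]
  change Tendsto (fun n => hammDist ((p⁻¹ * q) n) ((1 : ∀ n, Equiv.Perm (Fin (d n))) n)) ω (𝓝 0) ↔ _
  rw [tendsto_hammDist_iff]
  refine eventually_congr (Eventually.of_forall fun x => ?_)
  rw [act_mul, act_one, eq_comm, ← act_eq_iff]

/-- Diagonal selection along a free ultrafilter: if each condition `P k` can eventually be met, then
a single sequence of indices meets them with `k → ∞`. -/
theorem exists_diagonal {ω : Ultrafilter ℕ} (hω : (ω : Filter ℕ) ≤ cofinite) {P : ℕ → ℕ → Prop}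
    (hP : ∀ k, ∀ᶠ n in (ω : Filter ℕ), P k n) :
    ∃ κ : ℕ → ℕ, (∀ᶠ n in (ω : Filter ℕ), P (κ n) n) ∧
      ∀ k, ∀ᶠ n in (ω : Filter ℕ), k ≤ κ n := by
  classical
  refine ⟨fun n => Nat.findGreatest (fun k => P k n) n, ?_, fun k => ?_⟩
  · filter_upwards [hP 0] with n hn
    exact Nat.findGreatest_spec (P := fun k => P k n) (Nat.zero_le n) hn
  · have h1 : ∀ᶠ n in (ω : Filter ℕ), k ≤ n := by
      apply hω
      rw [Nat.cofinite_eq_atTop]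
      exact eventually_ge_atTop k
    filter_upwards [h1, hP k] with n h1 h2
    exact Nat.le_findGreatest h1 h2

/-! ### Functions represented in the finite models -/

/-- `T : Pts d → K` distributes the points of the finite models along `μ`: the images of the uniform
measures under `T` converge weak* to the image of `μ` under the embedding `e : Y → K`. -/
structure IsModel {Y K : Type*} [MeasurableSpace Y] [TopologicalSpace K] [MeasurableSpace K]
    (ω : Ultrafilter ℕ) {d : ℕ → ℕ} (μ : Measure Y) (e : Y → K) (T : Pts d → K) : Prop where
  measurableEmbedding : MeasurableEmbedding e
  tendsto_mean : ∀ φ : C(K, ℝ), Tendsto (mean fun x => φ (T x)) ω (𝓝 (∫ y, φ (e y) ∂μ))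

/-- The bounded sequence `a` of functions on the finite models represents `f ∈ L^∞(Y, μ)`: for
every `ε` some continuous function on `K` is `ε`-close in `L¹` both to `f` on `Y` and, eventually
along `ω`, to `a` on the models. This is the relation `ρ(f) = (a_n)_{n → ω}`. -/
structure Represents {Y K : Type*} [MeasurableSpace Y] [TopologicalSpace K]
    (ω : Ultrafilter ℕ) {d : ℕ → ℕ} (μ : Measure Y) (e : Y → K) (T : Pts d → K)
    (f : Y → ℂ) (a : Pts d → ℂ) : Prop where
  memLp : MemLp f ∞ μ
  bdd : ∃ M, ∀ x, ‖a x‖ ≤ M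
  approx : ∀ ε > 0, ∃ φ : C(K, ℂ), ∫ y, ‖f y - φ (e y)‖ ∂μ ≤ ε ∧
    ∀ᶠ n in (ω : Filter ℕ), mean (fun x => ‖a x - φ (T x)‖) n ≤ ε

theorem exists_ae_bound {Y : Type*} [MeasurableSpace Y] {μ : Measure Y} {f : Y → ℂ}
    (hf : MemLp f ∞ μ) : ∃ M, 0 < M ∧ ∀ᵐ y ∂μ, ‖f y‖ ≤ M := by
  refine ⟨(eLpNormEssSup f μ).toReal + 1, by positivity, ?_⟩
  have h := hf.2
  rw [eLpNorm_exponent_top] at h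
  filter_upwards [ae_le_eLpNormEssSup (f := f) (μ := μ)] with y hy
  have := ENNReal.toReal_mono h.ne hy
  simp at this
  linarith

section Represents
variable {Y K : Type*} [MeasurableSpace Y] [TopologicalSpace K] [CompactSpace K] [T2Space K]
  [SecondCountableTopology K] [MeasurableSpace K] [BorelSpace K]
  {ω : Ultrafilter ℕ} {d : ℕ → ℕ} [∀ n, NeZero (d n)]
  {μ : Measure Y} [IsProbabilityMeasure μ] {e : Y → K} {T : Pts d → K}

theorem exists_norm_bound (φ : C(K, ℂ)) : ∃ M, 0 < M ∧ ∀ k, ‖φ k‖ ≤ M :=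
  ⟨‖φ‖ + 1, by positivity, fun k => (φ.norm_coe_le_norm k).trans (by linarith)⟩

theorem IsModel.memLp (h : IsModel ω μ e T) (φ : C(K, ℂ)) : MemLp (fun y => φ (e y)) ∞ μ :=
  memLp_top_of_bound (φ.continuous.measurable.comp h.measurableEmbedding.measurable).aestronglyMeasurable
    ‖φ‖ (Eventually.of_forall fun y => φ.norm_coe_le_norm (e y))

theorem MemLp.integrable_of_top {f : Y → ℂ} (hf : MemLp f ∞ μ) : Integrable f μ :=
  hf.integrable le_top

theorem IsModel.tendsto_mean_complex (h : IsModel ω μ e T) (φ : C(K, ℂ)) :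
    Tendsto (mean fun x => φ (T x)) ω (𝓝 (∫ y, φ (e y) ∂μ)) := by
  have hre := h.tendsto_mean ⟨fun k => (φ k).re, by fun_prop⟩
  have him := h.tendsto_mean ⟨fun k => (φ k).im, by fun_prop⟩
  have hint := MemLp.integrable_of_top (h.memLp φ)
  rw [← integral_re_add_im hint]
  have h1 := (Complex.continuous_ofReal.tendsto _).comp hre
  have h2 := ((Complex.continuous_ofReal.tendsto _).comp him).mul_const Complex.I
  refine (h1.add h2).congr fun n => ?_
  simp only [mean, Function.comp_apply, ContinuousMap.coe_mk, smul_eq_mul]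
  apply Complex.ext <;> simp

theorem IsModel.tendsto_mean_norm (h : IsModel ω μ e T) (φ : C(K, ℂ)) :
    Tendsto (mean fun x => ‖φ (T x)‖) ω (𝓝 (∫ y, ‖φ (e y)‖ ∂μ)) :=
  h.tendsto_mean ⟨fun k => ‖φ k‖, by fun_prop⟩

theorem IsModel.represents (h : IsModel ω μ e T) (φ : C(K, ℂ)) :
    Represents ω μ e T (fun y => φ (e y)) (fun x => φ (T x)) where
  memLp := h.memLp φ
  bdd := ⟨‖φ‖, fun x => φ.norm_coe_le_norm _⟩
  approx ε hε := ⟨φ, by simpa using hε.le, by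
    refine Eventually.of_forall fun n => ?_
    simpa [mean] using hε.le⟩

theorem Represents.tendsto_mean {f : Y → ℂ} {a : Pts d → ℂ} (h : IsModel ω μ e T)
    (hf : Represents ω μ e T f a) : Tendsto (mean a) ω (𝓝 (∫ y, f y ∂μ)) := by
  rw [Metric.tendsto_nhds]
  intro ε hε
  obtain ⟨φ, h1, h2⟩ := hf.approx (ε / 4) (by positivity)
  filter_upwards [h2, Metric.tendsto_nhds.1 (h.tendsto_mean_complex φ) (ε / 4) (by positivity)]
    with n hn1 hn2
  rw [dist_eq_norm] at hn2 ⊢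
  have e1 : ‖mean a n - mean (fun x => φ (T x)) n‖ ≤ ε / 4 := by
    rw [← mean_sub]; exact (norm_mean_le _ n).trans hn1
  have e2 : ‖∫ y, f y ∂μ - ∫ y, φ (e y) ∂μ‖ ≤ ε / 4 := by
    rw [← integral_sub (MemLp.integrable_of_top hf.memLp) (MemLp.integrable_of_top (h.memLp φ))]
    exact (norm_integral_le_integral_norm _).trans h1
  rw [norm_sub_rev] at e2
  calc _ = ‖(mean a n - mean (fun x => φ (T x)) n) + (mean (fun x => φ (T x)) n
        - ∫ y, φ (e y) ∂μ) + (∫ y, φ (e y) ∂μ - ∫ y, f y ∂μ)‖ := by congr 1; ring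
    _ ≤ _ := norm_add₃_le
    _ < ε := by linarith

theorem Represents.congr {f f' : Y → ℂ} {a a' : Pts d → ℂ}
    (hf : Represents ω μ e T f a) (hff' : f =ᵐ[μ] f') (hb : ∃ M, ∀ x, ‖a' x‖ ≤ M)
    (haa' : Tendsto (fun x => a' x - a x) (loebFilter ω d) (𝓝 0)) :
    Represents ω μ e T f' a' where
  memLp := hf.memLp.ae_eq hff'
  bdd := hb
  approx ε hε := by
    obtain ⟨φ, h1, h2⟩ := hf.approx (ε / 2) (by positivity)
    have hb' : ∃ M, ∀ x, ‖a' x - a x‖ ≤ M := by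
      obtain ⟨M, hM⟩ := hb
      obtain ⟨M', hM'⟩ := hf.bdd
      exact ⟨M + M', fun x => (norm_sub_le _ _).trans (add_le_add (hM x) (hM' x))⟩
    have h3 := (mean_norm_tendsto_zero_iff hb').2 haa'
    refine ⟨φ, ?_, ?_⟩
    · rw [integral_congr_ae (g := fun y => ‖f y - φ (e y)‖)]
      · linarith
      · filter_upwards [hff'] with y hy
        rw [hy]
    · filter_upwards [h2, h3.eventually_lt_const (show 0 < ε / 2 by positivity)] with n h4 h5
      have : mean (fun x => ‖a' x - φ (T x)‖) n ≤
          mean (fun x => ‖a' x - a x‖ + ‖a x - φ (T x)‖) n :=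
        mean_mono (fun x => norm_sub_le_norm_sub_add_norm_sub _ _ _) n
      rw [mean_add] at this
      linarith

theorem Represents.congr_left {f f' : Y → ℂ} {a : Pts d → ℂ}
    (hf : Represents ω μ e T f a) (hff' : f =ᵐ[μ] f') : Represents ω μ e T f' a :=
  hf.congr hff' hf.bdd (by simpa only [sub_self] using tendsto_const_nhds)

theorem Represents.congr_right {f : Y → ℂ} {a a' : Pts d → ℂ}
    (hf : Represents ω μ e T f a) (hb : ∃ M, ∀ x, ‖a' x‖ ≤ M)
    (haa' : a' =ᶠ[loebFilter ω d] a) : Represents ω μ e T f a' :=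
  hf.congr ae_eq_rfl hb
    (tendsto_const_nhds.congr' (by filter_upwards [haa'] with x hx; simp [hx]))

/-- The class of a representing sequence is determined: `ρ` is well defined. -/
theorem Represents.tendsto_zero {f : Y → ℂ} {a : Pts d → ℂ} (h : IsModel ω μ e T)
    (hf : Represents ω μ e T f a) (h0 : f =ᵐ[μ] 0) : Tendsto a (loebFilter ω d) (𝓝 0) := by
  rw [← mean_norm_tendsto_zero_iff hf.bdd, Metric.tendsto_nhds]
  intro ε hε
  obtain ⟨φ, h1, h2⟩ := hf.approx (ε / 4) (by positivity)
  have h3 : ∫ y, ‖φ (e y)‖ ∂μ ≤ ε / 4 := by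
    refine le_trans (le_of_eq (integral_congr_ae ?_)) h1
    filter_upwards [h0] with y hy
    simp [hy]
  filter_upwards [h2, (h.tendsto_mean_norm φ).eventually_lt_const
    (show _ < ε / 2 by linarith)] with n h4 h5
  have : mean (fun x => ‖a x‖) n ≤ mean (fun x => ‖a x - φ (T x)‖ + ‖φ (T x)‖) n :=
    mean_mono (fun x => norm_le_norm_sub_add _ _) n
  rw [mean_add] at this
  rw [Real.dist_eq, sub_zero, abs_of_nonneg (mean_nonneg (fun x => norm_nonneg _) n)]
  linarith

theorem Represents.add {f g : Y → ℂ} {a b : Pts d → ℂ} (h : IsModel ω μ e T)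
    (hf : Represents ω μ e T f a) (hg : Represents ω μ e T g b) :
    Represents ω μ e T (fun y => f y + g y) (fun x => a x + b x) where
  memLp := hf.memLp.add hg.memLp
  bdd := by
    obtain ⟨M, hM⟩ := hf.bdd
    obtain ⟨M', hM'⟩ := hg.bdd
    exact ⟨M + M', fun x => (norm_add_le _ _).trans (add_le_add (hM x) (hM' x))⟩
  approx ε hε := by
    obtain ⟨φ, h1, h2⟩ := hf.approx (ε / 2) (by positivity)
    obtain ⟨ψ, h3, h4⟩ := hg.approx (ε / 2) (by positivity)
    refine ⟨φ + ψ, ?_, ?_⟩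
    · have i1 := (MemLp.integrable_of_top (hf.memLp.sub (h.memLp φ))).norm
      have i2 := (MemLp.integrable_of_top (hg.memLp.sub (h.memLp ψ))).norm
      calc _ ≤ ∫ y, (‖f y - φ (e y)‖ + ‖g y - ψ (e y)‖) ∂μ := by
            refine integral_mono_of_nonneg (Eventually.of_forall fun y => norm_nonneg _)
              (i1.add i2) (Eventually.of_forall fun y => ?_)
            simp only [ContinuousMap.add_apply]
            rw [add_sub_add_comm]
            exact norm_add_le _ _
        _ = _ := integral_add i1 i2
        _ ≤ ε := by linarith
    · filter_upwards [h2, h4] with n h5 h6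
      have : mean (fun x => ‖a x + b x - (φ + ψ) (T x)‖) n ≤
          mean (fun x => ‖a x - φ (T x)‖ + ‖b x - ψ (T x)‖) n := by
        refine mean_mono (fun x => ?_) n
        simp only [ContinuousMap.add_apply]
        rw [add_sub_add_comm]
        exact norm_add_le _ _
      rw [mean_add] at this
      linarith

theorem norm_mul_sub_mul_le (a b c d : ℂ) : ‖a * b - c * d‖ ≤ ‖a‖ * ‖b - d‖ + ‖d‖ * ‖a - c‖ := by
  calc _ = ‖a * (b - d) + d * (a - c)‖ := by congr 1; ring
    _ ≤ _ := (norm_add_le _ _).trans (by rw [norm_mul, norm_mul])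

theorem Represents.mul {f g : Y → ℂ} {a b : Pts d → ℂ} (h : IsModel ω μ e T)
    (hf : Represents ω μ e T f a) (hg : Represents ω μ e T g b) :
    Represents ω μ e T (fun y => f y * g y) (fun x => a x * b x) where
  memLp := MemLp.mul (p := ∞) (q := ∞) (r := ∞) hg.memLp hf.memLp
  bdd := by
    obtain ⟨M, hM⟩ := hf.bdd
    obtain ⟨M', hM'⟩ := hg.bdd
    exact ⟨M * M', fun x => by
      rw [norm_mul]
      exact mul_le_mul (hM x) (hM' x) (norm_nonneg _) ((norm_nonneg _).trans (hM x))⟩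
  approx ε hε := by
    obtain ⟨M, hM0, hM⟩ := exists_ae_bound hf.memLp
    obtain ⟨M', hM'⟩ := hf.bdd
    -- `g` is approximated first, as the error allowed for `f` depends on `‖ψ‖`
    obtain ⟨ψ, h3, h4⟩ := hg.approx (ε / 2 / (M + |M'|)) (by positivity)
    obtain ⟨N, hN0, hN⟩ := exists_norm_bound ψ
    obtain ⟨φ, h1, h2⟩ := hf.approx (ε / 2 / N) (by positivity)
    have key : (M + |M'|) * (ε / 2 / (M + |M'|)) + N * (ε / 2 / N) = ε := by
      field_simp; ring
    refine ⟨φ * ψ, ?_, ?_⟩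
    · have i1 := (MemLp.integrable_of_top (hf.memLp.sub (h.memLp φ))).norm.const_mul N
      have i2 := (MemLp.integrable_of_top (hg.memLp.sub (h.memLp ψ))).norm.const_mul (M + |M'|)
      calc _ ≤ ∫ y, ((M + |M'|) * ‖g y - ψ (e y)‖ + N * ‖f y - φ (e y)‖) ∂μ := by
            refine integral_mono_of_nonneg (Eventually.of_forall fun y => norm_nonneg _)
              (i2.add i1) ?_
            filter_upwards [hM] with y hy
            simp only [ContinuousMap.mul_apply]
            refine (norm_mul_sub_mul_le _ _ _ _).trans ?_
            have := abs_nonneg M'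
            gcongr
            · linarith
            · exact hN _
        _ = (M + |M'|) * ∫ y, ‖g y - ψ (e y)‖ ∂μ + N * ∫ y, ‖f y - φ (e y)‖ ∂μ := by
            rw [← integral_const_mul, ← integral_const_mul]
            exact integral_add i2 i1
        _ ≤ ε := by rw [← key]; gcongr
    · filter_upwards [h2, h4] with n h5 h6
      have : mean (fun x => ‖a x * b x - (φ * ψ) (T x)‖) n ≤
          mean (fun x => (M + |M'|) * ‖b x - ψ (T x)‖ + N * ‖a x - φ (T x)‖) n := by
        refine mean_mono (fun x => ?_) n
        simp only [ContinuousMap.mul_apply]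
        refine (norm_mul_sub_mul_le _ _ _ _).trans ?_
        have := (hM' x).trans (le_abs_self M')
        gcongr
        · linarith
        · exact hN _
      rw [mean_add, mean_const_mul, mean_const_mul] at this
      refine this.trans ?_
      rw [← key]
      gcongr

theorem IsModel.represents_const (h : IsModel ω μ e T) (c : ℂ) :
    Represents ω μ e T (fun _ => c) (fun _ => c) :=
  h.represents (ContinuousMap.const K c)

theorem Represents.const_mul {f : Y → ℂ} {a : Pts d → ℂ} (h : IsModel ω μ e T) (c : ℂ)
    (hf : Represents ω μ e T f a) : Represents ω μ e T (fun y => c * f y) (fun x => c * a x) :=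
  (h.represents_const c).mul h hf

theorem Represents.sub {f g : Y → ℂ} {a b : Pts d → ℂ} (h : IsModel ω μ e T)
    (hf : Represents ω μ e T f a) (hg : Represents ω μ e T g b) :
    Represents ω μ e T (fun y => f y - g y) (fun x => a x - b x) := by
  simpa [sub_eq_add_neg] using hf.add h (hg.const_mul h (-1))

/-- Representations are preserved by `1`-Lipschitz continuous functions. -/
theorem Represents.comp_lipschitz {f : Y → ℂ} {a : Pts d → ℂ} (h : IsModel ω μ e T)
    (hf : Represents ω μ e T f a) {r : ℂ → ℂ} (hr : ∀ z w, ‖r z - r w‖ ≤ ‖z - w‖) :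
    Represents ω μ e T (fun y => r (f y)) (fun x => r (a x)) := by
  have hrc : Continuous r := by
    refine (LipschitzWith.of_dist_le_mul (K := 1) fun z w => ?_).continuous
    simpa [dist_eq_norm] using hr z w
  have hrb : ∀ z, ‖r z‖ ≤ ‖z‖ + ‖r 0‖ := fun z => by
    have h1 := hr z 0
    have h2 := norm_le_norm_sub_add (r z) (r 0)
    rw [sub_zero] at h1
    linarith
  refine ⟨?_, ?_, fun ε hε => ?_⟩
  · obtain ⟨M, -, hM⟩ := exists_ae_bound hf.memLp
    refine memLp_top_of_bound (hrc.comp_aestronglyMeasurable hf.memLp.1) (M + ‖r 0‖) ?_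
    filter_upwards [hM] with y hy
    exact (hrb _).trans (by linarith)
  · obtain ⟨M, hM⟩ := hf.bdd
    exact ⟨M + ‖r 0‖, fun x => (hrb _).trans (by linarith [hM x])⟩
  · obtain ⟨φ, h1, h2⟩ := hf.approx ε hε
    refine ⟨⟨fun k => r (φ k), by fun_prop⟩, ?_, ?_⟩
    · exact (integral_mono_of_nonneg (Eventually.of_forall fun y => norm_nonneg _)
        (MemLp.integrable_of_top (hf.memLp.sub (h.memLp φ))).norm
        (Eventually.of_forall fun y => hr _ _)).trans h1
    · filter_upwards [h2] with n hn
      exact (mean_mono (fun x => hr _ _) n).trans hn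

theorem Represents.star {f : Y → ℂ} {a : Pts d → ℂ} (h : IsModel ω μ e T)
    (hf : Represents ω μ e T f a) :
    Represents ω μ e T (fun y => star (f y)) (fun x => star (a x)) :=
  hf.comp_lipschitz h fun z w => by rw [← star_sub, norm_star]

theorem Represents.norm {f : Y → ℂ} {a : Pts d → ℂ} (h : IsModel ω μ e T)
    (hf : Represents ω μ e T f a) :
    Represents ω μ e T (fun y => (‖f y‖ : ℂ)) (fun x => (‖a x‖ : ℂ)) :=
  hf.comp_lipschitz (r := fun z => (‖z‖ : ℂ)) h fun z w => by
    rw [← Complex.ofReal_sub, Complex.norm_real]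
    exact abs_norm_sub_norm_le z w

/-- The coordinatewise retraction of `ℂ` onto the square `[-M, M]²`. -/
def clampSquare (M : ℝ) (z : ℂ) : ℂ := ⟨max (-M) (min M z.re), max (-M) (min M z.im)⟩

theorem norm_clampSquare_sub_le (M : ℝ) (z w : ℂ) :
    ‖clampSquare M z - clampSquare M w‖ ≤ ‖z - w‖ := by
  have key : ∀ x y : ℝ, |max (-M) (min M x) - max (-M) (min M y)| ≤ |x - y| := fun x y => by
    have h1 := abs_max_sub_max_le_max (-M) (min M x) (-M) (min M y)
    have h2 := abs_min_sub_min_le_max M x M y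
    simp only [sub_self, abs_zero, abs_nonneg, sup_of_le_right] at h1 h2
    exact h1.trans h2
  rw [Complex.norm_def, Complex.norm_def]
  apply Real.sqrt_le_sqrt
  rw [Complex.normSq_apply, Complex.normSq_apply]
  have h1 := sq_le_sq.2 (key z.re w.re)
  have h2 := sq_le_sq.2 (key z.im w.im)
  simp only [clampSquare, Complex.sub_re, Complex.sub_im]
  nlinarith

theorem clampSquare_eq_self {M : ℝ} {z : ℂ} (hz : ‖z‖ ≤ M) : clampSquare M z = z := by
  have h1 := abs_le.1 ((Complex.abs_re_le_norm z).trans hz)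
  have h2 := abs_le.1 ((Complex.abs_im_le_norm z).trans hz)
  apply Complex.ext <;> simp [clampSquare, h1, h2]

theorem norm_clampSquare_le {M : ℝ} (hM : 0 ≤ M) (z : ℂ) : ‖clampSquare M z‖ ≤ 2 * M := by
  have key : ∀ x : ℝ, |max (-M) (min M x)| ≤ M := fun x => by
    rw [abs_le]
    exact ⟨le_max_left _ _, max_le (by linarith) (min_le_left _ _)⟩
  refine (Complex.norm_le_abs_re_add_abs_im _).trans ?_
  have h1 := key z.re
  have h2 := key z.im
  simp only [clampSquare]
  linarith

/-- Uniformly bounded continuous functions approximate a bounded function in `L¹`. -/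
theorem IsModel.exists_continuous_near (h : IsModel ω μ e T) {f : Y → ℂ} (hf : MemLp f ∞ μ) :
    ∃ M, ∀ ε > 0, ∃ φ : C(K, ℂ), (∀ k, ‖φ k‖ ≤ M) ∧ ∫ y, ‖f y - φ (e y)‖ ∂μ ≤ ε := by
  obtain ⟨M, hM0, hM⟩ := exists_ae_bound hf
  refine ⟨2 * M, fun ε hε => ?_⟩
  have he := h.measurableEmbedding
  have hext : ∀ y, Function.extend e f 0 (e y) = f y := fun y => he.injective.extend_apply f 0 y
  have hi : Integrable (Function.extend e f 0) (μ.map e) := by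
    rw [he.integrable_map_iff]
    exact (MemLp.integrable_of_top hf).congr (Eventually.of_forall fun y => (hext y).symm)
  have : IsProbabilityMeasure (μ.map e) :=
    Measure.isProbabilityMeasure_map he.measurable.aemeasurable
  obtain ⟨ψ, hψ, hψi⟩ := hi.exists_boundedContinuous_integral_sub_le hε
  rw [he.integral_map] at hψ
  have hψi' : Integrable (fun y => ψ (e y)) μ := (he.integrable_map_iff).1 hψi
  have hc : Continuous (clampSquare M) := by
    refine (LipschitzWith.of_dist_le_mul (K := 1) fun z w => ?_).continuous
    simpa [dist_eq_norm] using norm_clampSquare_sub_le M z w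
  refine ⟨⟨fun k => clampSquare M (ψ k), hc.comp ψ.continuous⟩,
    fun k => norm_clampSquare_le hM0.le _, ?_⟩
  refine le_trans (integral_mono_of_nonneg (Eventually.of_forall fun y => norm_nonneg _)
    ((MemLp.integrable_of_top hf).sub hψi').norm ?_) (le_of_eq_of_le ?_ hψ)
  · filter_upwards [hM] with y hy
    have := norm_clampSquare_sub_le M (f y) (ψ (e y))
    rwa [clampSquare_eq_self hy] at this
  · simp only [hext, Pi.sub_apply]

/-- Every bounded function is represented by a bounded sequence. -/
theorem IsModel.exists_represents (h : IsModel ω μ e T) (hω : (ω : Filter ℕ) ≤ cofinite)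
    {f : Y → ℂ} (hf : MemLp f ∞ μ) : ∃ a, Represents ω μ e T f a := by
  obtain ⟨M, hM⟩ := h.exists_continuous_near hf
  have hε : ∀ k : ℕ, (0 : ℝ) < 1 / (k + 1) := fun k => Nat.one_div_pos_of_nat
  choose φ hφM hφ using fun k : ℕ => hM (1 / (k + 1)) (hε k)
  have hφd : ∀ i k, i ≤ k → ∫ y, ‖(φ k - φ i) (e y)‖ ∂μ ≤ 2 * (1 / (i + 1)) := by
    intro i k hik
    have i1 := (MemLp.integrable_of_top (hf.sub (h.memLp (φ k)))).norm
    have i2 := (MemLp.integrable_of_top (hf.sub (h.memLp (φ i)))).norm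
    calc _ ≤ ∫ y, (‖f y - φ k (e y)‖ + ‖f y - φ i (e y)‖) ∂μ := by
          refine integral_mono_of_nonneg (Eventually.of_forall fun y => norm_nonneg _)
            (i1.add i2) (Eventually.of_forall fun y => ?_)
          simp only [ContinuousMap.sub_apply]
          rw [norm_sub_rev (f y) (φ k (e y))]
          exact norm_sub_le_norm_sub_add_norm_sub _ _ _
      _ = _ := integral_add i1 i2
      _ ≤ 1 / (k + 1) + 1 / (i + 1) := add_le_add (hφ k) (hφ i)
      _ ≤ _ := by
        have : (1 : ℝ) / (k + 1) ≤ 1 / (i + 1) := Nat.one_div_le_one_div hik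
        linarith
  have hP : ∀ k, ∀ᶠ n in (ω : Filter ℕ), ∀ i ∈ Finset.range (k + 1),
      mean (fun x => ‖(φ k - φ i) (T x)‖) n ≤ 3 * (1 / (i + 1)) := by
    intro k
    rw [Filter.eventually_all_finset]
    intro i hi
    have h1 := hφd i k (by simpa [Nat.lt_succ_iff] using hi)
    have h2 := h.tendsto_mean_norm (φ k - φ i)
    filter_upwards [h2.eventually_lt_const (show _ < 3 * (1 / ((i : ℝ) + 1)) by
      have := hε i
      linarith)] with n hn
    exact hn.le
  obtain ⟨κ, hκ1, hκ2⟩ := exists_diagonal hω hP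
  refine ⟨fun x => φ (κ x.1) (T x), hf, ⟨M, fun x => hφM _ _⟩, fun ε hε' => ?_⟩
  obtain ⟨i, hi⟩ := exists_nat_one_div_lt (show 0 < ε / 3 by positivity)
  refine ⟨φ i, (hφ i).trans (by linarith [hε i]), ?_⟩
  filter_upwards [hκ1, hκ2 i] with n h1 h2
  have h3 := h1 i (by simpa [Nat.lt_succ_iff] using h2)
  refine le_trans (le_of_eq ?_) (h3.trans (by linarith))
  simp [mean]

end Represents

/-! ### Represented sets and the locality principle -/

/-- The sequence `C` of subsets of the finite models represents the measurable set `A`. -/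
structure RepresentsSet {Y K : Type*} [MeasurableSpace Y] [TopologicalSpace K]
    (ω : Ultrafilter ℕ) {d : ℕ → ℕ} (μ : Measure Y) (e : Y → K) (T : Pts d → K)
    (A : Set Y) (C : Set (Pts d)) : Prop where
  measurableSet : MeasurableSet A
  represents : Represents ω μ e T (A.indicator 1) (C.indicator 1)

theorem exists_bound_indicator {α : Type*} (C : Set α) {a : α → ℂ} (ha : ∃ M, ∀ x, ‖a x‖ ≤ M) :
    ∃ M, ∀ x, ‖C.indicator a x‖ ≤ M := by
  obtain ⟨M, hM⟩ := ha
  exact ⟨M, fun x => (norm_indicator_le_norm_self a x).trans (hM x)⟩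

theorem exists_bound_one {α : Type*} : ∃ M, ∀ x : α, ‖(1 : α → ℂ) x‖ ≤ M := ⟨1, by simp⟩

section RepresentsSet
variable {Y K : Type*} [MeasurableSpace Y] [TopologicalSpace K] [CompactSpace K] [T2Space K]
  [SecondCountableTopology K] [MeasurableSpace K] [BorelSpace K]
  {ω : Ultrafilter ℕ} {d : ℕ → ℕ} [∀ n, NeZero (d n)]
  {μ : Measure Y} [IsProbabilityMeasure μ] {e : Y → K} {T : Pts d → K}

theorem Represents.indicator {f : Y → ℂ} {a : Pts d → ℂ} {A : Set Y} {C : Set (Pts d)}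
    (h : IsModel ω μ e T) (hf : Represents ω μ e T f a) (hA : RepresentsSet ω μ e T A C) :
    Represents ω μ e T (A.indicator f) (C.indicator a) := by
  have := hA.represents.mul h hf
  simpa only [← Set.indicator_mul_left, Pi.one_apply, one_mul] using this

theorem RepresentsSet.univ (h : IsModel ω μ e T) :
    RepresentsSet ω μ e T Set.univ (Set.univ : Set (Pts d)) where
  measurableSet := MeasurableSet.univ
  represents := by
    rw [Set.indicator_univ, Set.indicator_univ]
    exact h.represents_const 1

theorem RepresentsSet.inter {A B : Set Y} {C D : Set (Pts d)} (h : IsModel ω μ e T)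
    (hA : RepresentsSet ω μ e T A C) (hB : RepresentsSet ω μ e T B D) :
    RepresentsSet ω μ e T (A ∩ B) (C ∩ D) where
  measurableSet := hA.measurableSet.inter hB.measurableSet
  represents := by
    rw [← Set.indicator_indicator, ← Set.indicator_indicator]
    exact hB.represents.indicator h hA

theorem RepresentsSet.compl {A : Set Y} {C : Set (Pts d)} (h : IsModel ω μ e T)
    (hA : RepresentsSet ω μ e T A C) : RepresentsSet ω μ e T Aᶜ Cᶜ where
  measurableSet := hA.measurableSet.compl
  represents := by
    rw [Set.indicator_compl, Set.indicator_compl]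
    exact (h.represents_const 1).sub h hA.represents

theorem RepresentsSet.biInter {ι : Type*} {A : ι → Set Y} {C : ι → Set (Pts d)}
    (h : IsModel ω μ e T) (hA : ∀ i, RepresentsSet ω μ e T (A i) (C i)) (s : Finset ι) :
    RepresentsSet ω μ e T (⋂ i ∈ s, A i) (⋂ i ∈ s, C i) := by
  classical
  induction s using Finset.induction_on with
  | empty => simpa using RepresentsSet.univ h
  | insert i s _ ih =>
    rw [Finset.set_biInter_insert, Finset.set_biInter_insert]
    exact (hA i).inter h ih

theorem RepresentsSet.congr_right {A : Set Y} {C D : Set (Pts d)}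
    (hA : RepresentsSet ω μ e T A C) (hCD : ∀ᶠ x in loebFilter ω d, x ∈ D ↔ x ∈ C) :
    RepresentsSet ω μ e T A D where
  measurableSet := hA.measurableSet
  represents := hA.represents.congr_right (exists_bound_indicator D exists_bound_one) (by
    filter_upwards [hCD] with x hx
    by_cases h : x ∈ C <;> simp [h, hx])

theorem RepresentsSet.tendsto_mean {A : Set Y} {C : Set (Pts d)} (h : IsModel ω μ e T)
    (hA : RepresentsSet ω μ e T A C) :
    Tendsto (mean (C.indicator (1 : Pts d → ℝ))) ω (𝓝 (μ.real A)) := by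
  have h1 := hA.represents.tendsto_mean h
  have h0 : ∫ y, A.indicator (1 : Y → ℂ) y ∂μ = (μ.real A : ℂ) := by
    rw [integral_indicator hA.measurableSet]
    simp
  rw [h0] at h1
  have h2 := (Complex.continuous_re.tendsto _).comp h1
  refine h2.congr fun n => ?_
  simp only [mean, Function.comp_apply]
  rw [Complex.smul_re, Complex.re_sum]
  congr 1
  refine Finset.sum_congr rfl fun j _ => ?_
  by_cases hj : (⟨n, j⟩ : Pts d) ∈ C <;> simp [hj]

theorem RepresentsSet.eventually_notMem {A : Set Y} {C : Set (Pts d)} (h : IsModel ω μ e T)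
    (hA : RepresentsSet ω μ e T A C) (h0 : μ A = 0) : ∀ᶠ x in loebFilter ω d, x ∉ C := by
  rw [eventually_loeb]
  have h1 := hA.tendsto_mean h
  rw [measureReal_def, h0] at h1
  simpa using h1

theorem IsModel.exists_representsSet (h : IsModel ω μ e T) (hω : (ω : Filter ℕ) ≤ cofinite)
    {A : Set Y} (hA : MeasurableSet A) : ∃ C, RepresentsSet ω μ e T A C := by
  obtain ⟨a, ha⟩ := h.exists_represents hω (f := A.indicator 1)
    (memLp_top_of_bound (measurable_one.indicator hA).aestronglyMeasurable 1
      (Eventually.of_forall fun y => (norm_indicator_le_norm_self _ y).trans (by simp)))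
  -- `a² = a` in the limit, so that `a` may be rounded to `0` or `1`
  refine ⟨{x | 1 / 2 < (a x).re}, hA,
    ha.congr ae_eq_rfl (exists_bound_indicator _ exists_bound_one) ?_⟩
  have h1 := ((ha.mul h ha).sub h ha).tendsto_zero h (Eventually.of_forall fun y => by
    by_cases hy : y ∈ A <;> simp [hy])
  have h2 := h1.norm.const_mul 2
  rw [norm_zero, mul_zero] at h2
  refine squeeze_zero_norm (fun x => ?_) h2
  have h3 : ‖a x * a x - a x‖ = ‖a x‖ * ‖1 - a x‖ := by
    rw [← norm_mul, ← norm_neg]; congr 1; ring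
  rw [h3]
  by_cases hx : 1 / 2 < (a x).re
  · rw [Set.indicator_of_mem (by exact hx), Pi.one_apply]
    have := (Complex.abs_re_le_norm (a x))
    have h4 := le_abs_self (a x).re
    nlinarith [norm_nonneg (1 - a x)]
  · rw [Set.indicator_of_notMem (by exact hx), zero_sub, norm_neg]
    have := (Complex.abs_re_le_norm (1 - a x))
    have h4 := le_abs_self (1 - a x).re
    rw [Complex.sub_re, Complex.one_re] at h4 this
    nlinarith [norm_nonneg (a x)]

/-- Locality: a sequence represents `f` if it does so on each piece of a countable cover. -/
theorem represents_of_cover {ι : Type*} [Countable ι] {A : ι → Set Y} {C : ι → Set (Pts d)}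
    (h : IsModel ω μ e T) (hω : (ω : Filter ℕ) ≤ cofinite)
    (hA : ∀ i, RepresentsSet ω μ e T (A i) (C i)) (hcov : ∀ᵐ y ∂μ, ∃ i, y ∈ A i)
    {f : Y → ℂ} {a : Pts d → ℂ} (hf : MemLp f ∞ μ) (ha : ∃ M, ∀ x, ‖a x‖ ≤ M)
    (hloc : ∀ i, Represents ω μ e T ((A i).indicator f) ((C i).indicator a)) :
    Represents ω μ e T f a := by
  obtain ⟨a', ha'⟩ := h.exists_represents hω hf
  refine ha'.congr ae_eq_rfl ha ?_
  have hb : ∃ M, ∀ x, ‖a x - a' x‖ ≤ M := by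
    obtain ⟨M, hM⟩ := ha
    obtain ⟨M', hM'⟩ := ha'.bdd
    exact ⟨M + M', fun x => (norm_sub_le _ _).trans (add_le_add (hM x) (hM' x))⟩
  have hpiece : ∀ i, Tendsto (mean fun x => ‖(C i).indicator (fun x => a x - a' x) x‖) ω (𝓝 0) := by
    intro i
    rw [mean_norm_tendsto_zero_iff (exists_bound_indicator _ hb)]
    have := ((hloc i).sub h (ha'.indicator h (hA i))).tendsto_zero h
      (Eventually.of_forall fun y => by simp)
    refine this.congr fun x => ?_
    by_cases hx : x ∈ C i <;> simp [hx]
  rw [← mean_norm_tendsto_zero_iff hb, Metric.tendsto_nhds]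
  obtain ⟨M, hM⟩ := hb
  intro ε hε
  have hlim : Tendsto (fun s : Finset ι => M * μ.real (⋂ i ∈ s, (A i)ᶜ)) atTop (𝓝 0) := by
    have h1 : Tendsto (fun s : Finset ι => μ (⋂ i ∈ s, (A i)ᶜ)) atTop
        (𝓝 (μ (⋂ s : Finset ι, ⋂ i ∈ s, (A i)ᶜ))) := by
      refine tendsto_measure_iInter_atTop (fun s => ?_) (fun s t hst => ?_) ⟨∅, measure_ne_top _ _⟩
      · exact (Finset.measurableSet_biInter s fun i _ =>
          (hA i).measurableSet.compl).nullMeasurableSet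
      · exact Set.biInter_subset_biInter_left hst
    have h2 : μ (⋂ s : Finset ι, ⋂ i ∈ s, (A i)ᶜ) = 0 := by
      rw [← nonpos_iff_eq_zero, ← ae_iff.1 hcov]
      refine measure_mono fun y hy => ?_
      rintro ⟨i, hi⟩
      simp only [Set.mem_iInter] at hy
      exact hy {i} i (Finset.mem_singleton_self i) hi
    rw [h2] at h1
    have h3 := ((ENNReal.tendsto_toReal ENNReal.zero_ne_top).comp h1).const_mul M
    rwa [ENNReal.toReal_zero, mul_zero] at h3
  obtain ⟨s, hs⟩ := (hlim.eventually_lt_const (show 0 < ε / 2 by positivity)).exists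
  have h4 := ((RepresentsSet.biInter h (fun i => (hA i).compl h) s).tendsto_mean h).const_mul M
  have h5 := tendsto_finsetSum s fun i _ => hpiece i
  rw [Finset.sum_const_zero] at h5
  filter_upwards [h4.eventually_lt_const hs,
    h5.eventually_lt_const (show 0 < ε / 2 by positivity)] with n hn1 hn2
  rw [Real.dist_eq, sub_zero, abs_of_nonneg (mean_nonneg (fun x => norm_nonneg _) n)]
  have : mean (fun x => ‖a x - a' x‖) n ≤
      mean (fun x => M * (⋂ i ∈ s, (C i)ᶜ).indicator 1 x +
        ∑ i ∈ s, ‖(C i).indicator (fun x => a x - a' x) x‖) n := by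
    refine mean_mono (fun x => ?_) n
    by_cases hx : ∃ i ∈ s, x ∈ C i
    · obtain ⟨i, his, hi⟩ := hx
      have h6 := Finset.single_le_sum (f := fun i => ‖(C i).indicator (fun x => a x - a' x) x‖)
        (fun i _ => norm_nonneg _) his
      simp only [Set.indicator_of_mem hi] at h6
      have h7 := mul_nonneg ((norm_nonneg _).trans (hM x))
        (indicator_one_nonneg (⋂ i ∈ s, (C i)ᶜ) x)
      linarith
    · push Not at hx
      rw [Set.indicator_of_mem (by simpa using hx), Pi.one_apply, mul_one]
      have := hM x
      have h6 := Finset.sum_nonneg fun i (_ : i ∈ s) =>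
        norm_nonneg ((C i).indicator (fun x => a x - a' x) x)
      linarith
  rw [mean_add, mean_const_mul, mean_sum] at this
  linarith

end RepresentsSet

/-! ### Permutations representing elements of the full group -/

/-- A model of an action of `G` on `(Y, μ)` by the maps `σ n : G → Sym(d n)`. -/
structure IsActionModel {G Y K : Type*} [Group G] [MulAction G Y] [MeasurableSpace Y]
    [TopologicalSpace K] [MeasurableSpace K] (ω : Ultrafilter ℕ) {d : ℕ → ℕ} (μ : Measure Y)
    (e : Y → K) (T : Pts d → K) (σ : ∀ n, G → Equiv.Perm (Fin (d n))) : Prop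
    extends IsModel ω μ e T where
  translate : ∀ (g : G) {f : Y → ℂ} {a : Pts d → ℂ}, Represents ω μ e T f a →
    Represents ω μ e T (fun y => f (g • y)) (fun x => a (act (σ · g) x))
  stabilizer : ∀ g : G, Represents ω μ e T ({y | g • y = y}.indicator 1)
    ({x | act (σ · g) x = x}.indicator 1)
  approx_mul : ∀ g h : G, ∀ᶠ x in loebFilter ω d,
    act (σ · (g * h)) x = act (σ · g) (act (σ · h) x)

/-- The sequence of permutations `p` represents the transformation `γ`: the points at which `p`
agrees with `σ(g)` represent the points at which `γ` agrees with `g`, for each `g ∈ G`. -/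
def RepresentsPerm {G Y K : Type*} [Group G] [MulAction G Y] [MeasurableSpace Y]
    [TopologicalSpace K] (ω : Ultrafilter ℕ) {d : ℕ → ℕ} (μ : Measure Y)
    (e : Y → K) (T : Pts d → K) (σ : ∀ n, G → Equiv.Perm (Fin (d n)))
    (γ : Y → Y) (p : ∀ n, Equiv.Perm (Fin (d n))) : Prop :=
  ∀ g : G, RepresentsSet ω μ e T {y | γ y = g • y} {x | act p x = act (σ · g) x}

/-- An injective partial map of a finite set extends to a permutation. -/
theorem exists_perm_eqOn {α : Type*} [Finite α] {f : α → α} {U : Set α} (hf : U.InjOn f) :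
    ∃ p : Equiv.Perm α, ∀ x ∈ U, p x = f x := by
  classical
  refine ⟨Equiv.extendSubtype (p := (· ∈ U)) (q := (· ∈ f '' U))
    (Equiv.Set.imageOfInjOn f U hf), fun x hx => ?_⟩
  rw [Equiv.extendSubtype_apply_of_mem _ _ hx]
  rfl

section ActionModel
variable {G Y K : Type*} [Group G] [Countable G] [MulAction G Y] [MeasurableSpace Y]
  [MeasurableConstSMul G Y] [TopologicalSpace K] [CompactSpace K] [T2Space K]
  [SecondCountableTopology K] [MeasurableSpace K] [BorelSpace K]
  {ω : Ultrafilter ℕ} {d : ℕ → ℕ} [∀ n, NeZero (d n)]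
  {μ : Measure Y} [IsProbabilityMeasure μ] {e : Y → K} {T : Pts d → K}
  {σ : ∀ n, G → Equiv.Perm (Fin (d n))}

theorem IsModel.measurableSet_eq (h : IsModel ω μ e T) {f g : Y → Y} (hf : Measurable f)
    (hg : Measurable g) : MeasurableSet {y | f y = g y} := by
  have := measurableSet_eq_fun (h.measurableEmbedding.measurable.comp hf)
    (h.measurableEmbedding.measurable.comp hg)
  simpa [h.measurableEmbedding.injective.eq_iff] using this

theorem IsActionModel.act_one (h : IsActionModel ω μ e T σ) :
    ∀ᶠ x in loebFilter ω d, act (σ · 1) x = x := by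
  filter_upwards [h.approx_mul 1 1] with x hx
  rw [mul_one] at hx
  exact (act_injective _ hx).symm

theorem IsActionModel.act_inv_mul (h : IsActionModel ω μ e T σ) (g k : G) :
    ∀ᶠ x in loebFilter ω d, act (σ · (g⁻¹ * k)) x = act (σ · g)⁻¹ (act (σ · k) x) := by
  filter_upwards [h.approx_mul g (g⁻¹ * k)] with x hx
  rw [mul_inv_cancel_left] at hx
  rw [hx, act_inv_act]

theorem RepresentsSet.translate (h : IsActionModel ω μ e T σ) {A : Set Y} {C : Set (Pts d)}
    (hA : RepresentsSet ω μ e T A C) (g : G) :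
    RepresentsSet ω μ e T ((g • ·) ⁻¹' A) (act (σ · g) ⁻¹' C) where
  measurableSet := measurable_const_smul g hA.measurableSet
  represents := h.translate g hA.represents

theorem IsActionModel.representsSet_smul_eq_smul (h : IsActionModel ω μ e T σ) (g k : G) :
    RepresentsSet ω μ e T {y | g • y = k • y} {x | act (σ · g) x = act (σ · k) x} := by
  have h1 : RepresentsSet ω μ e T {y | (k⁻¹ * g) • y = y} {x | act (σ · (k⁻¹ * g)) x = x} :=
    ⟨h.measurableSet_eq (measurable_const_smul _) measurable_id, h.stabilizer _⟩
  have h2 : {y : Y | g • y = k • y} = {y | (k⁻¹ * g) • y = y} := by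
    ext y
    simp only [Set.mem_ofPred_eq, mul_smul, inv_smul_eq_iff]
  rw [h2]
  refine h1.congr_right ?_
  filter_upwards [h.act_inv_mul k g] with x hx
  change act (σ · g) x = act (σ · k) x ↔ act (σ · (k⁻¹ * g)) x = x
  rw [hx, eq_comm (b := x), ← act_eq_iff, eq_comm]

/-- To represent `γ` it suffices to represent each piece of a countable partition into sets on which
`γ` is given by the action of one group element. -/
theorem representsPerm_of_cover {ι : Type*} [Countable ι] {A : ι → Set Y} {C : ι → Set (Pts d)}
    {k : ι → G} (h : IsActionModel ω μ e T σ) (hω : (ω : Filter ℕ) ≤ cofinite)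
    (hA : ∀ i, RepresentsSet ω μ e T (A i) (C i)) (hcov : ∀ᵐ y ∂μ, ∃ i, y ∈ A i)
    {γ : Y → Y} (hγ : Measurable γ) {p : ∀ n, Equiv.Perm (Fin (d n))}
    (hγA : ∀ i, ∀ y ∈ A i, γ y = k i • y)
    (hpC : ∀ i, ∀ᶠ x in loebFilter ω d, x ∈ C i → act p x = act (σ · (k i)) x) :
    RepresentsPerm ω μ e T σ γ p := by
  intro g
  have hm := h.measurableSet_eq hγ (measurable_const_smul g)
  refine ⟨hm, represents_of_cover h.toIsModel hω hA hcov ?_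
    (exists_bound_indicator _ exists_bound_one) fun i => ?_⟩
  · exact memLp_top_of_bound (measurable_one.indicator hm).aestronglyMeasurable 1
      (Eventually.of_forall fun y => (norm_indicator_le_norm_self _ y).trans (by simp))
  · have h1 := ((hA i).inter h.toIsModel (h.representsSet_smul_eq_smul (k i) g)).represents
    rw [← Set.indicator_indicator, ← Set.indicator_indicator] at h1
    refine (h1.congr_right
      (exists_bound_indicator _ (exists_bound_indicator _ exists_bound_one)) ?_).congr_left ?_
    · filter_upwards [hpC i] with x hx
      by_cases hxC : x ∈ C i
      · simp [hxC, Set.indicator_apply, hx hxC]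
      · simp [hxC]
    · refine Eventually.of_forall fun y => ?_
      by_cases hy : y ∈ A i
      · classical
        simp only [Set.indicator_of_mem hy, Set.indicator_apply, Set.mem_ofPred_eq, hγA i y hy]
      · simp [hy]

theorem representsPerm_smul (h : IsActionModel ω μ e T σ) (g : G) :
    RepresentsPerm ω μ e T σ (g • ·) (σ · g) :=
  fun k => h.representsSet_smul_eq_smul g k

/-- Two sequences of permutations that represent the same `γ` agree almost everywhere. -/
theorem RepresentsPerm.unique (h : IsActionModel ω μ e T σ) (hω : (ω : Filter ℕ) ≤ cofinite)
    {γ δ : Y → Y} (hγ : ∀ᵐ y ∂μ, ∃ g : G, γ y = g • y) (hγδ : ∀ᵐ y ∂μ, γ y = δ y)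
    {p q : ∀ n, Equiv.Perm (Fin (d n))} (hp : RepresentsPerm ω μ e T σ γ p)
    (hq : RepresentsPerm ω μ e T σ δ q) : ∀ᶠ x in loebFilter ω d, act p x = act q x := by
  have h1 : Represents ω μ e T 1 ({x | act p x = act q x}.indicator 1) := by
    refine represents_of_cover h.toIsModel hω (fun g => (hp g).inter h.toIsModel (hq g)) ?_
      (memLp_top_of_bound aestronglyMeasurable_const 1 (by simp))
      (exists_bound_indicator _ exists_bound_one) fun g => ?_
    · filter_upwards [hγ, hγδ] with y hy hy'
      obtain ⟨g, hg⟩ := hy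
      exact ⟨g, hg, hy'.symm.trans hg⟩
    · refine ((hp g).inter h.toIsModel (hq g)).represents.congr_right
        (exists_bound_indicator _ (exists_bound_indicator _ exists_bound_one))
        (Eventually.of_forall fun x => ?_)
      by_cases hx : act p x = act (σ · g) x ∧ act q x = act (σ · g) x
      · have h3 : x ∈ {x | act p x = act q x} := hx.1.trans hx.2.symm
        rw [Set.indicator_indicator, Set.indicator_apply, Set.indicator_apply]
        simp only [Set.mem_inter_iff, h3, and_true]
      · rw [Set.indicator_of_notMem (by exact hx), Set.indicator_of_notMem (by exact hx)]
  have h2 : RepresentsSet ω μ e T Set.univ {x | act p x = act q x} :=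
    ⟨MeasurableSet.univ, by rwa [Set.indicator_univ]⟩
  filter_upwards [(h2.compl h.toIsModel).eventually_notMem h.toIsModel (by simp)] with x hx
  simpa using hx

theorem RepresentsPerm.mul (h : IsActionModel ω μ e T σ) (hω : (ω : Filter ℕ) ≤ cofinite)
    {γ δ : Y → Y} (hγm : Measurable γ) (hδm : MeasurePreserving δ μ μ)
    (hγ : ∀ᵐ y ∂μ, ∃ g : G, γ y = g • y) (hδ : ∀ᵐ y ∂μ, ∃ g : G, δ y = g • y)
    {p q : ∀ n, Equiv.Perm (Fin (d n))} (hp : RepresentsPerm ω μ e T σ γ p)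
    (hq : RepresentsPerm ω μ e T σ δ q) :
    RepresentsPerm ω μ e T σ (fun y => γ (δ y)) (p * q) := by
  refine representsPerm_of_cover (ι := G × G) (k := fun i => i.2 * i.1) h hω
    (fun i => (hq i.1).inter h.toIsModel ((hp i.2).translate h i.1)) ?_
    (hγm.comp hδm.measurable) ?_ ?_
  · filter_upwards [hδ, hδm.quasiMeasurePreserving.ae hγ] with y hy hy'
    obtain ⟨g, hg⟩ := hy
    obtain ⟨k, hk⟩ := hy'
    rw [hg] at hk
    exact ⟨(g, k), hg, hk⟩
  · rintro ⟨g, k⟩ y ⟨h1, h2⟩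
    have h1' : δ y = g • y := h1
    have h2' : γ (g • y) = k • g • y := h2
    change γ (δ y) = (k * g) • y
    rw [h1', h2', mul_smul]
  · rintro ⟨g, k⟩
    filter_upwards [h.approx_mul k g] with x hx
    rintro ⟨h1, h2⟩
    have h1' : act q x = act (σ · g) x := h1
    have h2' : act p (act (σ · g) x) = act (σ · k) (act (σ · g) x) := h2
    rw [act_mul, h1', h2', hx]

/-- Every injective transformation that moves points within orbits is represented: a partition of
`Y` into pieces on which `γ` is given by single group elements is lifted to the finite models,
and made disjoint there together with its image. -/
theorem exists_representsPerm (h : IsActionModel ω μ e T σ) (hω : (ω : Filter ℕ) ≤ cofinite)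
    {γ : Y → Y} (hγm : Measurable γ) (hγi : Function.Injective γ)
    (hγ : ∀ᵐ y ∂μ, ∃ g : G, γ y = g • y) : ∃ p, RepresentsPerm ω μ e T σ γ p := by
  obtain ⟨s, hs⟩ := exists_surjective_nat G
  set A : ℕ → Set Y := disjointed fun k => {y | γ y = s k • y} with hAdef
  have hAs : ∀ k, A k ⊆ {y | γ y = s k • y} := disjointed_subset _
  have hAd : ∀ {i k y}, i < k → y ∈ A k → y ∉ A i := fun hik hk hi =>
    (Set.disjoint_left.1 (disjoint_disjointed _ hik.ne)) hi hk
  have hAm : ∀ k, MeasurableSet (A k) := fun k =>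
    MeasurableSet.disjointed (fun k => h.measurableSet_eq hγm (measurable_const_smul (s k))) k
  choose C hC using fun k => h.exists_representsSet hω (hAm k)
  -- `C k` cut down so that both the `D k` and their images under `σ (s k)` are disjoint
  set D : ℕ → Set (Pts d) := fun k => {x | x ∈ C k ∧ ∀ i < k, x ∉ C i ∧
    act (σ · (s i))⁻¹ (act (σ · (s k)) x) ∉ C i} with hDdef
  have hCD : ∀ k, ∀ᶠ x in loebFilter ω d, x ∈ C k → x ∈ D k := by
    intro k
    have h1 : ∀ᶠ x in loebFilter ω d, ∀ i ∈ Finset.range k, x ∈ C k → x ∉ C i ∧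
        act (σ · (s i))⁻¹ (act (σ · (s k)) x) ∉ C i := by
      rw [Filter.eventually_all_finset]
      intro i hi
      have hik : i < k := Finset.mem_range.1 hi
      have e1 := ((hC k).inter h.toIsModel (hC i)).eventually_notMem h.toIsModel (by
        rw [show A k ∩ A i = ∅ from Set.eq_empty_of_forall_notMem fun y hy => hAd hik hy.1 hy.2,
          measure_empty])
      have e2 := ((hC k).inter h.toIsModel
        ((hC i).translate h ((s i)⁻¹ * s k))).eventually_notMem h.toIsModel (by
        rw [← measure_empty (μ := μ)]
        congr 1
        refine Set.eq_empty_of_forall_notMem fun y hy => ?_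
        have h2 : γ y = s k • y := hAs k hy.1
        have h3 : ((s i)⁻¹ * s k) • y ∈ A i := hy.2
        have h4 : γ (((s i)⁻¹ * s k) • y) = s i • ((s i)⁻¹ * s k) • y := hAs i h3
        rw [mul_smul (s i)⁻¹, smul_inv_smul, ← h2] at h4
        rw [mul_smul, ← h2, hγi h4] at h3
        exact hAd hik hy.1 h3)
      filter_upwards [e1, e2, h.act_inv_mul (s i) (s k)] with x h1 h2 h3 hx
      refine ⟨fun h4 => h1 ⟨hx, h4⟩, fun h4 => h2 ⟨hx, ?_⟩⟩
      rw [Set.mem_preimage, h3]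
      exact h4
    filter_upwards [h1] with x hx hxC
    exact ⟨hxC, fun i hi => hx i (Finset.mem_range.2 hi) hxC⟩
  have hinj : ∀ {i k x z}, x ∈ D i → z ∈ D k → i < k →
      x ≠ z ∧ act (σ · (s i)) x ≠ act (σ · (s k)) z := by
    intro i k x z hx hz hik
    refine ⟨fun hxz => (hz.2 i hik).1 (hxz ▸ hx.1), fun hxz => (hz.2 i hik).2 ?_⟩
    rw [← hxz, act_inv_act]
    exact hx.1
  have hp : ∀ n, ∃ p : Equiv.Perm (Fin (d n)), ∀ k (j : Fin (d n)), (⟨n, j⟩ : Pts d) ∈ D k →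
      p j = σ n (s k) j := by
    intro n
    classical
    set f : Fin (d n) → Fin (d n) := fun j =>
      if hj : ∃ k, (⟨n, j⟩ : Pts d) ∈ D k then σ n (s hj.choose) j else j with hf
    have hfj : ∀ k (j : Fin (d n)), (⟨n, j⟩ : Pts d) ∈ D k → f j = σ n (s k) j := by
      intro k j hj
      have hj' : ∃ k, (⟨n, j⟩ : Pts d) ∈ D k := ⟨k, hj⟩
      have : hj'.choose = k := by
        rcases lt_trichotomy hj'.choose k with hlt | heq | hgt
        · exact absurd rfl (hinj hj'.choose_spec hj hlt).1
        · exact heq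
        · exact absurd rfl (hinj hj hj'.choose_spec hgt).1
      rw [hf]
      simp only [dif_pos hj', this]
    obtain ⟨p, hp⟩ := exists_perm_eqOn (f := f) (U := {j | ∃ k, (⟨n, j⟩ : Pts d) ∈ D k}) (by
      rintro i ⟨k, hi⟩ j ⟨l, hj⟩ hij
      rw [hfj k i hi, hfj l j hj] at hij
      rcases lt_trichotomy k l with hlt | heq | hgt
      · exact absurd (by simp [act, hij]) (hinj hi hj hlt).2
      · subst heq
        exact (σ n (s k)).injective hij
      · exact absurd (by simp [act, hij]) (hinj hj hi hgt).2)
    exact ⟨p, fun k j hj => (hp j ⟨k, hj⟩).trans (hfj k j hj)⟩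
  choose p hp using hp
  refine ⟨p, representsPerm_of_cover h hω hC ?_ hγm (fun k y hy => hAs k hy) fun k => ?_⟩
  · filter_upwards [hγ] with y hy
    obtain ⟨g, hg⟩ := hy
    obtain ⟨k, rfl⟩ := hs g
    have : y ∈ ⋃ k, A k := by
      rw [hAdef, iUnion_disjointed]
      exact Set.mem_iUnion.2 ⟨k, hg⟩
    exact Set.mem_iUnion.1 this
  · filter_upwards [hCD k] with x hx hxC
    obtain ⟨n, j⟩ := x
    simp only [act, hp n k j (hx hxC)]

theorem Represents.comp_representsPerm (h : IsActionModel ω μ e T σ)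
    (hω : (ω : Filter ℕ) ≤ cofinite) {γ : Y → Y} (hγm : MeasurePreserving γ μ μ)
    (hγ : ∀ᵐ y ∂μ, ∃ g : G, γ y = g • y) {p : ∀ n, Equiv.Perm (Fin (d n))}
    (hp : RepresentsPerm ω μ e T σ γ p) {f : Y → ℂ} {a : Pts d → ℂ}
    (hf : Represents ω μ e T f a) :
    Represents ω μ e T (fun y => f (γ y)) (fun x => a (act p x)) := by
  refine represents_of_cover h.toIsModel hω hp hγ (hf.memLp.comp_measurePreserving hγm) ?_
    fun g => ?_
  · obtain ⟨M, hM⟩ := hf.bdd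
    exact ⟨M, fun x => hM _⟩
  · have h1 := (h.translate g hf).indicator h.toIsModel (hp g)
    convert h1 using 1
    · refine Set.indicator_congr fun y hy => ?_
      rw [show γ y = g • y from hy]
    · refine Set.indicator_congr fun x hx => ?_
      rw [show act p x = act (σ · g) x from hx]

theorem RepresentsPerm.representsSet_fixed (h : IsActionModel ω μ e T σ) {γ : Y → Y}
    {p : ∀ n, Equiv.Perm (Fin (d n))} (hp : RepresentsPerm ω μ e T σ γ p) :
    RepresentsSet ω μ e T {y | γ y = y} {x | act p x = x} := by
  have h1 := hp 1
  simp only [one_smul] at h1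
  refine h1.congr_right ?_
  filter_upwards [h.act_one] with x hx
  simp [hx]

end ActionModel

/-! ### Diagonal matrices, permutation matrices and their traces -/

section Matrices
variable {ω : Ultrafilter ℕ} {d : ℕ → ℕ}

section
open scoped Matrix.Norms.L2Operator

theorem opNorm_diagonal_le {k : ℕ} {v : Fin k → ℂ} {M : ℝ} (hM : 0 ≤ M) (hv : ∀ j, ‖v j‖ ≤ M) :
    opNorm (Matrix.diagonal v) ≤ M := by
  unfold opNorm
  rw [Matrix.l2_opNorm_diagonal]
  exact (pi_norm_le_iff_of_nonneg hM).2 hv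

end

/-- A bounded sequence of functions on the finite models, as a sequence of diagonal matrices. -/
def diagBdd (a : Pts d → ℂ) (ha : ∃ M, ∀ x, ‖a x‖ ≤ M) : BddSeq d :=
  ⟨fun n => Matrix.diagonal fun j => a ⟨n, j⟩, by
    obtain ⟨M, hM⟩ := ha
    exact ⟨|M|, fun n => opNorm_diagonal_le (abs_nonneg M) fun j => (hM _).trans (le_abs_self M)⟩⟩

theorem norm2_diagonal (a : Pts d → ℂ) (n : ℕ) :
    norm2 (Matrix.diagonal fun j : Fin (d n) => a ⟨n, j⟩) =
      Real.sqrt (mean (fun x => ‖a x‖ ^ 2) n) := by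
  rw [norm2_eq_sum]
  unfold mean
  rw [smul_eq_mul]
  congr 2
  refine Finset.sum_congr rfl fun j _ => ?_
  rw [Finset.sum_eq_single j]
  · simp
  · intro i _ hij
    simp [Matrix.diagonal_apply_ne _ hij]
  · simp

theorem matClass_diagBdd_eq [∀ n, NeZero (d n)] {a b : Pts d → ℂ} (ha : ∃ M, ∀ x, ‖a x‖ ≤ M)
    (hb : ∃ M, ∀ x, ‖b x‖ ≤ M)
    (hab : Tendsto (fun x => a x - b x) (loebFilter ω d) (𝓝 0)) :
    matClass ω d (diagBdd a ha) = matClass ω d (diagBdd b hb) := by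
  refine Ideal.Quotient.eq.2 ?_
  change Tendsto (fun n => norm2 ((Matrix.diagonal fun j => a ⟨n, j⟩) -
    Matrix.diagonal fun j => b ⟨n, j⟩)) ω (𝓝 0)
  have h1 : ∀ n, norm2 ((Matrix.diagonal fun j => a ⟨n, j⟩) -
      Matrix.diagonal fun j => b ⟨n, j⟩) = Real.sqrt (mean (fun x => ‖a x - b x‖ ^ 2) n) := by
    intro n
    rw [Matrix.diagonal_sub]
    exact norm2_diagonal (fun x => a x - b x) n
  simp only [h1]
  obtain ⟨M, hM⟩ := ha
  obtain ⟨M', hM'⟩ := hb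
  have h2 : Tendsto (mean fun x => ‖(a x - b x) ^ 2‖) ω (𝓝 0) := by
    rw [mean_norm_tendsto_zero_iff]
    · simpa using hab.pow 2
    · refine ⟨(M + M') ^ 2, fun x => ?_⟩
      rw [norm_pow]
      have := (norm_sub_le (a x) (b x)).trans (add_le_add (hM x) (hM' x))
      gcongr
  simp only [norm_pow] at h2
  have h3 := (Real.continuous_sqrt.tendsto _).comp h2
  rwa [Real.sqrt_zero] at h3

theorem matClass_diagBdd_mem (a : Pts d → ℂ) (ha : ∃ M, ∀ x, ‖a x‖ ≤ M) :
    matClass ω d (diagBdd a ha) ∈ LoebLInfty ω d :=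
  ⟨diagBdd a ha, fun _ => Matrix.isDiag_diagonal _, rfl⟩

theorem traceUltra_matClass {x : BddSeq d} {c : ℂ}
    (h : Tendsto (fun n => tr (x.1 n)) ω (𝓝 c)) : traceUltra ω d (matClass ω d x) = c :=
  h.limUnder_eq

theorem tr_diagonal_mul_permMat {k : ℕ} (v : Fin k → ℂ) (p : Equiv.Perm (Fin k)) :
    tr (Matrix.diagonal v * permMat p) = (k : ℂ)⁻¹ * ∑ j, if p j = j then v j else 0 := by
  unfold tr Matrix.trace
  congr 1
  refine Finset.sum_congr rfl fun j _ => ?_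
  rw [Matrix.diag_apply, Matrix.diagonal_mul]
  simp [permMat, eq_comm]

theorem permMat_conj_diagonal {k : ℕ} (v : Fin k → ℂ) (p : Equiv.Perm (Fin k)) :
    permMat p * Matrix.diagonal v * permMat p⁻¹ = Matrix.diagonal fun j => v (p⁻¹ j) := by
  ext i j
  rw [Matrix.mul_apply, Finset.sum_eq_single (p⁻¹ j)]
  · rw [Matrix.mul_diagonal, Matrix.diagonal_apply]
    by_cases h : i = j <;> simp [permMat, h]
  · intro b _ hb
    have h0 : permMat p⁻¹ b j = 0 := if_neg hb
    rw [h0, mul_zero]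
  · simp

theorem permEmb_mk (p : ∀ n, Equiv.Perm (Fin (d n))) :
    permEmb ω d (QuotientGroup.mk p) = matClass ω d (permSeq d p) := rfl

end Matrices

/-! ### The sofic approximation of the orbit equivalence relation -/

section Rho
variable {Y K : Type*} [MeasurableSpace Y] [TopologicalSpace K] [CompactSpace K] [T2Space K]
  [SecondCountableTopology K] [MeasurableSpace K] [BorelSpace K]
  {ω : Ultrafilter ℕ} {d : ℕ → ℕ} [∀ n, NeZero (d n)]
  {μ : Measure Y} [IsProbabilityMeasure μ] {e : Y → K} {T : Pts d → K}

/-- The value of the embedding `ρ` at `f`: the class of any representing sequence. -/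
def IsModel.rhoFun (h : IsModel ω μ e T) (hω : (ω : Filter ℕ) ≤ cofinite) (f : Lp ℂ ∞ μ) :
    LoebLInfty ω d :=
  ⟨matClass ω d (diagBdd _ (h.exists_represents hω (Lp.memLp f)).choose_spec.bdd),
    matClass_diagBdd_mem _ _⟩

theorem IsModel.rhoFun_eq (h : IsModel ω μ e T) (hω : (ω : Filter ℕ) ≤ cofinite) {f : Lp ℂ ∞ μ}
    {a : Pts d → ℂ} (hf : Represents ω μ e T f a) :
    h.rhoFun hω f = ⟨matClass ω d (diagBdd a hf.bdd), matClass_diagBdd_mem _ _⟩ := by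
  refine Subtype.ext (matClass_diagBdd_eq _ _ ?_)
  exact ((h.exists_represents hω (Lp.memLp f)).choose_spec.sub h hf).tendsto_zero h
    (Eventually.of_forall fun y => by simp)

/-- The embedding `ρ : L^∞(Y, μ) → L^∞(ℒ, u_ω)`. -/
def IsModel.rho (h : IsModel ω μ e T) (hω : (ω : Filter ℕ) ≤ cofinite) :
    Lp ℂ ∞ μ →ₗ[ℂ] LoebLInfty ω d where
  toFun := h.rhoFun hω
  map_add' f g := by
    obtain ⟨a, ha⟩ := h.exists_represents hω (Lp.memLp f)
    obtain ⟨b, hb⟩ := h.exists_represents hω (Lp.memLp g)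
    rw [h.rhoFun_eq hω ha, h.rhoFun_eq hω hb,
      h.rhoFun_eq hω ((ha.add h hb).congr_left (Lp.coeFn_add f g).symm)]
    refine Subtype.ext ((congrArg (matClass ω d) (Subtype.ext (funext fun n => ?_))).trans
      (map_add (matClass ω d) _ _))
    exact (Matrix.diagonal_add _ _).symm
  map_smul' c f := by
    obtain ⟨a, ha⟩ := h.exists_represents hω (Lp.memLp f)
    rw [h.rhoFun_eq hω ha,
      h.rhoFun_eq hω ((ha.const_mul h c).congr_left (Lp.coeFn_smul c f).symm)]
    refine Subtype.ext ((congrArg (matClass ω d) (Subtype.ext (funext fun n => ?_))).trans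
      (map_smul (matClass ω d) c _))
    exact Matrix.diagonal_smul c (fun j => a ⟨n, j⟩)

theorem IsModel.rho_eq (h : IsModel ω μ e T) (hω : (ω : Filter ℕ) ≤ cofinite) {f : Lp ℂ ∞ μ}
    {a : Pts d → ℂ} (hf : Represents ω μ e T f a) :
    (h.rho hω f : MatUltra ω d) = matClass ω d (diagBdd a hf.bdd) :=
  congrArg Subtype.val (h.rhoFun_eq hω hf)

theorem IsModel.rho_mul (h : IsModel ω μ e T) (hω : (ω : Filter ℕ) ≤ cofinite)
    (f g : Lp ℂ ∞ μ) : h.rho hω (f • g : Lp ℂ ∞ μ) = h.rho hω f * h.rho hω g := by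
  obtain ⟨a, ha⟩ := h.exists_represents hω (Lp.memLp f)
  obtain ⟨b, hb⟩ := h.exists_represents hω (Lp.memLp g)
  refine Subtype.ext ?_
  rw [h.rho_eq hω ((ha.mul h hb).congr_left (Lp.coeFn_lpSMul f g).symm), MulMemClass.coe_mul,
    h.rho_eq hω ha, h.rho_eq hω hb]
  refine (congrArg (matClass ω d) (Subtype.ext (funext fun n => ?_))).trans
    (map_mul (matClass ω d) _ _)
  exact (Matrix.diagonal_mul_diagonal _ _).symm

theorem IsModel.rho_star (h : IsModel ω μ e T) (hω : (ω : Filter ℕ) ≤ cofinite)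
    (f : Lp ℂ ∞ μ) : h.rho hω (star f) = star (h.rho hω f) := by
  obtain ⟨a, ha⟩ := h.exists_represents hω (Lp.memLp f)
  refine Subtype.ext ?_
  rw [h.rho_eq hω ((ha.star h).congr_left (Lp.coeFn_star f).symm)]
  refine Eq.trans ?_ (congrArg star (h.rho_eq hω ha)).symm
  refine (congrArg (matClass ω d) (Subtype.ext (funext fun n => ?_))).trans
    (map_star (matClass ω d) _)
  exact (Matrix.diagonal_conjTranspose fun j => a ⟨n, j⟩).symm

/-- The inclusion `L^∞(Y, μ) ⊆ L²(Y, μ)`. -/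
def lInftyToL2 (μ : Measure Y) [IsProbabilityMeasure μ] : Lp ℂ ∞ μ →ₗ[ℂ] Lp ℂ 2 μ where
  toFun f := ((Lp.memLp f).mono_exponent le_top).toLp f
  map_add' f g := by
    rw [← MemLp.toLp_add]
    exact MemLp.toLp_congr _ _ (Lp.coeFn_add f g)
  map_smul' c f := by
    rw [RingHom.id_apply, ← MemLp.toLp_const_smul]
    exact MemLp.toLp_congr _ _ (Lp.coeFn_smul c f)

theorem coeFn_lInftyToL2 (f : Lp ℂ ∞ μ) : lInftyToL2 μ f =ᵐ[μ] f :=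
  MemLp.coeFn_toLp ((Lp.memLp f).mono_exponent le_top)

theorem denseRange_lInftyToL2 : DenseRange (lInftyToL2 μ) := by
  refine (Lp.simpleFunc.denseRange (E := ℂ) (μ := μ) (p := 2) (by simp)).mono ?_
  rintro _ ⟨s, rfl⟩
  refine ⟨((Lp.simpleFunc.toSimpleFunc s).memLp_top μ).toLp _, Lp.ext ?_⟩
  refine (coeFn_lInftyToL2 _).trans ((MemLp.coeFn_toLp _).trans ?_)
  exact Lp.simpleFunc.toSimpleFunc_eq_toFun s

theorem norm_lInftyToL2 (f : Lp ℂ ∞ μ) :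
    ‖lInftyToL2 μ f‖ = Real.sqrt (∫ y, ‖f y‖ ^ 2 ∂μ) := by
  rw [← Real.sqrt_sq (norm_nonneg (lInftyToL2 μ f))]
  congr 1
  have h1 := congrArg Complex.re (inner_self_eq_norm_sq_to_K (𝕜 := ℂ) (lInftyToL2 μ f))
  rw [L2.inner_def, integral_congr_ae (g := fun y => ((‖f y‖ ^ 2 : ℝ) : ℂ)),
    integral_complex_ofReal] at h1
  · simpa [← Complex.ofReal_pow] using h1.symm
  · filter_upwards [coeFn_lInftyToL2 f] with y hy
    rw [hy, inner_self_eq_norm_sq_to_K]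
    simp

/-- Matrix coefficients of `ρ` are bounded for the `L²`-norm. -/
theorem IsModel.exists_norm_traceUltra_le (h : IsModel ω μ e T) (hω : (ω : Filter ℕ) ≤ cofinite)
    (x y : MatUltra ω d) : ∃ C, ∀ f : Lp ℂ ∞ μ,
      ‖traceUltra ω d (star y * (h.rho hω f : MatUltra ω d) * x)‖ ≤ C * ‖lInftyToL2 μ f‖ := by
  obtain ⟨x, rfl⟩ := Ideal.Quotient.mk_surjective x
  obtain ⟨y, rfl⟩ := Ideal.Quotient.mk_surjective y
  obtain ⟨C, hC⟩ := x.2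
  obtain ⟨D, hD⟩ := y.2
  refine ⟨D * C, fun f => ?_⟩
  obtain ⟨a, ha⟩ := h.exists_represents hω (Lp.memLp f)
  rw [h.rho_eq hω ha, norm_lInftyToL2]
  obtain ⟨c, hc⟩ := exists_lim_tr ω (star y * diagBdd a ha.bdd * x)
  have e1 : traceUltra ω d (star (Ideal.Quotient.mk (nullIdeal ω d) y) *
      matClass ω d (diagBdd a ha.bdd) * Ideal.Quotient.mk (nullIdeal ω d) x) = c :=
    traceUltra_matClass hc
  rw [e1]
  have h2 : Tendsto (mean fun x => ‖a x‖ ^ 2) ω (𝓝 (∫ y, ‖f y‖ ^ 2 ∂μ)) := by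
    have h3 := ((ha.norm h).mul h (ha.norm h)).tendsto_mean h
    have h4 := (Complex.continuous_re.tendsto _).comp h3
    have e2 : ∫ y, ((‖f y‖ : ℂ) * (‖f y‖ : ℂ)) ∂μ = ((∫ y, ‖f y‖ ^ 2 ∂μ : ℝ) : ℂ) := by
      rw [← integral_complex_ofReal]
      congr 1
      funext y
      simp [pow_two]
    rw [e2, Complex.ofReal_re] at h4
    refine h4.congr fun n => ?_
    simp only [mean, Function.comp_apply]
    rw [Complex.smul_re, Complex.re_sum]
    simp [pow_two]
  have h3 := ((Real.continuous_sqrt.tendsto _).comp h2).const_mul (D * C)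
  refine le_of_tendsto_of_tendsto hc.norm h3 (Eventually.of_forall fun n => ?_)
  have hC0 := (opNorm_nonneg _).trans (hC n)
  have hD0 := (opNorm_nonneg _).trans (hD n)
  calc _ ≤ norm2 (star (y.1 n) * Matrix.diagonal (fun j => a ⟨n, j⟩) * x.1 n) := norm_tr_le _
    _ ≤ norm2 (star (y.1 n) * Matrix.diagonal (fun j => a ⟨n, j⟩)) * opNorm (x.1 n) :=
      norm2_mul_le' _ _
    _ ≤ opNorm (star (y.1 n)) * norm2 (Matrix.diagonal (fun j => a ⟨n, j⟩)) * opNorm (x.1 n) :=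
      mul_le_mul_of_nonneg_right (norm2_mul_le _ _) (opNorm_nonneg _)
    _ ≤ D * norm2 (Matrix.diagonal (fun j => a ⟨n, j⟩)) * C := by
      rw [opNorm_star]
      have := norm2_nonneg (Matrix.diagonal (fun j => a ⟨n, j⟩))
      exact mul_le_mul (mul_le_mul_of_nonneg_right (hD n) this) (hC n) (opNorm_nonneg _)
        (mul_nonneg hD0 this)
    _ = _ := by
      rw [norm2_diagonal]
      simp only [Function.comp_apply]
      ring

/-- `ρ` is normal: its matrix coefficients extend to `L²(Y, μ)`, where they are inner products. -/
theorem IsModel.isNormalMap_rho (h : IsModel ω μ e T) (hω : (ω : Filter ℕ) ≤ cofinite) :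
    IsNormalMap (h.rho hω) := by
  intro x y
  obtain ⟨C, hC⟩ := h.exists_norm_traceUltra_le hω x y
  let Λ : Lp ℂ ∞ μ →ₗ[ℂ] ℂ :=
    { toFun f := traceUltra ω d (star y * (h.rho hω f : MatUltra ω d) * x)
      map_add' f g := by
        rw [map_add, AddMemClass.coe_add, mul_add, add_mul, map_add]
      map_smul' c f := by
        rw [map_smul]
        change traceUltra ω d (star y * (c • (h.rho hω f : MatUltra ω d)) * x) = _
        rw [mul_smul_comm, smul_mul_assoc, map_smul]
        rfl }
  set η := (InnerProductSpace.toDual ℂ (Lp ℂ 2 μ)).symm (Λ.extendOfNorm (lInftyToL2 μ))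
  have key : ∀ f : Lp ℂ ∞ μ, traceUltra ω d (star y * (h.rho hω f : MatUltra ω d) * x) =
      ∫ t, f t * (Lp.const 2 μ (1 : ℂ)) t * star (η t) ∂μ := by
    intro f
    have h1 : Λ f = inner ℂ η (lInftyToL2 μ f) := by
      rw [InnerProductSpace.toDual_symm_apply,
        LinearMap.extendOfNorm_eq denseRange_lInftyToL2 ⟨C, hC⟩]
    refine h1.trans ?_
    rw [L2.inner_def]
    refine integral_congr_ae ?_
    filter_upwards [coeFn_lInftyToL2 f, Lp.coeFn_const (p := 2) (μ := μ) (1 : ℂ)] with t h2 h3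
    rw [h2, h3]
    simp
  -- `∫ f η̄` is one of the functionals that induce the weak operator topology, with vectors `1`, `η`
  refine @Continuous.continuousOn _ _ (wotLInfty μ) _ _ _ ?_
  simp only [key]
  exact continuous_iInf_dom (i := Lp.const 2 μ (1 : ℂ))
    (continuous_iInf_dom (i := η) continuous_induced_dom)

end Rho

section Sofic
variable {G Y K : Type*} [Group G] [Countable G] [MulAction G Y] [MeasurableSpace Y]
  [MeasurableConstSMul G Y] [TopologicalSpace K] [CompactSpace K] [T2Space K]
  [SecondCountableTopology K] [MeasurableSpace K] [BorelSpace K]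
  {ω : Ultrafilter ℕ} {d : ℕ → ℕ} [∀ n, NeZero (d n)]
  {μ : Measure Y} [IsProbabilityMeasure μ] {e : Y → K} {T : Pts d → K}
  {σ : ∀ n, G → Equiv.Perm (Fin (d n))}

theorem fullAut_exists_smul (γ : fullAut μ (MulAction.orbitRel G Y)) :
    ∀ᵐ y ∂μ, ∃ g : G, γ.1 y = g • y := by
  filter_upwards [γ.2.2] with y hy
  obtain ⟨g, hg⟩ := hy
  exact ⟨g⁻¹, by rw [eq_inv_smul_iff]; exact hg⟩

theorem IsActionModel.exists_representsPerm_fullAut (h : IsActionModel ω μ e T σ)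
    (hω : (ω : Filter ℕ) ≤ cofinite) (γ : fullAut μ (MulAction.orbitRel G Y)) :
    ∃ p, RepresentsPerm ω μ e T σ γ.1 p :=
  exists_representsPerm h hω γ.1.measurable γ.1.injective (fullAut_exists_smul γ)

theorem IsActionModel.mk_eq_mk (h : IsActionModel ω μ e T σ) (hω : (ω : Filter ℕ) ≤ cofinite)
    {γ δ : fullAut μ (MulAction.orbitRel G Y)} (hγδ : ∀ᵐ y ∂μ, γ.1 y = δ.1 y)
    {p q : ∀ n, Equiv.Perm (Fin (d n))} (hp : RepresentsPerm ω μ e T σ γ.1 p)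
    (hq : RepresentsPerm ω μ e T σ δ.1 q) :
    (QuotientGroup.mk p : PermUltra ω d) = QuotientGroup.mk q :=
  (mk_eq_mk_iff p q).2 (hp.unique h hω (fullAut_exists_smul γ) hγδ hq)

/-- The class of the permutations that represent a full group element, as a homomorphism. -/
def IsActionModel.permHomAut (h : IsActionModel ω μ e T σ) (hω : (ω : Filter ℕ) ≤ cofinite) :
    fullAut μ (MulAction.orbitRel G Y) →* PermUltra ω d :=
  MonoidHom.mk' (fun γ => QuotientGroup.mk (h.exists_representsPerm_fullAut hω γ).choose)
    fun γ δ => by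
      rw [← QuotientGroup.mk_mul]
      refine h.mk_eq_mk hω (Eventually.of_forall fun y => rfl)
        (h.exists_representsPerm_fullAut hω (γ * δ)).choose_spec ?_
      exact (h.exists_representsPerm_fullAut hω γ).choose_spec.mul h hω γ.1.measurable δ.2.1
        (fullAut_exists_smul γ) (fullAut_exists_smul δ)
        (h.exists_representsPerm_fullAut hω δ).choose_spec

theorem IsActionModel.permHomAut_eq (h : IsActionModel ω μ e T σ)
    (hω : (ω : Filter ℕ) ≤ cofinite) {γ δ : fullAut μ (MulAction.orbitRel G Y)}
    (hγδ : ∀ᵐ y ∂μ, γ.1 y = δ.1 y) {p : ∀ n, Equiv.Perm (Fin (d n))}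
    (hp : RepresentsPerm ω μ e T σ δ.1 p) : h.permHomAut hω γ = QuotientGroup.mk p :=
  h.mk_eq_mk hω hγδ (h.exists_representsPerm_fullAut hω γ).choose_spec hp

/-- The homomorphism `[ℛ] → 𝒮_ω`. -/
def IsActionModel.permHom (h : IsActionModel ω μ e T σ) (hω : (ω : Filter ℕ) ≤ cofinite) :
    FullGroup μ (MulAction.orbitRel G Y) →* PermUltra ω d :=
  QuotientGroup.lift (aeTrivial μ (MulAction.orbitRel G Y)) (h.permHomAut hω) fun γ hγ => by
    rw [MonoidHom.mem_ker, ← map_one (h.permHomAut hω)]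
    exact h.permHomAut_eq (δ := 1) hω hγ (h.exists_representsPerm_fullAut hω 1).choose_spec

theorem IsActionModel.permHom_eq (h : IsActionModel ω μ e T σ) (hω : (ω : Filter ℕ) ≤ cofinite)
    {γ : fullAut μ (MulAction.orbitRel G Y)} {p : ∀ n, Equiv.Perm (Fin (d n))}
    (hp : RepresentsPerm ω μ e T σ γ.1 p) :
    h.permHom hω (QuotientGroup.mk γ) = QuotientGroup.mk p :=
  h.permHomAut_eq hω (Eventually.of_forall fun _ => rfl) hp

theorem IsActionModel.isSoficApproximation (h : IsActionModel ω μ e T σ)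
    (hω : (ω : Filter ℕ) ≤ cofinite) :
    IsSoficApproximation μ (MulAction.orbitRel G Y) ω d (h.rho hω) (h.permHom hω) where
  map_mul := h.rho_mul hω
  map_star := h.rho_star hω
  normal := h.isNormalMap_rho hω
  trace_eq f γ := by
    obtain ⟨a, ha⟩ := h.exists_represents hω (Lp.memLp f)
    obtain ⟨p, hp⟩ := h.exists_representsPerm_fullAut hω γ
    rw [h.rho_eq hω ha, h.permHom_eq hω hp, permEmb_mk, ← map_mul]
    refine traceUltra_matClass ?_
    have hfix := hp.representsSet_fixed h
    have h1 := (ha.indicator h.toIsModel hfix).tendsto_mean h.toIsModel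
    rw [integral_indicator hfix.measurableSet] at h1
    refine h1.congr fun n => ?_
    change _ = tr ((Matrix.diagonal fun j => a ⟨n, j⟩) * permMat (p n))
    rw [tr_diagonal_mul_permMat, mean]
    simp [Set.indicator_apply, act]
  covariant f γ := by
    obtain ⟨a, ha⟩ := h.exists_represents hω (Lp.memLp f)
    obtain ⟨p, hp⟩ := h.exists_representsPerm_fullAut hω γ
    obtain ⟨q, hq⟩ := h.exists_representsPerm_fullAut hω γ⁻¹
    have hqp : (QuotientGroup.mk q : PermUltra ω d) = QuotientGroup.mk p⁻¹ := by
      rw [← h.permHom_eq hω hq, QuotientGroup.mk_inv, QuotientGroup.mk_inv, map_inv,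
        h.permHom_eq hω hp]
    have h1 := (ha.comp_representsPerm h hω (γ⁻¹).2.1 (fullAut_exists_smul γ⁻¹) hq).congr_left
      (Lp.coeFn_compMeasurePreserving f (γ⁻¹).2.1).symm
    have h2 := h1.congr_right (a' := fun x => a (act p⁻¹ x))
      (by obtain ⟨M, hM⟩ := ha.bdd; exact ⟨M, fun x => hM _⟩) (by
        filter_upwards [(mk_eq_mk_iff q p⁻¹).1 hqp] with x hx
        rw [hx])
    rw [h.rho_eq hω ha, h.rho_eq hω h2, h.permHom_eq hω hp, ← QuotientGroup.mk_inv, permEmb_mk,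
      permEmb_mk, ← map_mul, ← map_mul]
    refine congrArg (matClass ω d) (Subtype.ext (funext fun n => ?_))
    exact permMat_conj_diagonal (fun j => a ⟨n, j⟩) (p n)

end Sofic

/-! ### Relabelling and product measures -/

/-- A fixed enumeration of a countable set. -/
def enum (α : Type*) [Countable α] : α → ℕ := (exists_injective_nat α).choose

theorem enum_injective (α : Type*) [Countable α] : Function.Injective (enum α) :=
  (exists_injective_nat α).choose_spec

theorem finite_enum_lt (α : Type*) [Countable α] (N : ℕ) : {a : α | enum α a < N}.Finite :=
  (Set.finite_Iio N).preimage (enum_injective α).injOn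

/-- The least element of a set in the fixed enumeration only depends on the part of the set up to a
given element. -/
theorem argminOn_enum_congr {α : Type*} [Countable α] {S S' : Set α} {a : α} (ha : a ∈ S)
    (ha' : a ∈ S') (h : ∀ k, enum α k ≤ enum α a → (k ∈ S ↔ k ∈ S')) :
    Function.argminOn (enum α) S ⟨a, ha⟩ = Function.argminOn (enum α) S' ⟨a, ha'⟩ := by
  have h1 := Function.argminOn_le (enum α) S ha
  have h2 := Function.argminOn_le (enum α) S' ha'
  have h3 := (h _ h1).1 (Function.argminOn_mem (enum α) S ⟨a, ha⟩)
  have h4 := (h _ h2).2 (Function.argminOn_mem (enum α) S' ⟨a, ha'⟩)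
  exact enum_injective α (le_antisymm (Function.argminOn_le (enum α) S h4)
    (Function.argminOn_le (enum α) S' h3))

/-- The least element of the fibre of `ι` through `a`. -/
def fiberRep {α β : Type*} [Countable α] (ι : α → β) (a : α) : α :=
  Function.argminOn (enum α) {k | ι k = ι a} ⟨a, rfl⟩

theorem map_fiberRep {α β : Type*} [Countable α] (ι : α → β) (a : α) : ι (fiberRep ι a) = ι a :=
  Function.argminOn_mem (enum α) {k | ι k = ι a} ⟨a, rfl⟩

theorem fiberRep_congr {α β : Type*} [Countable α] (ι : α → β) {a a' : α} (h : ι a = ι a') :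
    fiberRep ι a = fiberRep ι a' := by
  unfold fiberRep
  congr 1
  rw [h]

/-- The law of independent uniform labels on `α`. -/
abbrev labelLaw (α : Type*) : Measure (α → unitInterval) := Measure.infinitePi fun _ => volume

theorem labelLaw_map_injective {α β : Type*} {ι : α → β} (hι : Function.Injective ι) :
    (labelLaw β).map (fun c a => c (ι a)) = labelLaw α := by
  have h1 := (ProbabilityTheory.iIndepFun_infinitePi (P := fun _ : β => (volume : Measure unitInterval))
    (X := fun _ x => x) (fun _ => measurable_id)).precomp hι
  rw [ProbabilityTheory.iIndepFun_iff_map_fun_eq_infinitePi_map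
    (fun a => measurable_pi_apply (ι a))] at h1
  refine h1.trans ?_
  congr 1
  funext a
  exact Measure.infinitePi_map_eval (fun _ : β => (volume : Measure unitInterval)) (ι a)

/-- Pulling back independent labels along `ι` gives labels that are constant on the fibres of `ι`
and otherwise independent. -/
theorem labelLaw_map_fiberRep {α β : Type*} [Countable α] (ι : α → β) :
    (labelLaw β).map (fun c a => c (ι a)) = (labelLaw α).map (fun u a => u (fiberRep ι a)) := by
  -- both laws come from independent labels on the set of representatives
  let R : Type _ := Set.range (fiberRep ι)
  let F : (R → unitInterval) → α → unitInterval := fun v a => v ⟨fiberRep ι a, a, rfl⟩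
  have hF : Measurable F := measurable_pi_iff.2 fun a => measurable_pi_apply _
  have h1 : Function.Injective fun r : R => ι r.1 := by
    rintro ⟨_, a, rfl⟩ ⟨_, a', rfl⟩ h
    have h' : ι (fiberRep ι a) = ι (fiberRep ι a') := h
    rw [map_fiberRep ι a, map_fiberRep ι a'] at h'
    exact Subtype.ext (fiberRep_congr ι h')
  have h2 : Function.Injective fun r : R => r.1 := Subtype.val_injective
  have e1 : (fun (c : β → unitInterval) a => c (ι a)) = F ∘ fun c (r : R) => c (ι r.1) := by
    funext c a
    simp only [Function.comp_apply, F, map_fiberRep]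
  have e2 : (fun (u : α → unitInterval) a => u (fiberRep ι a)) = F ∘ fun u (r : R) => u r.1 := rfl
  have m1 : Measurable fun (c : β → unitInterval) (r : R) => c (ι r.1) :=
    measurable_pi_iff.2 fun _ => measurable_pi_apply _
  have m2 : Measurable fun (u : α → unitInterval) (r : R) => u r.1 :=
    measurable_pi_iff.2 fun _ => measurable_pi_apply _
  rw [e1, e2, ← Measure.map_map hF m1, ← Measure.map_map hF m2,
    labelLaw_map_injective h1, labelLaw_map_injective h2]

/-- Independent uniform labels are almost surely distinct, as Lebesgue measure has no atoms. -/
theorem labelLaw_ae_injective (α : Type*) [Countable α] :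
    ∀ᵐ u ∂labelLaw α, Function.Injective u := by
  have h : ∀ a b : α, a ≠ b → ∀ᵐ u ∂labelLaw α, u a ≠ u b := by
    intro a b hab
    have h1 : ProbabilityTheory.IndepFun (fun u : α → unitInterval => u a) (fun u => u b)
        (labelLaw α) :=
      (ProbabilityTheory.iIndepFun_infinitePi (P := fun _ : α => (volume : Measure unitInterval))
        (X := fun _ x => x) (fun _ => measurable_id)).indepFun hab
    rw [ProbabilityTheory.indepFun_iff_map_prod_eq_prod_map_map
      (measurable_pi_apply a).aemeasurable (measurable_pi_apply b).aemeasurable,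
      Measure.infinitePi_map_eval (fun _ : α => (volume : Measure unitInterval)) a,
      Measure.infinitePi_map_eval (fun _ : α => (volume : Measure unitInterval)) b] at h1
    have h2 : ∀ᵐ z ∂((volume : Measure unitInterval).prod volume), z.1 ≠ z.2 := by
      have hms : MeasurableSet {z : unitInterval × unitInterval | z.1 ≠ z.2} :=
        (measurableSet_eq_fun measurable_fst measurable_snd).compl
      rw [Measure.ae_prod_iff_ae_ae hms]
      refine Eventually.of_forall fun x => ?_
      filter_upwards [compl_mem_ae_iff.2 (measure_singleton x)] with y hy
      exact fun hxy => hy hxy.symm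
    rw [← h1] at h2
    exact ae_of_ae_map ((measurable_pi_apply a).prodMk (measurable_pi_apply b)).aemeasurable h2
  have h' : ∀ᵐ u ∂labelLaw α, ∀ a b : α, a ≠ b → u a ≠ u b := by
    rw [ae_all_iff]; intro a
    rw [ae_all_iff]; intro b
    by_cases hab : a = b
    · exact Eventually.of_forall fun u hn => absurd hab hn
    · filter_upwards [h a b hab] with u hu _
      exact hu
  filter_upwards [h'] with u hu a b hab
  by_contra hne
  exact hu a b hne hab

/-! ### The space of labelled subsets of the group -/

/-- The compact space `{0,1}^G × [0,1]^G`. -/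
abbrev LabelSpace (G : Type*) : Type _ := (G → Bool) × (G → unitInterval)

/-- Maps that eventually agree in each coordinate are asymptotically close. -/
theorem tendsto_uniformity_labelSpace {G α : Type*} {l : Filter α} {f g : α → LabelSpace G}
    (h1 : ∀ a, ∀ᶠ x in l, (f x).1 a = (g x).1 a) (h2 : ∀ a, ∀ᶠ x in l, (f x).2 a = (g x).2 a) :
    Tendsto (fun x => (f x, g x)) l (uniformity (LabelSpace G)) := by
  have key : ∀ {β : Type} [UniformSpace β] {u v : α → β}, (∀ᶠ x in l, u x = v x) →
      Tendsto (fun x => (u x, v x)) l (uniformity β) := by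
    intro β _ u v h s hs
    rw [mem_map]
    filter_upwards [h] with x hx
    change (u x, v x) ∈ s
    rw [hx]
    exact refl_mem_uniformity hs
  rw [uniformity_prod, tendsto_inf, tendsto_comap_iff, tendsto_comap_iff, Pi.uniformity,
    Pi.uniformity, tendsto_iInf, tendsto_iInf]
  exact ⟨fun a => tendsto_comap_iff.2 (key (h1 a)), fun a => tendsto_comap_iff.2 (key (h2 a))⟩

theorem eventually_abs_sub_lt {G α : Type*} {l : Filter α} {f g : α → LabelSpace G}
    (h1 : ∀ a, ∀ᶠ x in l, (f x).1 a = (g x).1 a) (h2 : ∀ a, ∀ᶠ x in l, (f x).2 a = (g x).2 a)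
    {E : Type*} [NormedAddCommGroup E] (φ : C(LabelSpace G, E)) {ε : ℝ} (hε : 0 < ε) :
    ∀ᶠ x in l, ‖φ (f x) - φ (g x)‖ < ε := by
  have hφ := CompactSpace.uniformContinuous_of_continuous φ.continuous
  have h3 := (tendsto_uniformity_labelSpace h1 h2).eventually
    (hφ (Metric.dist_mem_uniformity hε))
  filter_upwards [h3] with x hx
  rw [← dist_eq_norm]
  exact hx

section Trunc
variable {G : Type*} [Countable G]

/-- Replaces the labels outside the `N`-th initial segment of `G` by `0`. -/
def truncLabel (N : ℕ) (p : LabelSpace G) : LabelSpace G :=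
  (p.1, fun g => if enum G g < N then p.2 g else 0)

theorem continuous_truncLabel (N : ℕ) : Continuous (truncLabel (G := G) N) := by
  refine continuous_fst.prodMk (continuous_pi fun g => ?_)
  by_cases h : enum G g < N
  · simp only [h, if_true]; fun_prop
  · simp only [h, if_false]; fun_prop

/-- A continuous function depends on finitely many labels up to a uniformly small error. -/
theorem exists_truncLabel_near (φ : C(LabelSpace G, ℝ)) {ε : ℝ} (hε : 0 < ε) :
    ∃ N, ∀ p, |φ (truncLabel N p) - φ p| < ε := by
  have h := eventually_abs_sub_lt (l := (atTop : Filter ℕ) ×ˢ (⊤ : Filter (LabelSpace G)))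
    (f := fun q => truncLabel q.1 q.2) (g := fun q => q.2)
    (fun a => Eventually.of_forall fun q => rfl)
    (fun a => by
      filter_upwards [(eventually_gt_atTop (enum G a)).prod_inl (⊤ : Filter (LabelSpace G))]
        with q hq
      simp [truncLabel, hq]) φ hε
  rw [← principal_univ, eventually_prod_principal_iff] at h
  obtain ⟨N, hN⟩ := h.exists
  exact ⟨N, fun p => hN p (Set.mem_univ p)⟩

end Trunc

section Relabel
variable {G : Type*} [Group G] [Countable G]

/-- The least element `k` of `G` with `k g⁻¹ ∈ b` or `k = g`; if `b` is a subgroup, this is a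
representative of the coset `b g`. -/
def cosetRep (b : G → Bool) (g : G) : G :=
  Function.argminOn (enum G) {k | b (k * g⁻¹) = true ∨ k = g} ⟨g, Or.inr rfl⟩

/-- `(b, u) ↦ (b, u ∘ cosetRep b)`, which makes independent labels constant on cosets. -/
def relabel (p : LabelSpace G) : LabelSpace G := (p.1, fun g => p.2 (cosetRep p.1 g))

/-- `cosetRep b g` only depends on finitely many coordinates of `b`. -/
theorem eventually_cosetRep_eq (b : G → Bool) (g : G) : ∀ᶠ b' in 𝓝 b, cosetRep b' g = cosetRep b g := by
  have h1 : ∀ᶠ b' in 𝓝 b, ∀ k ∈ {k | enum G k < enum G g + 1}, b' (k * g⁻¹) = b (k * g⁻¹) := by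
    rw [eventually_all_finite (finite_enum_lt G _)]
    intro k _
    have h2 : Tendsto (fun b' : G → Bool => b' (k * g⁻¹)) (𝓝 b) (𝓝 (b (k * g⁻¹))) :=
      (continuous_apply _).tendsto b
    rw [nhds_discrete Bool, tendsto_pure] at h2
    exact h2
  filter_upwards [h1] with b' hb'
  refine argminOn_enum_congr (a := g) (Or.inr rfl) (Or.inr rfl) fun k hk => ?_
  simp only [Set.mem_ofPred_eq]
  rw [hb' k (Nat.lt_succ_of_le hk)]

theorem continuous_relabel : Continuous (relabel (G := G)) := by
  refine continuous_fst.prodMk (continuous_pi fun g => continuous_iff_continuousAt.2 fun p => ?_)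
  have h1 : ContinuousAt (fun q : LabelSpace G => q.2 (cosetRep p.1 g)) p := by fun_prop
  refine h1.congr ?_
  filter_upwards [continuous_fst.continuousAt.eventually (eventually_cosetRep_eq p.1 g)] with q hq
  rw [hq]

/-- The law of `(b, x)`, where `b` has law `Θ` and `x` is made of labels that are independent up to
being constant on the cosets of `b`. -/
def cosetLabelLaw (Θ : Measure (G → Bool)) : Measure (LabelSpace G) :=
  (Θ.prod (labelLaw G)).map relabel

instance (Θ : Measure (G → Bool)) [IsProbabilityMeasure Θ] :
    IsProbabilityMeasure (cosetLabelLaw Θ) :=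
  Measure.isProbabilityMeasure_map continuous_relabel.measurable.aemeasurable

end Relabel

/-! ### Random labellings of the finite models -/

section RandomLabels
variable {G : Type*} [Group G] [Countable G]

/-- The stabilizer of the point `j`, with the labels that `j` sees along its orbit. -/
def labelPt {k : ℕ} (τ : G → Equiv.Perm (Fin k)) (c : Fin k → unitInterval) (j : Fin k) :
    LabelSpace G :=
  (stabIndicator τ j, fun g => c (τ g⁻¹ j))

theorem measurable_labelPt {k : ℕ} (τ : G → Equiv.Perm (Fin k)) (j : Fin k) :
    Measurable fun c => labelPt τ c j :=
  measurable_const.prodMk (measurable_pi_iff.2 fun _ => measurable_pi_apply _)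

/-- If `τ` looks like an action at `j`, seen through the `N`-th window, then random labels on the
model have the same law as random labels on the cosets of the stabilizer of `j`. -/
theorem integral_labelPt_eq {k : ℕ} {τ : G → Equiv.Perm (Fin k)} {j : Fin k} {N : ℕ}
    (h : ∀ g l, enum G g < N → enum G l < N → (τ l⁻¹ j = τ g⁻¹ j ↔ τ (l * g⁻¹) j = j))
    (φ : C(LabelSpace G, ℝ)) :
    ∫ c, φ (truncLabel N (labelPt τ c j)) ∂labelLaw (Fin k) =
      ∫ u, φ (truncLabel N (relabel (stabIndicator τ j, u))) ∂labelLaw G := by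
  set ι : G → Fin k := fun g => τ g⁻¹ j with hι
  let F : (G → unitInterval) → ℝ := fun x => φ (truncLabel N (stabIndicator τ j, x))
  have hF : Continuous F :=
    φ.continuous.comp ((continuous_truncLabel N).comp (by fun_prop))
  have hrep : ∀ g, enum G g < N → cosetRep (stabIndicator τ j) g = fiberRep ι g := by
    intro g hg
    refine argminOn_enum_congr (a := g)
      (S := {l | stabIndicator τ j (l * g⁻¹) = true ∨ l = g}) (S' := {l | ι l = ι g})
      (Or.inr rfl) rfl fun l hl => ?_
    have h1 := h g l hg (hl.trans_lt hg)
    simp only [Set.mem_ofPred_eq, stabIndicator, decide_eq_true_eq, hι, h1]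
    constructor
    · rintro (h2 | rfl)
      · exact h2
      · rw [← h1]
    · exact Or.inl
  have e1 : ∀ c, φ (truncLabel N (labelPt τ c j)) = F (fun g => c (ι g)) := fun c => rfl
  have e2 : ∀ u, φ (truncLabel N (relabel (stabIndicator τ j, u))) =
      F (fun g => u (fiberRep ι g)) := by
    intro u
    simp only [F]
    congr 1
    refine Prod.ext rfl (funext fun g => ?_)
    by_cases hg : enum G g < N
    · simp [truncLabel, relabel, hg, hrep g hg]
    · simp [truncLabel, hg]
  simp only [e1, e2]
  have m1 : Measurable fun (c : Fin k → unitInterval) g => c (ι g) :=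
    measurable_pi_iff.2 fun _ => measurable_pi_apply _
  have m2 : Measurable fun (u : G → unitInterval) g => u (fiberRep ι g) :=
    measurable_pi_iff.2 fun _ => measurable_pi_apply _
  rw [← integral_map m1.aemeasurable hF.measurable.aestronglyMeasurable,
    ← integral_map m2.aemeasurable hF.measurable.aestronglyMeasurable, labelLaw_map_fiberRep]

/-- The average of `φ` over the labelled points of the model. -/
def labelMean {k : ℕ} (τ : G → Equiv.Perm (Fin k)) (φ : LabelSpace G → ℝ)
    (c : Fin k → unitInterval) : ℝ := (k : ℝ)⁻¹ * ∑ j, φ (labelPt τ c j)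

theorem memLp_labelPt {k : ℕ} (τ : G → Equiv.Perm (Fin k)) (φ : C(LabelSpace G, ℝ)) (j : Fin k)
    (q : ℝ≥0∞) : MemLp (fun c => φ (labelPt τ c j)) q (labelLaw (Fin k)) :=
  MemLp.of_bound (φ.continuous.measurable.comp (measurable_labelPt τ j)).aestronglyMeasurable ‖φ‖
    (Eventually.of_forall fun _ => φ.norm_coe_le_norm _)

theorem memLp_labelMean {k : ℕ} (τ : G → Equiv.Perm (Fin k)) (φ : C(LabelSpace G, ℝ))
    (q : ℝ≥0∞) : MemLp (labelMean τ φ) q (labelLaw (Fin k)) :=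
  (memLp_finsetSum Finset.univ fun j _ => memLp_labelPt τ φ j q).const_mul _

/-- Labels seen from points with disjoint windows are independent. -/
theorem indepFun_labelPt {k : ℕ} (τ : G → Equiv.Perm (Fin k)) (φ : C(LabelSpace G, ℝ)) (N : ℕ)
    {i j : Fin k}
    (hij : ∀ g l, enum G g < N → enum G l < N → τ g⁻¹ i ≠ τ l⁻¹ j) :
    ProbabilityTheory.IndepFun (fun c => φ (truncLabel N (labelPt τ c i)))
      (fun c => φ (truncLabel N (labelPt τ c j))) (labelLaw (Fin k)) := by
  let F := (finite_enum_lt G N).toFinset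
  have hF : ∀ g, g ∈ F ↔ enum G g < N := fun g => Set.Finite.mem_toFinset _
  let W : Fin k → Finset (Fin k) := fun i => F.image fun g => τ g⁻¹ i
  have hdisj : Disjoint (W i) (W j) := by
    rw [Finset.disjoint_left]
    intro z hz hz'
    obtain ⟨g, hg, rfl⟩ := Finset.mem_image.1 hz
    obtain ⟨l, hl, hgl⟩ := Finset.mem_image.1 hz'
    exact hij g l ((hF g).1 hg) ((hF l).1 hl) hgl.symm
  have h1 := (ProbabilityTheory.iIndepFun_infinitePi
    (P := fun _ : Fin k => (volume : Measure unitInterval))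
    (X := fun _ x => x) (fun _ => measurable_id)).indepFun_finset (W i) (W j) hdisj
    (fun _ => measurable_pi_apply _)
  let H : ∀ i : Fin k, (W i → unitInterval) → ℝ := fun i v =>
    φ (stabIndicator τ i, fun g => if hg : enum G g < N then
      v ⟨τ g⁻¹ i, Finset.mem_image.2 ⟨g, (hF g).2 hg, rfl⟩⟩ else 0)
  have hH : ∀ i, Measurable (H i) := by
    intro i
    refine φ.continuous.measurable.comp (measurable_const.prodMk (measurable_pi_iff.2 fun g => ?_))
    by_cases hg : enum G g < N
    · simp only [hg, dif_pos]
      exact measurable_pi_apply _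
    · simp only [hg, dif_neg, not_false_eq_true]
      exact measurable_const
  have h2 := h1.comp (hH i) (hH j)
  have e : ∀ i, (fun c => φ (truncLabel N (labelPt τ c i))) =
      H i ∘ fun c (z : W i) => c z := by
    intro i
    funext c
    simp only [H, Function.comp_apply]
    congr 1
  rw [e i, e j]
  exact h2

/-- The variance is of order `1 / k`, because for each of the `k` points only boundedly many others
have a window that meets its own. -/
theorem variance_labelMean_le {k : ℕ} (τ : G → Equiv.Perm (Fin k)) (φ : C(LabelSpace G, ℝ))
    (N : ℕ) : ProbabilityTheory.variance (labelMean τ fun p => φ (truncLabel N p))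
      (labelLaw (Fin k)) ≤ ((finite_enum_lt G N).toFinset.card ^ 2 * (2 * ‖φ‖) ^ 2) * (k : ℝ)⁻¹ := by
  classical
  set F := (finite_enum_lt G N).toFinset with hFdef
  have hF : ∀ g, g ∈ F ↔ enum G g < N := fun g => Set.Finite.mem_toFinset _
  let φ' : C(LabelSpace G, ℝ) := ⟨fun p => φ (truncLabel N p),
    φ.continuous.comp (continuous_truncLabel N)⟩
  have hφ' : ∀ p, |φ' p| ≤ ‖φ‖ := fun p => φ.norm_coe_le_norm _
  let X : Fin k → (Fin k → unitInterval) → ℝ := fun j c => φ' (labelPt τ c j)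
  have hX : ∀ j, MemLp (X j) 2 (labelLaw (Fin k)) := fun j => memLp_labelPt τ φ' j 2
  have e1 : (labelMean τ fun p => φ (truncLabel N p)) = fun c => (k : ℝ)⁻¹ * (∑ j, X j) c := by
    funext c
    simp [labelMean, X, φ']
  have hE : ∀ j, |∫ c, X j c ∂labelLaw (Fin k)| ≤ ‖φ‖ := fun j => by
    have := norm_integral_le_of_norm_le_const (μ := labelLaw (Fin k)) (f := X j)
      (Eventually.of_forall fun c => hφ' _)
    simpa using this
  have hcov : ∀ i j, ProbabilityTheory.covariance (X i) (X j) (labelLaw (Fin k)) ≤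
      (2 * ‖φ‖) ^ 2 := by
    intro i j
    unfold ProbabilityTheory.covariance
    refine (le_abs_self _).trans ?_
    have := norm_integral_le_of_norm_le_const (μ := labelLaw (Fin k))
      (f := fun c => (X i c - ∫ c, X i c ∂labelLaw (Fin k)) *
        (X j c - ∫ c, X j c ∂labelLaw (Fin k))) (C := (2 * ‖φ‖) ^ 2)
      (Eventually.of_forall fun c => by
        rw [norm_mul, pow_two]
        have h1 : ∀ j, ‖X j c - ∫ c, X j c ∂labelLaw (Fin k)‖ ≤ 2 * ‖φ‖ := fun j =>
          (norm_sub_le _ _).trans (by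
            have := hE j
            have := hφ' (labelPt τ c j)
            simp only [Real.norm_eq_abs, X] at *
            linarith)
        exact mul_le_mul (h1 i) (h1 j) (norm_nonneg _) (by positivity))
    simpa using this
  -- the points whose window meets that of `i`
  let D : Fin k → Finset (Fin k) := fun i =>
    (F ×ˢ F).image fun q => (τ q.2⁻¹)⁻¹ (τ q.1⁻¹ i)
  have hcov0 : ∀ i j, j ∉ D i →
      ProbabilityTheory.covariance (X i) (X j) (labelLaw (Fin k)) = 0 := by
    intro i j hj
    refine (indepFun_labelPt τ φ N fun g l hg hl hgl => hj ?_).covariance_eq_zero (hX i) (hX j)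
    refine Finset.mem_image.2 ⟨(g, l), Finset.mem_product.2 ⟨(hF g).2 hg, (hF l).2 hl⟩, ?_⟩
    simp only [hgl]
    exact (τ l⁻¹).symm_apply_apply j
  have hrow : ∀ i, ∑ j, ProbabilityTheory.covariance (X i) (X j) (labelLaw (Fin k)) ≤
      F.card ^ 2 * (2 * ‖φ‖) ^ 2 := by
    intro i
    rw [← Finset.sum_subset (Finset.subset_univ (D i)) fun j _ hj => hcov0 i j hj]
    refine (Finset.sum_le_card_nsmul _ _ _ fun j _ => hcov i j).trans ?_
    rw [nsmul_eq_mul]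
    refine mul_le_mul_of_nonneg_right ?_ (by positivity)
    have := Finset.card_image_le (s := F ×ˢ F) (f := fun q : G × G => (τ q.2⁻¹)⁻¹ (τ q.1⁻¹ i))
    rw [Finset.card_product, ← pow_two] at this
    exact_mod_cast this
  rw [e1, ProbabilityTheory.variance_const_mul, ProbabilityTheory.variance_sum' fun j _ => hX j]
  have h1 := Finset.sum_le_sum fun i (_ : i ∈ Finset.univ) => hrow i
  rw [Finset.sum_const, Finset.card_univ, Fintype.card_fin, nsmul_eq_mul] at h1
  refine (mul_le_mul_of_nonneg_left h1 (by positivity)).trans (le_of_eq ?_)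
  rcases Nat.eq_zero_or_pos k with rfl | hk
  · simp
  · have : (k : ℝ) ≠ 0 := by exact_mod_cast hk.ne'
    field_simp

end RandomLabels

/-! ### Convergence of randomly labelled models -/

theorem eventually_act_mul {G : Type*} [Group G] {d : ℕ → ℕ} {σ : ∀ n, G → Equiv.Perm (Fin (d n))}
    (hσ : IsApproxHom σ) {ω : Ultrafilter ℕ} (hω : (ω : Filter ℕ) ≤ cofinite) (g h : G) :
    ∀ᶠ x in loebFilter ω d, act (σ · (g * h)) x = act (σ · g) (act (σ · h) x) := by
  rw [Nat.cofinite_eq_atTop] at hω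
  exact (tendsto_hammDist_iff (σ · (g * h)) ((σ · g) * (σ · h))).1 ((hσ g h).mono_left hω)

theorem eventually_act_one {G : Type*} [Group G] {d : ℕ → ℕ} {σ : ∀ n, G → Equiv.Perm (Fin (d n))}
    (hσ : IsApproxHom σ) {ω : Ultrafilter ℕ} (hω : (ω : Filter ℕ) ≤ cofinite) :
    ∀ᶠ x in loebFilter ω d, act (σ · 1) x = x := by
  filter_upwards [eventually_act_mul hσ hω 1 1] with x hx
  rw [mul_one] at hx
  exact (act_injective _ hx).symm

theorem integral_stabLaw {G : Type*} [Countable G] {k : ℕ} [NeZero k] (τ : G → Equiv.Perm (Fin k))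
    {F : (G → Bool) → ℝ} (hF : Continuous F) :
    ∫ b, F b ∂(stabLaw τ : Measure (G → Bool)) = (k : ℝ)⁻¹ * ∑ j, F (stabIndicator τ j) := by
  change ∫ b, F b ∂(Measure.map _ _) = _
  rw [integral_map (measurable_of_finite _).aemeasurable hF.measurable.aestronglyMeasurable]
  have h1 : ProbabilityTheory.uniformOn (Set.univ : Set (Fin k)) =
      (k : ℝ≥0∞)⁻¹ • Measure.count := by
    ext s _
    rw [ProbabilityTheory.uniformOn_univ, Measure.smul_apply, smul_eq_mul, Fintype.card_fin,
      ENNReal.div_eq_inv_mul]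
  rw [h1, integral_smul_measure, integral_count]
  simp

section Moments
variable {G : Type*} [Group G] [Countable G] {d : ℕ → ℕ} [∀ n, NeZero (d n)]
  {σ : ∀ n, G → Equiv.Perm (Fin (d n))} {ω : Ultrafilter ℕ}

theorem tendsto_mean_stabIndicator (σ : ∀ n, G → Equiv.Perm (Fin (d n))) (ω : Ultrafilter ℕ)
    {F : (G → Bool) → ℝ} (hF : Continuous F) :
    Tendsto (mean fun x => F (stabIndicator (σ x.1) x.2)) ω
      (𝓝 (∫ b, F b ∂(limStabLaw σ ω : Measure (G → Bool)))) := by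
  have h := ProbabilityMeasure.tendsto_iff_forall_integral_tendsto.1 (tendsto_limStabLaw σ ω)
    (BoundedContinuousFunction.mkOfCompact ⟨F, hF⟩)
  refine h.congr fun n => ?_
  exact integral_stabLaw (σ n) hF

/-- Inside a finite window, almost all points of the models look like points of an action. -/
theorem eventually_window (hσ : IsApproxHom σ) (hω : (ω : Filter ℕ) ≤ cofinite) (N : ℕ) :
    ∀ᶠ x in loebFilter ω d, ∀ g l, enum G g < N → enum G l < N →
      (σ x.1 l⁻¹ x.2 = σ x.1 g⁻¹ x.2 ↔ σ x.1 (l * g⁻¹) x.2 = x.2) := by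
  have h1 : ∀ᶠ x in loebFilter ω d, ∀ g ∈ {g | enum G g < N}, ∀ l ∈ {g | enum G g < N},
      (σ x.1 l⁻¹ x.2 = σ x.1 g⁻¹ x.2 ↔ σ x.1 (l * g⁻¹) x.2 = x.2) := by
    rw [eventually_all_finite (finite_enum_lt G N)]
    intro g _
    rw [eventually_all_finite (finite_enum_lt G N)]
    intro l _
    filter_upwards [eventually_act_mul hσ hω l g⁻¹, eventually_act_mul hσ hω l l⁻¹,
      eventually_act_one hσ hω] with x h1 h2 h3
    obtain ⟨n, j⟩ := x
    rw [mul_inv_cancel, h3] at h2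
    have h1' : σ n (l * g⁻¹) j = σ n l (σ n g⁻¹ j) := eq_of_heq (Sigma.mk.inj h1).2
    have h2' : j = σ n l (σ n l⁻¹ j) := eq_of_heq (Sigma.mk.inj h2).2
    change σ n l⁻¹ j = σ n g⁻¹ j ↔ σ n (l * g⁻¹) j = j
    rw [h1', ← (σ n l).injective.eq_iff, ← h2']
    exact eq_comm
  filter_upwards [h1] with x hx g l hg hl
  exact hx g hg l hl

/-- The expected averages of functions of finitely many labels converge. -/
theorem tendsto_integral_labelMean_trunc (hσ : IsApproxHom σ) (hω : (ω : Filter ℕ) ≤ cofinite)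
    (φ : C(LabelSpace G, ℝ)) (N : ℕ) :
    Tendsto (fun n => ∫ c, labelMean (σ n) (fun p => φ (truncLabel N p)) c ∂labelLaw (Fin (d n))) ω
      (𝓝 (∫ p, φ (truncLabel N p) ∂cosetLabelLaw (limStabLaw σ ω : Measure (G → Bool)))) := by
  let φ' : C(LabelSpace G, ℝ) := ⟨fun p => φ (truncLabel N p),
    φ.continuous.comp (continuous_truncLabel N)⟩
  let Ψ : (G → Bool) → ℝ := fun b => ∫ u, φ' (relabel (b, u)) ∂labelLaw G
  have hcont : Continuous fun q : LabelSpace G => φ' (relabel q) :=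
    φ'.continuous.comp continuous_relabel
  have hΨ : Continuous Ψ := by
    refine continuous_of_dominated (bound := fun _ => ‖φ'‖) (fun b => ?_) (fun b => ?_)
      (integrable_const _) (Eventually.of_forall fun u => ?_)
    · exact (hcont.comp (by fun_prop : Continuous fun u => (b, u))).aestronglyMeasurable
    · exact Eventually.of_forall fun u => φ'.norm_coe_le_norm _
    · exact hcont.comp (by fun_prop : Continuous fun b => (b, u))
  have hlim : ∫ p, φ (truncLabel N p) ∂cosetLabelLaw (limStabLaw σ ω : Measure (G → Bool)) =
      ∫ b, Ψ b ∂(limStabLaw σ ω : Measure (G → Bool)) := by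
    unfold cosetLabelLaw
    change ∫ p, φ' p ∂_ = _
    rw [integral_map continuous_relabel.measurable.aemeasurable
      φ'.continuous.measurable.aestronglyMeasurable, integral_prod]
    exact Integrable.of_bound hcont.aestronglyMeasurable ‖φ'‖
      (Eventually.of_forall fun q => φ'.norm_coe_le_norm _)
  rw [hlim]
  have h1 := tendsto_mean_stabIndicator σ ω hΨ
  let E : Pts d → ℝ := fun x => ∫ c, φ' (labelPt (σ x.1) c x.2) ∂labelLaw (Fin (d x.1))
  have hE : ∀ n, ∫ c, labelMean (σ n) (fun p => φ (truncLabel N p)) c ∂labelLaw (Fin (d n)) =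
      mean E n := by
    intro n
    unfold labelMean mean
    rw [integral_const_mul, integral_finsetSum, smul_eq_mul]
    · rfl
    · exact fun j _ => (memLp_labelPt (σ n) φ' j 1).integrable le_rfl
  simp only [hE]
  have hdiff : Tendsto (fun x => E x - Ψ (stabIndicator (σ x.1) x.2)) (loebFilter ω d) (𝓝 0) := by
    refine tendsto_const_nhds.congr' ?_
    filter_upwards [eventually_window hσ hω N] with x hx
    rw [eq_comm, sub_eq_zero]
    exact integral_labelPt_eq hx φ
  have hb : ∃ M, ∀ x, ‖E x - Ψ (stabIndicator (σ x.1) x.2)‖ ≤ M := by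
    refine ⟨‖φ'‖ + ‖φ'‖, fun x => (norm_sub_le _ _).trans (add_le_add ?_ ?_)⟩
    · have := norm_integral_le_of_norm_le_const (μ := labelLaw (Fin (d x.1)))
        (f := fun c => φ' (labelPt (σ x.1) c x.2))
        (Eventually.of_forall fun c => φ'.norm_coe_le_norm _)
      simpa using this
    · have := norm_integral_le_of_norm_le_const (μ := labelLaw G)
        (f := fun u => φ' (relabel (stabIndicator (σ x.1) x.2, u)))
        (Eventually.of_forall fun c => φ'.norm_coe_le_norm _)
      simpa using this
  have h2 : Tendsto (fun n => mean E n - mean (fun x => Ψ (stabIndicator (σ x.1) x.2)) n) ω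
      (𝓝 0) := by
    refine squeeze_zero_norm (fun n => ?_) ((mean_norm_tendsto_zero_iff hb).2 hdiff)
    rw [← mean_sub]
    exact norm_mean_le _ n
  simpa using h2.add h1

/-- Averages over randomly labelled models converge in mean square. -/
theorem tendsto_integral_labelMean_sq (hσ : IsApproxHom σ) (hω : (ω : Filter ℕ) ≤ cofinite)
    (hd : Tendsto d ω atTop) (φ : C(LabelSpace G, ℝ)) :
    Tendsto (fun n => ∫ c, (labelMean (σ n) φ c -
      ∫ p, φ p ∂cosetLabelLaw (limStabLaw σ ω : Measure (G → Bool))) ^ 2 ∂labelLaw (Fin (d n))) ω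
      (𝓝 0) := by
  set κ := cosetLabelLaw (limStabLaw σ ω : Measure (G → Bool)) with hκ
  rw [Metric.tendsto_nhds]
  intro ε hε
  obtain ⟨δ, hδ, hδε⟩ : ∃ δ > 0, 8 * δ ^ 2 < ε / 2 := by
    refine ⟨min 1 (ε / 32), by positivity, ?_⟩
    have h1 := min_le_left (1 : ℝ) (ε / 32)
    have h2 := min_le_right (1 : ℝ) (ε / 32)
    have h3 : 0 < min 1 (ε / 32) := by positivity
    nlinarith
  obtain ⟨N, hN⟩ := exists_truncLabel_near φ hδ
  let φ' : C(LabelSpace G, ℝ) := ⟨fun p => φ (truncLabel N p),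
    φ.continuous.comp (continuous_truncLabel N)⟩
  have hφ' : ∀ p, |φ p - φ' p| ≤ δ := fun p => by
    rw [abs_sub_comm]; exact (hN p).le
  have hmean : ∀ n c, |labelMean (σ n) φ c - labelMean (σ n) φ' c| ≤ δ := by
    intro n c
    -- `c` labels the `n`-th model only, so the functions on the other models are set to `0`
    have h1 := norm_mean_le (d := d)
      (fun x => if hx : x.1 = n then φ (labelPt (σ n) c (hx ▸ x.2)) -
        φ' (labelPt (σ n) c (hx ▸ x.2)) else 0) n
    have h2 := mean_le_of_le (d := d) (c := δ)
      (a := fun x => ‖(if hx : x.1 = n then φ (labelPt (σ n) c (hx ▸ x.2)) -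
        φ' (labelPt (σ n) c (hx ▸ x.2)) else 0)‖) (fun x => by
        split_ifs with hx
        · exact hφ' _
        · simpa using hδ.le) n
    refine le_trans (le_of_eq ?_) (h1.trans h2)
    simp [labelMean, mean, Finset.sum_sub_distrib, mul_sub]
  have hint : |∫ p, φ' p ∂κ - ∫ p, φ p ∂κ| ≤ δ := by
    have i1 : ∀ ψ : C(LabelSpace G, ℝ), Integrable ψ κ := fun ψ =>
      Integrable.of_bound ψ.continuous.aestronglyMeasurable ‖ψ‖
        (Eventually.of_forall fun q => ψ.norm_coe_le_norm _)
    rw [← integral_sub (i1 φ') (i1 φ)]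
    have := norm_integral_le_of_norm_le_const (μ := κ) (f := fun p => φ' p - φ p)
      (Eventually.of_forall fun p => (hN p).le)
    simpa using this
  have hA := tendsto_integral_labelMean_trunc hσ hω φ N
  have hA2 := ((hA.sub_const (∫ p, φ' p ∂κ)).pow 2).const_mul 4
  have hV : Tendsto (fun n => 4 * (((finite_enum_lt G N).toFinset.card ^ 2 * (2 * ‖φ‖) ^ 2) *
      (d n : ℝ)⁻¹)) ω (𝓝 (4 * (((finite_enum_lt G N).toFinset.card ^ 2 * (2 * ‖φ‖) ^ 2) * 0))) :=
    ((tendsto_inv_atTop_zero.comp (tendsto_natCast_atTop_atTop.comp hd)).const_mul _).const_mul _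
  have hlim := hA2.add hV
  rw [show (∫ p, φ (truncLabel N p) ∂κ) = ∫ p, φ' p ∂κ from rfl, sub_self] at hlim
  simp only [ne_eq, OfNat.ofNat_ne_zero, not_false_eq_true, zero_pow, mul_zero, add_zero] at hlim
  filter_upwards [hlim.eventually_lt_const (show 0 < ε / 2 by positivity)] with n hn
  rw [Real.dist_eq, sub_zero, abs_of_nonneg (integral_nonneg fun c => sq_nonneg _)]
  set A := ∫ c, labelMean (σ n) (fun p => φ (truncLabel N p)) c ∂labelLaw (Fin (d n)) with hAdef
  have hvar : ProbabilityTheory.variance (labelMean (σ n) φ') (labelLaw (Fin (d n))) ≤ _ :=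
    variance_labelMean_le (σ n) φ N
  rw [ProbabilityTheory.variance_eq_integral (memLp_labelMean (σ n) φ' 1).1.aemeasurable] at hvar
  have hsq : Integrable (fun c => (labelMean (σ n) φ' c - A) ^ 2) (labelLaw (Fin (d n))) :=
    ((memLp_labelMean (σ n) φ' 2).sub (memLp_const A)).integrable_sq
  calc _ ≤ ∫ c, (4 * (labelMean (σ n) φ' c - A) ^ 2 +
        (4 * (A - ∫ p, φ' p ∂κ) ^ 2 + 8 * δ ^ 2)) ∂labelLaw (Fin (d n)) := by
        refine integral_mono_of_nonneg (Eventually.of_forall fun c => sq_nonneg _)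
          ((hsq.const_mul 4).add (integrable_const _)) (Eventually.of_forall fun c => ?_)
        have h1 := abs_le.1 (hmean n c)
        have h2 := abs_le.1 hint
        have h3 : (labelMean (σ n) φ c - labelMean (σ n) φ' c +
            (∫ p, φ' p ∂κ - ∫ p, φ p ∂κ)) ^ 2 ≤ (2 * δ) ^ 2 :=
          sq_le_sq' (by linarith) (by linarith)
        simp only
        nlinarith [sq_nonneg ((labelMean (σ n) φ c - labelMean (σ n) φ' c +
            (∫ p, φ' p ∂κ - ∫ p, φ p ∂κ)) - ((labelMean (σ n) φ' c - A) + (A - ∫ p, φ' p ∂κ))),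
          sq_nonneg ((labelMean (σ n) φ' c - A) - (A - ∫ p, φ' p ∂κ))]
    _ = 4 * ∫ c, (labelMean (σ n) φ' c - A) ^ 2 ∂labelLaw (Fin (d n)) +
        (4 * (A - ∫ p, φ' p ∂κ) ^ 2 + 8 * δ ^ 2) := by
        rw [integral_add (hsq.const_mul 4) (integrable_const _), integral_const_mul,
          integral_const]
        simp
    _ < ε := by
        have h4 : ∫ c, (labelMean (σ n) φ' c - A) ^ 2 ∂labelLaw (Fin (d n)) ≤ _ := hvar
        linarith

/-- Some labelling of the finite models distributes them along the limit law. -/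
theorem exists_labelling (hσ : IsApproxHom σ) (hω : (ω : Filter ℕ) ≤ cofinite)
    (hd : Tendsto d ω atTop) : ∃ c : ∀ n, Fin (d n) → unitInterval, ∀ φ : C(LabelSpace G, ℝ),
      Tendsto (mean fun x : Pts d => φ (labelPt (σ x.1) (c x.1) x.2)) ω
        (𝓝 (∫ p, φ p ∂cosetLabelLaw (limStabLaw σ ω : Measure (G → Bool)))) := by
  set κ := cosetLabelLaw (limStabLaw σ ω : Measure (G → Bool)) with hκ
  let ψ : ℕ → C(LabelSpace G, ℝ) := TopologicalSpace.denseSeq _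
  have hP : ∀ k, ∀ᶠ n in (ω : Filter ℕ), ∃ c : Fin (d n) → unitInterval,
      ∀ i ∈ Finset.range (k + 1), |labelMean (σ n) (ψ i) c - ∫ p, ψ i p ∂κ| ≤ 1 / (k + 1) := by
    intro k
    have h1 := tendsto_finsetSum (Finset.range (k + 1)) fun i _ =>
      tendsto_integral_labelMean_sq hσ hω hd (ψ i)
    rw [Finset.sum_const_zero] at h1
    have hk : (0 : ℝ) < 1 / (k + 1) := Nat.one_div_pos_of_nat
    filter_upwards [h1.eventually_lt_const (show (0 : ℝ) < (1 / (k + 1)) ^ 2 by positivity)]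
      with n hn
    have hi : ∀ i ∈ Finset.range (k + 1), Integrable
        (fun c => (labelMean (σ n) (ψ i) c - ∫ p, ψ i p ∂κ) ^ 2) (labelLaw (Fin (d n))) :=
      fun i _ => ((memLp_labelMean (σ n) (ψ i) 2).sub (memLp_const _)).integrable_sq
    rw [← integral_finsetSum _ hi] at hn
    -- some `c` does not exceed the expected sum of the squared errors
    obtain ⟨c, hc⟩ := exists_le_integral (integrable_finsetSum _ hi)
    refine ⟨c, fun i hi => abs_le_of_sq_le_sq ?_ hk.le⟩
    exact (Finset.single_le_sum (f := fun i => (labelMean (σ n) (ψ i) c - ∫ p, ψ i p ∂κ) ^ 2)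
      (fun i _ => sq_nonneg _) hi).trans (hc.trans hn.le)
  obtain ⟨κ', h1, h2⟩ := exists_diagonal hω hP
  have h3 : ∀ n, ∃ c : Fin (d n) → unitInterval, (∃ c : Fin (d n) → unitInterval,
      ∀ i ∈ Finset.range (κ' n + 1), |labelMean (σ n) (ψ i) c - ∫ p, ψ i p ∂κ| ≤ 1 / (κ' n + 1)) →
      ∀ i ∈ Finset.range (κ' n + 1), |labelMean (σ n) (ψ i) c - ∫ p, ψ i p ∂κ| ≤ 1 / (κ' n + 1) := by
    intro n
    by_cases h : ∃ c : Fin (d n) → unitInterval,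
      ∀ i ∈ Finset.range (κ' n + 1), |labelMean (σ n) (ψ i) c - ∫ p, ψ i p ∂κ| ≤ 1 / (κ' n + 1)
    · exact ⟨h.choose, fun _ => h.choose_spec⟩
    · exact ⟨fun _ => 0, fun h' => absurd h' h⟩
  choose c hc using h3
  refine ⟨c, fun φ => ?_⟩
  have hdense : ∀ i, Tendsto (mean fun x : Pts d => ψ i (labelPt (σ x.1) (c x.1) x.2)) ω
      (𝓝 (∫ p, ψ i p ∂κ)) := by
    intro i
    rw [Metric.tendsto_nhds]
    intro ε hε
    obtain ⟨m, hm⟩ := exists_nat_one_div_lt hε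
    filter_upwards [h1, h2 i, h2 m] with n hn1 hn2 hn3
    refine lt_of_le_of_lt (hc n hn1 i (Finset.mem_range.2 (Nat.lt_succ_of_le hn2))) ?_
    exact (Nat.one_div_le_one_div hn3).trans_lt hm
  rw [Metric.tendsto_nhds]
  intro ε hε
  obtain ⟨i, hi⟩ := (TopologicalSpace.denseRange_denseSeq C(LabelSpace G, ℝ)).exists_dist_lt φ
    (show 0 < ε / 4 by positivity)
  have hφ : ∀ p, ‖φ p - ψ i p‖ ≤ ε / 4 := fun p => by
    rw [← dist_eq_norm]
    exact (ContinuousMap.dist_apply_le_dist p).trans hi.le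
  have i1 : ∀ ψ : C(LabelSpace G, ℝ), Integrable ψ κ := fun ψ =>
    Integrable.of_bound ψ.continuous.aestronglyMeasurable ‖ψ‖
      (Eventually.of_forall fun q => ψ.norm_coe_le_norm _)
  have hint : ‖∫ p, φ p ∂κ - ∫ p, ψ i p ∂κ‖ ≤ ε / 4 := by
    rw [← integral_sub (i1 φ) (i1 (ψ i))]
    have := norm_integral_le_of_norm_le_const (μ := κ) (f := fun p => φ p - ψ i p)
      (Eventually.of_forall hφ)
    simpa using this
  filter_upwards [Metric.tendsto_nhds.1 (hdense i) (ε / 4) (by positivity)] with n hn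
  have hm : ‖mean (fun x : Pts d => φ (labelPt (σ x.1) (c x.1) x.2)) n -
      mean (fun x : Pts d => ψ i (labelPt (σ x.1) (c x.1) x.2)) n‖ ≤ ε / 4 := by
    rw [← mean_sub]
    exact (norm_mean_le _ n).trans (mean_le_of_le (fun x => hφ _) n)
  rw [Real.dist_eq] at hn ⊢
  rw [Real.norm_eq_abs] at hm hint
  rw [abs_le] at hm hint
  rw [abs_lt] at hn ⊢
  constructor <;> linarith [hm.1, hm.2, hn.1, hn.2, hint.1, hint.2]

end Moments

/-! ### The invariant random subgroup and the Bernoulli space as Borel spaces -/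

section Embedding
variable {G : Type*} [Group G] [Countable G]

@[simp] theorem subgroupIndicator_eq_true (H : Subgroup G) (g : G) :
    subgroupIndicator H g = true ↔ g ∈ H := by
  simp [subgroupIndicator]

theorem mem_range_subgroupIndicator (b : G → Bool) : b ∈ Set.range (subgroupIndicator (G := G)) ↔
    b 1 = true ∧ (∀ g h, b g = true → b h = true → b (g * h) = true) ∧
      ∀ g, b g = true → b g⁻¹ = true := by
  constructor
  · rintro ⟨H, rfl⟩
    simp only [subgroupIndicator_eq_true]
    exact ⟨H.one_mem, fun g h => H.mul_mem, fun g => H.inv_mem⟩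
  · rintro ⟨h1, h2, h3⟩
    refine ⟨{ carrier := {g | b g = true}, mul_mem' := fun {g h} => h2 g h, one_mem' := h1,
              inv_mem' := fun {g} => h3 g }, funext fun g => ?_⟩
    rw [Bool.eq_iff_iff, subgroupIndicator_eq_true]
    rfl

theorem measurableSet_forall_of_countable {α ι : Type*} [MeasurableSpace α] [Countable ι]
    {p : ι → α → Prop} (hp : ∀ i, MeasurableSet {a | p i a}) : MeasurableSet {a | ∀ i, p i a} := by
  have h : {a | ∀ i, p i a} = ⋂ i, {a | p i a} := by ext a; simp
  rw [h]
  exact MeasurableSet.iInter hp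

theorem measurableSet_apply_eq_true (g : G) : MeasurableSet {b : G → Bool | b g = true} :=
  (measurable_pi_apply (X := fun _ : G => Bool) g) (measurableSet_singleton true)

theorem measurableSet_range_subgroupIndicator :
    MeasurableSet (Set.range (subgroupIndicator (G := G))) := by
  have h : Set.range (subgroupIndicator (G := G)) = {b | b 1 = true ∧
      (∀ g h, b g = true → b h = true → b (g * h) = true) ∧ ∀ g, b g = true → b g⁻¹ = true} :=
    Set.ext mem_range_subgroupIndicator
  rw [h]
  have hm := measurableSet_apply_eq_true (G := G)
  refine (hm 1).inter (MeasurableSet.inter ?_ ?_)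
  · refine measurableSet_forall_of_countable fun g => measurableSet_forall_of_countable fun h => ?_
    exact (hm g).imp ((hm h).imp (hm (g * h)))
  · exact measurableSet_forall_of_countable fun g => (hm g).imp (hm g⁻¹)

theorem subgroupIndicator_injective : Function.Injective (subgroupIndicator (G := G)) := by
  intro H K h
  ext g
  rw [← subgroupIndicator_eq_true, h, subgroupIndicator_eq_true]

theorem measurableEmbedding_subgroupIndicator :
    MeasurableEmbedding (subgroupIndicator (G := G)) :=
  MeasurableEmbedding.iff_comap_eq.2
    ⟨subgroupIndicator_injective, rfl, measurableSet_range_subgroupIndicator⟩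

/-- The embedding of the Bernoulli space into the compact space `{0,1}^G × [0,1]^G`. -/
def bernEmbed (y : BernSpace G unitInterval) : LabelSpace G := (subgroupIndicator y.1.1, y.1.2)

theorem bernEmbed_injective : Function.Injective (bernEmbed (G := G)) := by
  rintro ⟨⟨H, x⟩, hx⟩ ⟨⟨K, z⟩, hz⟩ h
  have h1 : subgroupIndicator H = subgroupIndicator K := congrArg Prod.fst h
  have h2 : x = z := congrArg Prod.snd h
  exact Subtype.ext (Prod.ext (subgroupIndicator_injective h1) h2)

theorem measurableSet_coset_invariant : MeasurableSet {p : Subgroup G × (G → unitInterval) |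
    ∀ g : G, ∀ h ∈ p.1, p.2 (h * g) = p.2 g} := by
  refine measurableSet_forall_of_countable fun g => measurableSet_forall_of_countable fun h => ?_
  refine MeasurableSet.imp (measurable_fst (measurable_mem_subgroup h)) ?_
  exact measurableSet_eq_fun ((measurable_pi_apply _).comp measurable_snd)
    ((measurable_pi_apply _).comp measurable_snd)

theorem measurableEmbedding_bernEmbed : MeasurableEmbedding (bernEmbed (G := G)) := by
  refine MeasurableEmbedding.iff_comap_eq.2 ⟨bernEmbed_injective, ?_, ?_⟩
  · change MeasurableSpace.comap bernEmbed (MeasurableSpace.comap Prod.fst _ ⊔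
      MeasurableSpace.comap Prod.snd _) = MeasurableSpace.comap Subtype.val
        (MeasurableSpace.comap Prod.fst (MeasurableSpace.comap subgroupIndicator _) ⊔
          MeasurableSpace.comap Prod.snd _)
    rw [MeasurableSpace.comap_sup, MeasurableSpace.comap_sup, MeasurableSpace.comap_comp,
      MeasurableSpace.comap_comp, MeasurableSpace.comap_comp, MeasurableSpace.comap_comp,
      MeasurableSpace.comap_comp]
    rfl
  · have h : Set.range (bernEmbed (G := G)) = {p : LabelSpace G |
        p.1 ∈ Set.range (subgroupIndicator (G := G)) ∧
          ∀ g h : G, p.1 h = true → p.2 (h * g) = p.2 g} := by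
      ext p
      constructor
      · rintro ⟨y, rfl⟩
        exact ⟨⟨y.1.1, rfl⟩, fun g h hh => y.2 g h ((subgroupIndicator_eq_true _ _).1 hh)⟩
      · rintro ⟨⟨H, hH⟩, h⟩
        refine ⟨⟨(H, p.2), fun g k hk => h g k ?_⟩, Prod.ext hH rfl⟩
        rw [← hH]
        exact (subgroupIndicator_eq_true _ _).2 hk
    rw [h]
    refine (measurable_fst measurableSet_range_subgroupIndicator).inter ?_
    refine measurableSet_forall_of_countable fun g => measurableSet_forall_of_countable fun h => ?_
    refine MeasurableSet.imp (measurable_fst (measurableSet_apply_eq_true h)) ?_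
    exact measurableSet_eq_fun ((measurable_pi_apply _).comp measurable_snd)
      ((measurable_pi_apply _).comp measurable_snd)

/-! ### The Bernoulli measure in terms of relabelling -/

theorem cosetRep_subgroupIndicator (H : Subgroup G) (g : G) : cosetRep (subgroupIndicator H) g =
    fiberRep (Quotient.mk (QuotientGroup.rightRel H)) g := by
  refine argminOn_enum_congr (a := g)
    (S := {k | subgroupIndicator H (k * g⁻¹) = true ∨ k = g})
    (S' := {k | Quotient.mk (QuotientGroup.rightRel H) k = Quotient.mk (QuotientGroup.rightRel H) g})
    (Or.inr rfl) rfl fun k _ => ?_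
  simp only [Set.mem_ofPred_eq, subgroupIndicator_eq_true]
  rw [eq_comm (a := Quotient.mk _ k), Quotient.eq, QuotientGroup.rightRel_apply]
  refine or_iff_left_of_imp ?_
  rintro rfl
  simp

theorem cosetRep_eq_iff (H : Subgroup G) (g k : G) :
    cosetRep (subgroupIndicator H) k = cosetRep (subgroupIndicator H) g ↔ k * g⁻¹ ∈ H := by
  rw [cosetRep_subgroupIndicator, cosetRep_subgroupIndicator, ← QuotientGroup.rightRel_apply,
    ← Quotient.eq]
  constructor
  · intro h
    rw [← map_fiberRep (Quotient.mk (QuotientGroup.rightRel H)) g, ← h,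
      map_fiberRep (Quotient.mk (QuotientGroup.rightRel H)) k]
  · exact fun h => fiberRep_congr _ h.symm

/-- Independent labels on the cosets of `H` are independent labels on `G`, read at the
representatives of the cosets. -/
theorem cosetMeasure_eq (H : Subgroup G) : cosetMeasure (volume : Measure unitInterval) H =
    (labelLaw G).map fun u g => u (cosetRep (subgroupIndicator H) g) := by
  simp only [cosetRep_subgroupIndicator]
  exact labelLaw_map_fiberRep (Quotient.mk (QuotientGroup.rightRel H))

/-- `relabel` with subgroups as first components. -/
def subgroupRelabel (p : Subgroup G × (G → unitInterval)) : Subgroup G × (G → unitInterval) :=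
  (p.1, fun g => p.2 (cosetRep (subgroupIndicator p.1) g))

theorem measurable_subgroupRelabel : Measurable (subgroupRelabel (G := G)) := by
  have h1 : Measurable (Prod.map subgroupIndicator id :
      Subgroup G × (G → unitInterval) → LabelSpace G) :=
    measurableEmbedding_subgroupIndicator.measurable.prodMap measurable_id
  exact measurable_fst.prodMk
    (measurable_snd.comp (continuous_relabel.measurable.comp h1))

theorem bind_cosetMeasure (Θ : Measure (Subgroup G)) [SFinite Θ] :
    (Θ.bind fun H => (Measure.dirac H).prod (cosetMeasure (volume : Measure unitInterval) H)) =
      (Θ.prod (labelLaw G)).map subgroupRelabel := by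
  have hu : ∀ H : Subgroup G, Measurable fun (u : G → unitInterval) g =>
      u (cosetRep (subgroupIndicator H) g) :=
    fun H => measurable_pi_iff.2 fun g => measurable_pi_apply _
  have h1 : ∀ H : Subgroup G, (Measure.dirac H).prod (cosetMeasure (volume : Measure unitInterval) H)
      = (labelLaw G).map fun u => subgroupRelabel (H, u) := by
    intro H
    have : IsProbabilityMeasure (cosetMeasure (volume : Measure unitInterval) H) := by
      rw [cosetMeasure_eq]
      exact Measure.isProbabilityMeasure_map (hu H).aemeasurable
    rw [Measure.dirac_prod, cosetMeasure_eq, Measure.map_map measurable_prodMk_left (hu H)]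
    rfl
  simp only [h1]
  have h2 : ∀ H : Subgroup G, Measurable fun u => subgroupRelabel (H, u) :=
    fun H => measurable_subgroupRelabel.comp measurable_prodMk_left
  have h3 : Measurable fun H : Subgroup G => (labelLaw G).map fun u => subgroupRelabel (H, u) := by
    refine Measure.measurable_of_measurable_coe _ fun s hs => ?_
    simp only [Measure.map_apply (h2 _) hs]
    exact measurable_measure_prodMk_left (measurable_subgroupRelabel hs)
  ext s hs
  rw [Measure.bind_apply hs h3.aemeasurable, Measure.map_apply measurable_subgroupRelabel hs,
    Measure.prod_apply (measurable_subgroupRelabel hs)]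
  simp only [Measure.map_apply (h2 _) hs]
  rfl

theorem map_bernEmbed_bernMeasure (Θ : Measure (Subgroup G)) [SFinite Θ] :
    (bernMeasure (volume : Measure unitInterval) Θ).map bernEmbed =
      cosetLabelLaw (Θ.map subgroupIndicator) := by
  let val : BernSpace G unitInterval → Subgroup G × (G → unitInterval) := fun y => y.1
  have hval : MeasurableEmbedding val :=
    MeasurableEmbedding.subtype_coe measurableSet_coset_invariant
  have hind : Measurable (Prod.map subgroupIndicator id :
      Subgroup G × (G → unitInterval) → LabelSpace G) :=
    measurableEmbedding_subgroupIndicator.measurable.prodMap measurable_id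
  have h1 : (bernMeasure (volume : Measure unitInterval) Θ).map val =
      (Θ.prod (labelLaw G)).map subgroupRelabel := by
    have hrange : Set.range val = {p | ∀ g : G, ∀ h ∈ p.1, p.2 (h * g) = p.2 g} :=
      Subtype.range_coe_subtype
    change Measure.map val (Measure.comap val _) = _
    rw [hval.map_comap, bind_cosetMeasure, hrange]
    refine Measure.restrict_eq_self_of_ae_mem ?_
    refine (ae_map_iff measurable_subgroupRelabel.aemeasurable measurableSet_coset_invariant).2
      (Eventually.of_forall ?_)
    rintro ⟨H, u⟩ g h hh
    have hh' : h ∈ H := hh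
    simp only [subgroupRelabel]
    rw [(cosetRep_eq_iff H g (h * g)).2 (by simpa using hh')]
  change Measure.map (Prod.map subgroupIndicator id ∘ val) _ = _
  rw [← Measure.map_map hind hval.measurable, h1, Measure.map_map hind measurable_subgroupRelabel]
  have h2 : (Prod.map subgroupIndicator id ∘ subgroupRelabel :
      Subgroup G × (G → unitInterval) → LabelSpace G) =
        relabel ∘ Prod.map subgroupIndicator id := rfl
  rw [h2, ← Measure.map_map continuous_relabel.measurable hind, cosetLabelLaw,
    ← Measure.map_prod_map Θ (labelLaw G) measurableEmbedding_subgroupIndicator.measurable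
      measurable_id, Measure.map_id]

end Embedding

/-! ### The limit law is concentrated on subgroups -/

section Limit
variable {G : Type*} [Group G] [Countable G] {d : ℕ → ℕ} [∀ n, NeZero (d n)]
  {σ : ∀ n, G → Equiv.Perm (Fin (d n))} {ω : Ultrafilter ℕ}

/-- A clopen condition met by the stabilizers of almost all points of the models holds almost surely
in the limit. -/
theorem limStabLaw_ae {A : Set (G → Bool)} (hA : IsClopen A)
    (h : ∀ᶠ x in loebFilter ω d, stabIndicator (σ x.1) x.2 ∈ A) :
    ∀ᵐ b ∂(limStabLaw σ ω : Measure (G → Bool)), b ∈ A := by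
  have h1 := tendsto_mean_stabIndicator σ ω
    (hA.compl.continuous_indicator (continuous_const (y := (1 : ℝ))))
  have h2 : Tendsto (mean fun x : Pts d => Aᶜ.indicator (fun _ => (1 : ℝ))
      (stabIndicator (σ x.1) x.2)) ω (𝓝 0) := h
  have h3 := tendsto_nhds_unique h1 h2
  rw [integral_indicator hA.compl.isOpen.measurableSet] at h3
  rw [ae_iff]
  change (limStabLaw σ ω : Measure (G → Bool)) Aᶜ = 0
  rw [← measureReal_eq_zero_iff]
  simpa using h3

theorem stabIndicator_eq_true_iff (x : Pts d) (g : G) :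
    stabIndicator (σ x.1) x.2 g = true ↔ act (σ · g) x = x := by
  obtain ⟨n, j⟩ := x
  rw [act_mk_eq_iff]
  simp [stabIndicator]

theorem limStabLaw_ae_mem_range (hσ : IsApproxHom σ) (hω : (ω : Filter ℕ) ≤ cofinite) :
    ∀ᵐ b ∂(limStabLaw σ ω : Measure (G → Bool)), b ∈ Set.range (subgroupIndicator (G := G)) := by
  have hc : ∀ g : G, IsClopen {b : G → Bool | b g = true} := fun g =>
    (isClopen_discrete {true}).preimage (continuous_apply g)
  have himp : ∀ {A B : Set (G → Bool)}, IsClopen A → IsClopen B → IsClopen {b | b ∈ A → b ∈ B} := by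
    intro A B hA hB
    have : {b | b ∈ A → b ∈ B} = Aᶜ ∪ B := by
      ext b; simp [imp_iff_not_or]
    rw [this]
    exact hA.compl.union hB
  have h1 : ∀ᵐ b ∂(limStabLaw σ ω : Measure (G → Bool)), b 1 = true := by
    refine limStabLaw_ae (hc 1) ?_
    filter_upwards [eventually_act_one hσ hω] with x hx
    exact (stabIndicator_eq_true_iff x 1).2 hx
  have h2 : ∀ᵐ b ∂(limStabLaw σ ω : Measure (G → Bool)), ∀ g h,
      b g = true → b h = true → b (g * h) = true := by
    rw [ae_all_iff]; intro g
    rw [ae_all_iff]; intro h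
    refine limStabLaw_ae (himp (hc g) (himp (hc h) (hc (g * h)))) ?_
    filter_upwards [eventually_act_mul hσ hω g h] with x hx hg hh
    refine (stabIndicator_eq_true_iff x _).2 ?_
    rw [hx, (stabIndicator_eq_true_iff x h).1 hh, (stabIndicator_eq_true_iff x g).1 hg]
  have h3 : ∀ᵐ b ∂(limStabLaw σ ω : Measure (G → Bool)), ∀ g, b g = true → b g⁻¹ = true := by
    rw [ae_all_iff]; intro g
    refine limStabLaw_ae (himp (hc g) (hc g⁻¹)) ?_
    filter_upwards [eventually_act_mul hσ hω g⁻¹ g, eventually_act_one hσ hω] with x hx h1 hg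
    refine (stabIndicator_eq_true_iff x _).2 ?_
    rw [inv_mul_cancel, h1, (stabIndicator_eq_true_iff x g).1 hg] at hx
    exact hx.symm
  filter_upwards [h1, h2, h3] with b h1 h2 h3
  exact (mem_range_subgroupIndicator b).2 ⟨h1, h2, h3⟩

theorem map_irs (hσ : IsApproxHom σ) (hω : (ω : Filter ℕ) ≤ cofinite) :
    (irs σ ω).map subgroupIndicator = (limStabLaw σ ω : Measure (G → Bool)) := by
  unfold irs
  rw [measurableEmbedding_subgroupIndicator.map_comap]
  exact Measure.restrict_eq_self_of_ae_mem (limStabLaw_ae_mem_range hσ hω)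

theorem isProbabilityMeasure_irs (hσ : IsApproxHom σ) (hω : (ω : Filter ℕ) ≤ cofinite) :
    IsProbabilityMeasure (irs σ ω) := by
  have h : IsProbabilityMeasure ((irs σ ω).map subgroupIndicator) := by
    rw [map_irs hσ hω]; infer_instance
  exact (Measure.isProbabilityMeasure_map_iff
    measurableEmbedding_subgroupIndicator.measurable.aemeasurable).1 h

theorem map_bernEmbed (hσ : IsApproxHom σ) (hω : (ω : Filter ℕ) ≤ cofinite) :
    (bernMeasure (volume : Measure unitInterval) (irs σ ω)).map bernEmbed =
      cosetLabelLaw (limStabLaw σ ω : Measure (G → Bool)) := by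
  have := isProbabilityMeasure_irs hσ hω
  rw [map_bernEmbed_bernMeasure, map_irs hσ hω]

theorem isProbabilityMeasure_bernMeasure (hσ : IsApproxHom σ) (hω : (ω : Filter ℕ) ≤ cofinite) :
    IsProbabilityMeasure (bernMeasure (volume : Measure unitInterval) (irs σ ω)) := by
  have h : IsProbabilityMeasure
      ((bernMeasure (volume : Measure unitInterval) (irs σ ω)).map bernEmbed) := by
    rw [map_bernEmbed hσ hω]; infer_instance
  exact (Measure.isProbabilityMeasure_map_iff
    measurableEmbedding_bernEmbed.measurable.aemeasurable).1 h

/-- Almost every point of the Bernoulli space over `H` has stabilizer `H`: the labels of distinct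
cosets are almost surely distinct. -/
theorem ae_smul_eq_iff (hσ : IsApproxHom σ) (hω : (ω : Filter ℕ) ≤ cofinite) :
    ∀ᵐ y ∂(bernMeasure (volume : Measure unitInterval) (irs σ ω)),
      ∀ g : G, g • y = y ↔ g ∈ y.1.1 := by
  have h1 : ∀ᵐ p ∂cosetLabelLaw (limStabLaw σ ω : Measure (G → Bool)),
      ∀ g : G, p.2 g⁻¹ = p.2 1 → p.1 g = true := by
    have hms : MeasurableSet {p : LabelSpace G | ∀ g : G, p.2 g⁻¹ = p.2 1 → p.1 g = true} := by
      refine measurableSet_forall_of_countable fun g => MeasurableSet.imp ?_ ?_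
      · exact measurableSet_eq_fun ((measurable_pi_apply _).comp measurable_snd)
          ((measurable_pi_apply _).comp measurable_snd)
      · exact measurable_fst (measurableSet_apply_eq_true g)
    unfold cosetLabelLaw
    refine (ae_map_iff continuous_relabel.measurable.aemeasurable hms).2 ?_
    have h2 := (Measure.quasiMeasurePreserving_fst (μ := (limStabLaw σ ω : Measure (G → Bool)))
      (ν := labelLaw G)).ae (limStabLaw_ae_mem_range hσ hω)
    have h3 := (Measure.quasiMeasurePreserving_snd (μ := (limStabLaw σ ω : Measure (G → Bool)))
      (ν := labelLaw G)).ae (labelLaw_ae_injective G)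
    filter_upwards [h2, h3] with p hp hinj g hg
    obtain ⟨b, u⟩ := p
    obtain ⟨H, rfl⟩ := hp
    have h4 : cosetRep (subgroupIndicator H) g⁻¹ = cosetRep (subgroupIndicator H) 1 := hinj hg
    rw [cosetRep_eq_iff] at h4
    exact (subgroupIndicator_eq_true H g).2 (by simpa using h4)
  rw [← map_bernEmbed hσ hω] at h1
  filter_upwards [ae_of_ae_map measurableEmbedding_bernEmbed.measurable.aemeasurable h1] with y hy g
  constructor
  · intro h
    refine (subgroupIndicator_eq_true _ g).1 (hy g ?_)
    have h2 : (g • y).1.2 1 = y.1.2 1 := by rw [h]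
    have h3 : (g • y).1.2 1 = y.1.2 (g⁻¹ * 1) := rfl
    rw [h3, mul_one] at h2
    exact h2
  · intro h
    refine Subtype.ext (Prod.ext ?_ (funext fun a => y.2 a g⁻¹ (inv_mem h)))
    change y.1.1.map (MulAut.conj g).toMonoidHom = y.1.1
    ext a
    rw [Subgroup.mem_map]
    constructor
    · rintro ⟨k, hk, rfl⟩
      exact mul_mem (mul_mem h hk) (inv_mem h)
    · intro ha
      exact ⟨g⁻¹ * a * g, mul_mem (mul_mem (inv_mem h) ha) h, by simp [MulAut.conj_apply, mul_assoc]⟩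

end Limit

/-! ### The action on labels and the model of the Bernoulli action -/

section Model
variable {G : Type*} [Group G] [Countable G] {d : ℕ → ℕ} [∀ n, NeZero (d n)]
  {σ : ∀ n, G → Equiv.Perm (Fin (d n))} {ω : Ultrafilter ℕ}

/-- The extension of the action of `G` on the Bernoulli space to `{0,1}^G × [0,1]^G`. -/
def labelAct (g : G) (p : LabelSpace G) : LabelSpace G :=
  (fun a => p.1 (g⁻¹ * a * g), fun a => p.2 (g⁻¹ * a))

theorem continuous_labelAct (g : G) : Continuous (labelAct g) := by
  unfold labelAct; fun_prop

theorem bernEmbed_smul (g : G) (y : BernSpace G unitInterval) :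
    bernEmbed (g • y) = labelAct g (bernEmbed y) := by
  refine Prod.ext (funext fun a => ?_) rfl
  rw [Bool.eq_iff_iff]
  change subgroupIndicator (y.1.1.map (MulAut.conj g).toMonoidHom) a = true ↔
    subgroupIndicator y.1.1 (g⁻¹ * a * g) = true
  rw [subgroupIndicator_eq_true, subgroupIndicator_eq_true, Subgroup.mem_map]
  constructor
  · rintro ⟨k, hk, rfl⟩
    simpa [MulAut.conj_apply, mul_assoc] using hk
  · intro ha
    exact ⟨g⁻¹ * a * g, ha, by simp [MulAut.conj_apply, mul_assoc]⟩

/-- A labelling `c` of the models, as a map to `{0,1}^G × [0,1]^G`. -/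
def labelMap (σ : ∀ n, G → Equiv.Perm (Fin (d n))) (c : ∀ n, Fin (d n) → unitInterval)
    (x : Pts d) : LabelSpace G := labelPt (σ x.1) (c x.1) x.2

theorem labelMap_fst (c : ∀ n, Fin (d n) → unitInterval) (x : Pts d) (g : G) :
    (labelMap σ c x).1 g = true ↔ act (σ · g) x = x :=
  stabIndicator_eq_true_iff x g

theorem labelMap_snd (c : ∀ n, Fin (d n) → unitInterval) (x : Pts d) (g : G) :
    (labelMap σ c x).2 g = (fun z : Pts d => c z.1 z.2) (act (σ · g⁻¹) x) := rfl

/-- Labelled models are asymptotically equivariant. -/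
theorem eventually_labelMap_equivariant (hσ : IsApproxHom σ) (hω : (ω : Filter ℕ) ≤ cofinite)
    (c : ∀ n, Fin (d n) → unitInterval) (g : G) {E : Type*} [NormedAddCommGroup E]
    (φ : C(LabelSpace G, E)) {ε : ℝ} (hε : 0 < ε) : ∀ᶠ x in loebFilter ω d,
      ‖φ (labelMap σ c (act (σ · g) x)) - φ (labelAct g (labelMap σ c x))‖ < ε := by
  refine eventually_abs_sub_lt (fun a => ?_) (fun a => ?_) φ hε
  · filter_upwards [eventually_act_mul hσ hω g (g⁻¹ * a * g), eventually_act_mul hσ hω a g]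
      with x h1 h2
    rw [Bool.eq_iff_iff, labelMap_fst]
    change _ ↔ (labelMap σ c x).1 (g⁻¹ * a * g) = true
    rw [labelMap_fst, ← h2, ← (act_injective (σ · g)).eq_iff (a := act (σ · (g⁻¹ * a * g)) x), ← h1]
    rw [show g * (g⁻¹ * a * g) = a * g by group]
  · filter_upwards [eventually_act_mul hσ hω a⁻¹ g] with x h1
    change (labelMap σ c (act (σ · g) x)).2 a = (labelMap σ c x).2 (g⁻¹ * a)
    rw [labelMap_snd, labelMap_snd, ← h1, mul_inv_rev, inv_inv]

theorem tendsto_labelMap_equivariant (hσ : IsApproxHom σ) (hω : (ω : Filter ℕ) ≤ cofinite)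
    (c : ∀ n, Fin (d n) → unitInterval) (g : G) {E : Type*} [NormedAddCommGroup E]
    (φ : C(LabelSpace G, E)) : Tendsto (mean fun x =>
      ‖φ (labelMap σ c (act (σ · g) x)) - φ (labelAct g (labelMap σ c x))‖) ω (𝓝 0) := by
  refine mean_tendsto_zero (fun x => norm_nonneg _) (M := ‖φ‖ + ‖φ‖) (fun x => ?_) fun ε hε => ?_
  · exact (norm_sub_le _ _).trans (add_le_add (φ.norm_coe_le_norm _) (φ.norm_coe_le_norm _))
  · filter_upwards [eventually_labelMap_equivariant hσ hω c g φ hε] with x hx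
    exact hx.le

theorem isModel_labelMap (hσ : IsApproxHom σ) (hω : (ω : Filter ℕ) ≤ cofinite)
    {c : ∀ n, Fin (d n) → unitInterval} (hc : ∀ φ : C(LabelSpace G, ℝ),
      Tendsto (mean fun x : Pts d => φ (labelMap σ c x)) ω
        (𝓝 (∫ p, φ p ∂cosetLabelLaw (limStabLaw σ ω : Measure (G → Bool))))) :
    IsModel ω (bernMeasure (volume : Measure unitInterval) (irs σ ω)) bernEmbed (labelMap σ c) where
  measurableEmbedding := measurableEmbedding_bernEmbed
  tendsto_mean φ := by
    have h := hc φ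
    rwa [← map_bernEmbed hσ hω, measurableEmbedding_bernEmbed.integral_map] at h

/-- The Bernoulli action preserves the measure, as a limit of the counting measures of the models. -/
theorem measurePreserving_smul_bernMeasure (hσ : IsApproxHom σ) (hω : (ω : Filter ℕ) ≤ cofinite)
    (hd : Tendsto d ω atTop) (g : G) : MeasurePreserving (g • ·)
      (bernMeasure (volume : Measure unitInterval) (irs σ ω))
      (bernMeasure (volume : Measure unitInterval) (irs σ ω)) := by
  set μ := bernMeasure (volume : Measure unitInterval) (irs σ ω)
  refine ⟨measurable_const_smul g, ?_⟩
  obtain ⟨c, hc⟩ := exists_labelling hσ hω hd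
  have hemb := measurableEmbedding_bernEmbed (G := G)
  set κ := cosetLabelLaw (limStabLaw σ ω : Measure (G → Bool))
  have hκ : μ.map bernEmbed = κ := map_bernEmbed hσ hω
  have hact := (continuous_labelAct g).measurable
  have hinv : κ.map (labelAct g) = κ := by
    have : IsProbabilityMeasure (κ.map (labelAct g)) :=
      Measure.isProbabilityMeasure_map hact.aemeasurable
    refine ext_of_forall_integral_eq_of_IsFiniteMeasure fun φ => ?_
    rw [integral_map hact.aemeasurable φ.continuous.measurable.aestronglyMeasurable]
    let ψ : C(LabelSpace G, ℝ) := φ.toContinuousMap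
    have h1 := hc (ψ.comp ⟨labelAct g, continuous_labelAct g⟩)
    have h2 : Tendsto (mean fun x : Pts d => ψ (labelMap σ c (act (σ · g) x))) ω
        (𝓝 (∫ p, ψ p ∂κ)) :=
      (hc ψ).congr fun n =>
        (mean_comp_act (σ · g) (fun x : Pts d => ψ (labelMap σ c x)) n).symm
    have h3 : Tendsto (fun n => mean (fun x : Pts d => ψ (labelMap σ c (act (σ · g) x))) n -
        mean (fun x : Pts d => ψ (labelAct g (labelMap σ c x))) n) ω (𝓝 0) := by
      refine squeeze_zero_norm (fun n => ?_) (tendsto_labelMap_equivariant hσ hω c g ψ)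
      rw [← mean_sub]
      exact norm_mean_le _ n
    have h4 := h2.sub h3
    simp only [sub_sub_cancel, sub_zero] at h4
    exact tendsto_nhds_unique h1 h4
  have h5 : (μ.map (g • ·)).map bernEmbed = μ.map bernEmbed := by
    have h6 : (bernEmbed ∘ (g • ·) : BernSpace G unitInterval → LabelSpace G) =
        labelAct g ∘ bernEmbed := funext fun y => bernEmbed_smul g y
    rw [Measure.map_map hemb.measurable (measurable_const_smul g), h6,
      ← Measure.map_map hact hemb.measurable, hκ, hinv]
  rw [← hemb.comap_map (μ.map (g • ·)), h5, hemb.comap_map]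

theorem isActionModel_labelMap (hσ : IsApproxHom σ) (hω : (ω : Filter ℕ) ≤ cofinite)
    (hd : Tendsto d ω atTop) {c : ∀ n, Fin (d n) → unitInterval}
    (hc : ∀ φ : C(LabelSpace G, ℝ), Tendsto (mean fun x : Pts d => φ (labelMap σ c x)) ω
      (𝓝 (∫ p, φ p ∂cosetLabelLaw (limStabLaw σ ω : Measure (G → Bool))))) :
    IsActionModel ω (bernMeasure (volume : Measure unitInterval) (irs σ ω)) bernEmbed
      (labelMap σ c) σ where
  toIsModel := isModel_labelMap hσ hω hc
  approx_mul g h := eventually_act_mul hσ hω g h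
  stabilizer g := by
    have := isProbabilityMeasure_bernMeasure hσ hω
    have h := isModel_labelMap hσ hω hc
    let φ : C(LabelSpace G, ℂ) := ⟨fun p => if p.1 g = true then 1 else 0,
      (continuous_of_discreteTopology (f := fun t : Bool => if t = true then (1 : ℂ) else 0)).comp
        ((continuous_apply g).comp continuous_fst)⟩
    classical
    have e1 : (fun x => φ (labelMap σ c x)) =
        ({x : Pts d | act (σ · g) x = x}.indicator 1 : Pts d → ℂ) := by
      funext x
      simp only [φ, ContinuousMap.coe_mk, labelMap_fst, Set.indicator_apply, Set.mem_ofPred_eq,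
        Pi.one_apply]
    rw [← e1]
    refine (h.represents φ).congr_left ?_
    filter_upwards [ae_smul_eq_iff hσ hω] with y hy
    simp only [φ, ContinuousMap.coe_mk, Set.indicator_apply, Set.mem_ofPred_eq, hy g, Pi.one_apply,
      bernEmbed, subgroupIndicator_eq_true]
  translate g f a hf := by
    have := isProbabilityMeasure_bernMeasure hσ hω
    have hg := measurePreserving_smul_bernMeasure hσ hω hd g
    refine ⟨hf.memLp.comp_measurePreserving hg, ?_, fun ε hε => ?_⟩
    · obtain ⟨M, hM⟩ := hf.bdd
      exact ⟨M, fun x => hM _⟩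
    · obtain ⟨φ, h1, h2⟩ := hf.approx (ε / 2) (by positivity)
      refine ⟨φ.comp ⟨labelAct g, continuous_labelAct g⟩, ?_, ?_⟩
      · have e1 := hg.integral_comp (MeasurableEquiv.smul g).measurableEmbedding
          (fun y => ‖f y - φ (bernEmbed y)‖)
        simp only [bernEmbed_smul] at e1
        refine le_trans (le_of_eq e1) (h1.trans (by linarith))
      · filter_upwards [h2, (tendsto_labelMap_equivariant hσ hω c g φ).eventually_lt_const
          (show 0 < ε / 2 by positivity)] with n hn1 hn2
        rw [← mean_comp_act (σ · g)] at hn1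
        refine (mean_mono (fun x => norm_sub_le_norm_sub_add_norm_sub _
          (φ (labelMap σ c (act (σ · g) x))) _) n).trans ?_
        rw [mean_add]
        exact (add_le_add hn1 hn2.le).trans (by linarith)

end Model

end SoficExtension

end

open SoficExtension in
theorem theorem1 {G : Type*} [Group G] [Countable G] (d : ℕ → ℕ) [∀ n, NeZero (d n)]
    (σ : ∀ n, G → Equiv.Perm (Fin (d n))) (hσ : IsApproxHom σ)
    (ω : Ultrafilter ℕ) (hω : (ω : Filter ℕ) ≤ cofinite) (hd : Tendsto d ω atTop) :
    let μ : Measure (BernSpace G unitInterval) := bernMeasure volume (irs σ ω)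
    let R : Setoid (BernSpace G unitInterval) := MulAction.orbitRel G (BernSpace G unitInterval)
    IsProbabilityMeasure μ ∧
    ∃ hΞ : ∀ g : G, MeasurableEquiv.smul g ∈ fullAut μ R,
    ∃ (ρ : Lp ℂ ∞ μ →ₗ[ℂ] LoebLInfty ω d) (s : FullGroup μ R →* PermUltra ω d),
      IsSoficApproximation μ R ω d ρ s ∧
      ∀ g : G, s (QuotientGroup.mk ⟨MeasurableEquiv.smul g, hΞ g⟩) = ultraMap ω σ g := by
  intro μ R
  have hμ : IsProbabilityMeasure μ := isProbabilityMeasure_bernMeasure hσ hω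
  obtain ⟨c, hc⟩ := exists_labelling hσ hω hd
  have h : IsActionModel ω μ bernEmbed (labelMap σ c) σ := isActionModel_labelMap hσ hω hd hc
  refine ⟨hμ, fun g => ⟨measurePreserving_smul_bernMeasure hσ hω hd g,
    Eventually.of_forall fun y => ?_⟩, h.rho hω, h.permHom hω, h.isSoficApproximation hω,
    fun g => h.permHom_eq hω (representsPerm_smul h g)⟩
  exact R.symm ⟨g, rfl⟩
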